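/- **Setting.** Let $\lambda,\mu,\omega\in\mathbb R$ with $\mu>0$, $\lambda>-\mu$, $\omega>0$, and put $k_p=\omega/\sqrt{\lambda+2\mu}$, $k_s=\omega/\sqrt{\mu}$. Let $\mathbf x:\mathbb R\to\mathbb R^2$ be a smooth, regular ($\mathbf x'\neq0$), $2\pi$-periodic parameterization of a simple closed curve ($\mathbf x(\tau)=\mathbf x(t)$ only if $\tau-t\in2\pi\mathbb Z$). Write $\boldsymbol r=\mathbf x(\tau)-\mathbf x(t)$, $r=|\boldsymbol r|$, $\boldsymbol\nu(t)=(x_2'(t),-x_1'(t))^\top$, $G(\boldsymbol r)=r^{-2}\boldsymbol r\boldsymbol r^\top$, $\phi_n=\frac i4H^{(1)}_n$. Let $$\Phi(\boldsymbol x,\boldsymbol y)=\tfrac1\mu\phi_0(k_s|\boldsymbol x-\boldsymbol y|)I_2+\tfrac1{\omega^2}\nabla_{\boldsymbol x}\nabla_{\boldsymbol x}^\top\big(\phi_0(k_s|\boldsymbol x-\boldsymbol y|)-\phi_0(k_p|\boldsymbol x-\boldsymbol y|)\big)$$ be the fundamental solution of the time-harmonic Navier equation, and for $\sigma(\mathbf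 u)=\mu(\nabla\mathbf u+(\nabla\mathbf u)^\top)+\lambda(\nabla\cdot\mathbf u)I_2$ let $T_t$ (resp. $T_\tau$) denote $\mathbf u\mapsto\sigma(\mathbf u)\boldsymbol\nu(t)$ at the point $\mathbf x(t)$ (resp. $\sigma(\mathbf u)\boldsymbol\nu(\tau)$ at $\mathbf x(\tau)$), applied to matrices column by column. The parameterized kernels are $$V(\tau,t)=\Phi(\mathbf x(\tau),\mathbf x(t)),\quad K(\tau,t)=[T_t\Phi(\mathbf x(\tau),\mathbf x(t))]^\top,\quad W(\tau,t)=T_\tau[T_t\Phi(\mathbf x(\tau),\mathbf x(t))]^\top ,$$ and the elastostatic ones $$V_0=-\tfrac{\lambda+3\mu}{4\pi(\lambda+2\mu)\mu}\log r\,I_2+\tfrac{\lambda+\mu}{4\pi(\lambda+2\mu)\mu}G(\boldsymbol r),$$ $$K_0=\tfrac{\mu}{\lambda+2\mu}\Big(\tfrac{\partial}{\partial t}\tfrac1{2\pi}\log r\Big)\begin{bmatrix}0&-1\\1&0\end{bmatrix}+\tfrac{1}{2\pi r^2}(\boldsymbol\nu(t)\cdot\boldsymbol r)\Big(\tfrac{\mu}{\lambda+2\mu}I_2+2\tfrac{\lambda+\mu}{\lambda+2\mu}G(\boldsymbol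 r)\Big),$$ $$W_0=-\tfrac{\mu(\lambda+\mu)}{\lambda+2\mu}\,\tfrac{\partial^2}{\partial\tau\,\partial t}\,\tfrac1\pi\big(-\log r\,I_2+G(\boldsymbol r)\big).$$ **Claim.** There exist smooth $2\times2$ complex matrix functions $A_{\log},A_{\rm reg},B_{\log},B_{\rm reg},C_{\log},D_{\rm reg}$ of $(\tau,t)\in\mathbb R^2$, $2\pi$-periodic in each variable, such that for all $\tau,t$ with $\mathbf x(\tau)\ne\mathbf x(t)$ $$V=V_0+A_{\log}\sin^2\tfrac{\tau-t}2\,\log r+A_{\rm reg},\quad K=K_0+B_{\log}\sin(\tau-t)\log r+B_{\rm reg},\quad W=W_0+C_{\log}\log r+D_{\rm reg}.$$ Moreover, for all such $\tau,t$ these functions are given explicitly, with the coefficients $a^{(j)},b^{(j)},c^{(j)}$ and matrices $U_i,\tilde U_i,R_i$ listed below (all coefficients evaluated at $z=r$): (V) $A_{\log}\sin^2\frac{\tau-t}2=a^{(2)}_{\log}r^2I_2+a^{(3)}_{\log}r^2G(\boldsymbol r)$ and $A_{\rm reg}=a^{(4)}_{\rm reg}I_2+a^{(5)}_{\rm reg}r^2G(\boldsymbol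 r)$. (K) $K=K_0+\mathcal B_{\log}\log r+\mathcal B_{\rm reg}$, where $\mathcal B_{\log}=b^{(2)}_{\log}U_1^\top+b^{(3)}_{\log}G(\boldsymbol r)U_1^\top+b^{(4)}_{\log}U_2^\top$ and $\mathcal B_{\rm reg}=b^{(5)}_{\rm reg}U_1^\top+b^{(6)}_{\rm reg}G(\boldsymbol r)U_1^\top+b^{(7)}_{\rm reg}U_2^\top$; and $B_{\log}\sin(\tau-t)=\mathcal B_{\log}$, $B_{\rm reg}=\mathcal B_{\rm reg}$ whenever $\cos(\tau-t)\ge\frac{\sqrt2}2$. (W) $C_{\log}=\frac{c^{(1)}_{\log}}{r^2}\tilde U_1U_1^\top+b^{(2)}_{\log}R_1+\frac{c^{(3)}_{\log}}{r^2}\tilde U_1G(\boldsymbol r)U_1^\top+b^{(3)}_{\log}R_3+\frac{c^{(5)}_{\log}}{r^2}\tilde U_1U_2^\top+b^{(4)}_{\log}R_2$ and $D_{\rm reg}=\frac{c^{(7)}_{\rm reg}}{r^2}\tilde U_1U_1^\top+b^{(5)}_{\rm reg}R_1+\frac{c^{(9)}_{\rm reg}}{r^2}\tilde U_1G(\boldsymbol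 r)U_1^\top+b^{(6)}_{\rm reg}R_3+\frac{c^{(11)}_{\rm reg}}{r^2}\tilde U_1U_2^\top+b^{(7)}_{\rm reg}R_2$. *Matrices.* With $m=\boldsymbol\nu(t)$, $n=\boldsymbol\nu(\tau)$: $U_1=\lambda m\boldsymbol r^\top+\mu\boldsymbol r m^\top+\mu(m\cdot\boldsymbol r)I_2$, $U_2=(\lambda+2\mu)m\boldsymbol r^\top+\mu\boldsymbol r m^\top+\mu(m\cdot\boldsymbol r)(I_2-4G(\boldsymbol r))$; $\tilde U_1,\tilde U_2$ are the same expressions with $n$ in place of $m$; with $S=\mu mn^\top+\lambda nm^\top+\mu(n\cdot m)I_2$, $$R_1=2\lambda(\lambda+2\mu)nm^\top+2\mu^2(mn^\top+(n\cdot m)I_2),$$ $$R_2=2(\lambda+2\mu)(\lambda+\mu)nm^\top+2\mu S(I_2-2G(\boldsymbol r))-\tfrac{4\mu(m\cdot\boldsymbol r)}{r^2}\tilde U_2,$$ $$R_3=2\lambda(\lambda+\mu)nm^\top+2\mu S\,G(\boldsymbol r)+\tfrac{2\mu(m\cdot\boldsymbol r)}{r^2}\tilde U_2 .$$ *Coefficients.*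 For $k\in\{k_p,k_s\}$ let $j_{n,k}(z)=J_n(kz)/(kz)^n$, and let $C_{n,k}(z)$ be defined for $z>0$ by $\phi_n(kz)=-\frac1{2\pi}J_n(kz)\log z+z^nC_{n,k}(z)+s_{n,k}(z)$ with $s_{0,k}=0$, $s_{1,k}=\frac1{2\pi kz}$, $s_{2,k}=\frac1{\pi k^2z^2}+\frac1{4\pi}$, $s_{3,k}=\frac4{\pi k^3z^3}+\frac1{2\pi kz}+\frac{kz}{16\pi}$. Abbreviate $j_n^p=j_{n,k_p}(z)$, $C_n^p=C_{n,k_p}(z)$, and likewise with $s$. Then $$a^{(2)}_{\log}=\tfrac1{2\pi z^2\omega^2}\big(-k_p^2j_1^p-k_s^2j_0^s+k_s^2j_1^s+\tfrac{k_s^2+k_p^2}2\big),\quad a^{(3)}_{\log}=\tfrac1{2\pi z^2\omega^2}\big(-k_p^2j_0^p+2k_p^2j_1^p+k_s^2j_0^s-2k_s^2j_1^s\big),$$ $$a^{(4)}_{\rm reg}=\tfrac1{\omega^2}\big(k_pC_1^p+k_s^2C_0^s-k_sC_1^s\big),\quad a^{(5)}_{\rm reg}=\tfrac1{\omega^2z^2}\big(k_p^2C_0^p-2k_pC_1^p-k_s^2C_0^s+2k_sC_1^s+\tfrac{k_p^2-k_s^2}{4\pi}\big),$$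 $$b^{(2)}_{\log}=\tfrac1{2\pi\omega^2}\big(-k_p^4j_2^p-k_s^4j_1^s+k_s^4j_2^s\big),\quad b^{(3)}_{\log}=\tfrac1{2\pi\omega^2}\big(-k_p^4j_1^p+2k_p^4j_2^p+k_s^4j_1^s-2k_s^4j_2^s\big),\quad b^{(4)}_{\log}=-a^{(3)}_{\log},$$ $$b^{(5)}_{\rm reg}=-\tfrac1{\omega^2}\big(-k_s^3C_1^s+k_s^2C_2^s-k_p^2C_2^p\big),\quad b^{(6)}_{\rm reg}=-\tfrac1{\omega^2}\big(k_s^3C_1^s-2k_s^2C_2^s-k_p^3C_1^p+2k_p^2C_2^p\big),\quad b^{(7)}_{\rm reg}=-a^{(5)}_{\rm reg},$$ $$c^{(1)}_{\log}=\tfrac{z^2}{2\pi\omega^2}\big(k_p^6j_3^p+k_s^6j_2^s-k_s^6j_3^s\big),\quad c^{(3)}_{\log}=\tfrac{z^2}{2\pi\omega^2}\big(k_p^6j_2^p-2k_p^6j_3^p-k_s^6j_2^s+2k_s^6j_3^s\big),$$ $$c^{(5)}_{\log}=\tfrac1{2\pi\omega^2z^2}\big(-2k_p^2J_0(k_pz)-k_p^3zJ_1(k_pz)+4k_p^2j_1^p+2k_p^2J_2(k_pz)+2k_s^2J_0(k_sz)+k_s^3zJ_1(k_sz)-4k_s^2j_1^s-2k_s^2J_2(k_sz)\big),$$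 $$c^{(7)}_{\rm reg}=-\tfrac{3k_s^4+k_p^4}{16\pi\omega^2}-\tfrac{z^2}{\omega^2}\big(k_p^3C_3^p+k_s^4C_2^s-k_s^3C_3^s\big),$$ $$c^{(9)}_{\rm reg}=\tfrac{z^2}{\omega^2}\big(2k_p^3C_3^p-k_p^4C_2^p-2k_s^3C_3^s+k_s^4C_2^s\big)-\tfrac{k_p^4-k_s^4}{8\pi\omega^2},$$ $$c^{(11)}_{\rm reg}=-\tfrac1{z^2\omega^2}\Big(-k_p^3z^2C_1^p+2k_p^2z^2C_2^p-2k_p^2C_0^p+4k_pC_1^p+k_s^3z^2C_1^s-2k_s^2z^2C_2^s+2k_s^2C_0^s-4k_sC_1^s-\tfrac{z^2(k_p^4-k_s^4)}{16\pi}-\tfrac{k_p^2-k_s^2}{2\pi}\Big)-\tfrac{k_p^4-k_s^4}{16\pi\omega^2}.$$ -/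

import Mathlib

open scoped ContDiff

noncomputable section

namespace Elastodynamics

/-! ## Bessel and Hankel functions of integer order on the positive half line -/

/-- The Bessel function of the first kind `J_n`. -/
def besselJ (n : ℕ) (z : ℝ) : ℝ :=
  ∑' m : ℕ, (-1) ^ m / ((m.factorial : ℝ) * ((m + n).factorial : ℝ)) * (z / 2) ^ (2 * m + n)

/-- The digamma function at the positive integers: `ψ(m + 1) = H_m - γ`. -/
def digammaSucc (m : ℕ) : ℝ := ((harmonic m : ℚ) : ℝ) - Real.eulerMascheroniConstant

/-- The Bessel function of the second kind `Y_n` (for `z > 0`), by its standard expansion. -/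
def besselY (n : ℕ) (z : ℝ) : ℝ :=
  -(1 / (Real.pi * (z / 2) ^ n)) *
      ∑ m ∈ Finset.range n,
        ((n - m - 1).factorial : ℝ) / (m.factorial : ℝ) * (z ^ 2 / 4) ^ m
    + 2 / Real.pi * Real.log (z / 2) * besselJ n z
    - (z / 2) ^ n / Real.pi *
      ∑' m : ℕ, (digammaSucc m + digammaSucc (n + m)) *
        (-(z ^ 2 / 4)) ^ m / ((m.factorial : ℝ) * ((n + m).factorial : ℝ))

/-- The Hankel function of the first kind `H_n^{(1)} = J_n + i Y_n`. -/
def hankel1 (n : ℕ) (z : ℝ) : ℂ := (besselJ n z : ℂ) + Complex.I * (besselY n z : ℂ)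

/-- `φ_n = (i/4) H_n^{(1)}`. -/
def hphi (n : ℕ) (z : ℝ) : ℂ := Complex.I / 4 * hankel1 n z

/-! ## The Navier equation: stress, traction, fundamental solution -/

/-- The Euclidean plane. -/
abbrev Plane : Type := EuclideanSpace ℝ (Fin 2)

/-- Complex `2 × 2` matrices. -/
abbrev CMat : Type := Matrix (Fin 2) (Fin 2) ℂ

/-- Real `2 × 2` matrices. -/
abbrev RMat : Type := Matrix (Fin 2) (Fin 2) ℝ

/-- A real matrix seen as a complex matrix. -/
def toC (M : RMat) : CMat := M.map Complex.ofReal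

/-- The partial derivative `∂f/∂x_i`. -/
def pd (i : Fin 2) (f : Plane → ℂ) (x : Plane) : ℂ :=
  fderiv ℝ f x (EuclideanSpace.single i (1 : ℝ))

/-- The pressure wave number. -/
def kP (lam mu om : ℝ) : ℝ := om / Real.sqrt (lam + 2 * mu)

/-- The shear wave number. -/
def kS (mu om : ℝ) : ℝ := om / Real.sqrt mu

/-- The strain tensor `ε(u) = (∇u + (∇u)ᵀ) / 2`. -/
def strain (u : Plane → Fin 2 → ℂ) (x : Plane) : CMat :=
  Matrix.of fun i j => (1 / 2 : ℂ) * (pd j (fun y => u y i) x + pd i (fun y => u y j) x)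

/-- The divergence of a planar field. -/
def divergence (u : Plane → Fin 2 → ℂ) (x : Plane) : ℂ := ∑ k, pd k (fun y => u y k) x

/-- The stress tensor `σ(u) = 2μ ε(u) + λ (∇·u) I`. -/
def stress (lam mu : ℝ) (u : Plane → Fin 2 → ℂ) (x : Plane) : CMat :=
  (2 * (mu : ℂ)) • strain u x + ((lam : ℂ) * divergence u x) • (1 : CMat)

/-- The traction `σ(u)(x) n` for a (not necessarily unit) direction `n`. -/
def traction (lam mu : ℝ) (n : Fin 2 → ℝ) (u : Plane → Fin 2 → ℂ) (x : Plane) : Fin 2 → ℂ :=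
  (stress lam mu u x).mulVec fun i => (n i : ℂ)

/-- The traction of a matrix field, applied column by column. -/
def tractionMat (lam mu : ℝ) (n : Fin 2 → ℝ) (F : Plane → CMat) (x : Plane) : CMat :=
  Matrix.of fun i j => traction lam mu n (fun y k => F y k j) x i

/-- The fundamental solution of the time-harmonic Navier equation. -/
def fundSol (lam mu om : ℝ) (x y : Plane) : CMat :=
  ((1 / (mu : ℂ)) * hphi 0 (kS mu om * ‖x - y‖)) • (1 : CMat)
    + (1 / (om : ℂ) ^ 2) • Matrix.of fun i j =>
        pd i (pd j fun z => hphi 0 (kS mu om * ‖z - y‖) - hphi 0 (kP lam mu om * ‖z - y‖)) x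

/-! ## Parameterized kernels -/

/-- The non-normalized normal field `ν = (x₂', -x₁')` of a parameterized curve. -/
def normalField (x : ℝ → Plane) (t : ℝ) : Fin 2 → ℝ := ![deriv x t 1, -deriv x t 0]

/-- Single layer kernel. -/
def kernelV (lam mu om : ℝ) (x : ℝ → Plane) (τ t : ℝ) : CMat := fundSol lam mu om (x τ) (x t)

/-- Double layer kernel `[T_t Φ(x(τ), x(t))]ᵀ`. -/
def kernelK (lam mu om : ℝ) (x : ℝ → Plane) (τ t : ℝ) : CMat :=
  (tractionMat lam mu (normalField x t) (fun y => fundSol lam mu om (x τ) y) (x t)).transpose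

/-- Hypersingular kernel `T_τ [T_t Φ(x(τ), x(t))]ᵀ`. -/
def kernelW (lam mu om : ℝ) (x : ℝ → Plane) (τ t : ℝ) : CMat :=
  tractionMat lam mu (normalField x τ)
    (fun z =>
      (tractionMat lam mu (normalField x t) (fun y => fundSol lam mu om z y) (x t)).transpose)
    (x τ)

/-- `G(r) = r rᵀ / |r|²`. -/
def matG (r : Plane) : RMat := (1 / ‖r‖ ^ 2) • Matrix.of fun i j => r i * r j

/-- Elastostatic single layer kernel. -/
def kernelV0 (lam mu : ℝ) (x : ℝ → Plane) (τ t : ℝ) : RMat :=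
  (-((lam + 3 * mu) / (4 * Real.pi * (lam + 2 * mu) * mu)) * Real.log ‖x τ - x t‖) • (1 : RMat)
    + ((lam + mu) / (4 * Real.pi * (lam + 2 * mu) * mu)) • matG (x τ - x t)

/-- Elastostatic double layer kernel. -/
def kernelK0 (lam mu : ℝ) (x : ℝ → Plane) (τ t : ℝ) : RMat :=
  (mu / (lam + 2 * mu) * deriv (fun s => 1 / (2 * Real.pi) * Real.log ‖x τ - x s‖) t) •
      !![0, -1; 1, 0]
    + (1 / (2 * Real.pi * ‖x τ - x t‖ ^ 2) * (normalField x t ⬝ᵥ ⇑(x τ - x t))) •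
      ((mu / (lam + 2 * mu)) • (1 : RMat)
        + (2 * ((lam + mu) / (lam + 2 * mu))) • matG (x τ - x t))

/-- Elastostatic hypersingular kernel; `∂²/∂τ∂t` is taken entry by entry. -/
def kernelW0 (lam mu : ℝ) (x : ℝ → Plane) (τ t : ℝ) : RMat :=
  (-(mu * (lam + mu) / (lam + 2 * mu))) • Matrix.of fun i j =>
    deriv (fun s => deriv (fun u =>
      1 / Real.pi * ((-Real.log ‖x s - x u‖) • (1 : RMat) + matG (x s - x u)) i j) t) τ

/-! ## Explicit coefficients, functions of `z > 0`

In this part `p`, `s` stand for the wave numbers `k_p`, `k_s`. -/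

/-- `J_n(kz) / (kz)^n`. -/
def jq (n : ℕ) (k z : ℝ) : ℝ := besselJ n (k * z) / (k * z) ^ n

/-- The negative powers (with their companion terms) in the expansion of `φ_n(kz)`, `n ≤ 3`. -/
def hphiSing : ℕ → ℝ → ℝ → ℝ
  | 0, _, _ => 0
  | 1, k, z => 1 / (2 * Real.pi * k * z)
  | 2, k, z => 1 / (Real.pi * k ^ 2 * z ^ 2) + 1 / (4 * Real.pi)
  | 3, k, z => 4 / (Real.pi * k ^ 3 * z ^ 3) + 1 / (2 * Real.pi * k * z)
      + k * z / (16 * Real.pi)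
  | _, _, _ => 0

/-- The regular part `C_{n,k}`, determined for `z > 0` by
`φ_n(kz) = -(1/2π) J_n(kz) log z + z^n C_{n,k}(z) + hphiSing n k z`. -/
def hphiReg (n : ℕ) (k z : ℝ) : ℂ :=
  (hphi n (k * z) + ((1 / (2 * Real.pi) * besselJ n (k * z) * Real.log z : ℝ) : ℂ)
    - (hphiSing n k z : ℂ)) / (z : ℂ) ^ n

def aLog2 (p s om z : ℝ) : ℝ :=
  1 / (2 * Real.pi * z ^ 2 * om ^ 2) *
    (-p ^ 2 * jq 1 p z - s ^ 2 * jq 0 s z + s ^ 2 * jq 1 s z + (s ^ 2 + p ^ 2) / 2)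

def aLog3 (p s om z : ℝ) : ℝ :=
  1 / (2 * Real.pi * z ^ 2 * om ^ 2) *
    (-p ^ 2 * jq 0 p z + 2 * p ^ 2 * jq 1 p z + s ^ 2 * jq 0 s z - 2 * s ^ 2 * jq 1 s z)

def aReg4 (p s om z : ℝ) : ℂ :=
  1 / (om : ℂ) ^ 2 * (p * hphiReg 1 p z + s ^ 2 * hphiReg 0 s z - s * hphiReg 1 s z)

def aReg5 (p s om z : ℝ) : ℂ :=
  1 / ((om : ℂ) ^ 2 * (z : ℂ) ^ 2) *
    (p ^ 2 * hphiReg 0 p z - 2 * p * hphiReg 1 p z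
      - s ^ 2 * hphiReg 0 s z + 2 * s * hphiReg 1 s z
      + 1 / (4 * (Real.pi : ℂ)) * (p ^ 2 - s ^ 2))

def bLog2 (p s om z : ℝ) : ℝ :=
  1 / (2 * Real.pi * om ^ 2) * (-p ^ 4 * jq 2 p z - s ^ 4 * jq 1 s z + s ^ 4 * jq 2 s z)

def bLog3 (p s om z : ℝ) : ℝ :=
  1 / (2 * Real.pi * om ^ 2) *
    (-p ^ 4 * jq 1 p z + 2 * p ^ 4 * jq 2 p z + s ^ 4 * jq 1 s z - 2 * s ^ 4 * jq 2 s z)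

def bLog4 (p s om z : ℝ) : ℝ := -aLog3 p s om z

def bReg5 (p s om z : ℝ) : ℂ :=
  -(1 / (om : ℂ) ^ 2) *
    (-s ^ 3 * hphiReg 1 s z + s ^ 2 * hphiReg 2 s z - p ^ 2 * hphiReg 2 p z)

def bReg6 (p s om z : ℝ) : ℂ :=
  -(1 / (om : ℂ) ^ 2) *
    (s ^ 3 * hphiReg 1 s z - 2 * s ^ 2 * hphiReg 2 s z
      - p ^ 3 * hphiReg 1 p z + 2 * p ^ 2 * hphiReg 2 p z)

def bReg7 (p s om z : ℝ) : ℂ := -aReg5 p s om z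

def cLog1 (p s om z : ℝ) : ℝ :=
  z ^ 2 / (2 * Real.pi * om ^ 2) * (p ^ 6 * jq 3 p z + s ^ 6 * jq 2 s z - s ^ 6 * jq 3 s z)

def cLog3 (p s om z : ℝ) : ℝ :=
  z ^ 2 / (2 * Real.pi * om ^ 2) *
    (p ^ 6 * jq 2 p z - 2 * p ^ 6 * jq 3 p z - s ^ 6 * jq 2 s z + 2 * s ^ 6 * jq 3 s z)

def cLog5 (p s om z : ℝ) : ℝ :=
  1 / (2 * Real.pi * om ^ 2 * z ^ 2) *
    (-2 * p ^ 2 * besselJ 0 (p * z) - p ^ 3 * z * besselJ 1 (p * z) + 4 * p ^ 2 * jq 1 p z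
      + 2 * p ^ 2 * besselJ 2 (p * z)
      + 2 * s ^ 2 * besselJ 0 (s * z) + s ^ 3 * z * besselJ 1 (s * z) - 4 * s ^ 2 * jq 1 s z
      - 2 * s ^ 2 * besselJ 2 (s * z))

def cReg7 (p s om z : ℝ) : ℂ :=
  -(1 / (16 * (Real.pi : ℂ) * (om : ℂ) ^ 2) * (3 * s ^ 4 + p ^ 4)
    + (z : ℂ) ^ 2 / (om : ℂ) ^ 2 *
      (p ^ 3 * hphiReg 3 p z + s ^ 4 * hphiReg 2 s z - s ^ 3 * hphiReg 3 s z))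

def cReg9 (p s om z : ℝ) : ℂ :=
  (z : ℂ) ^ 2 / (om : ℂ) ^ 2 *
      (2 * p ^ 3 * hphiReg 3 p z - p ^ 4 * hphiReg 2 p z
        - 2 * s ^ 3 * hphiReg 3 s z + s ^ 4 * hphiReg 2 s z)
    - (p ^ 4 - s ^ 4) / (8 * (Real.pi : ℂ) * (om : ℂ) ^ 2)

def cReg11 (p s om z : ℝ) : ℂ :=
  -(1 / ((z : ℂ) ^ 2 * (om : ℂ) ^ 2) *
      (-p ^ 3 * z ^ 2 * hphiReg 1 p z + 2 * p ^ 2 * z ^ 2 * hphiReg 2 p z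
        - 2 * p ^ 2 * hphiReg 0 p z + 4 * p * hphiReg 1 p z
        + s ^ 3 * z ^ 2 * hphiReg 1 s z - 2 * s ^ 2 * z ^ 2 * hphiReg 2 s z
        + 2 * s ^ 2 * hphiReg 0 s z - 4 * s * hphiReg 1 s z
        - z ^ 2 * (p ^ 4 - s ^ 4) / (16 * (Real.pi : ℂ))
        - (p ^ 2 - s ^ 2) / (2 * (Real.pi : ℂ)))
    + (p ^ 4 - s ^ 4) / (16 * (Real.pi : ℂ) * (om : ℂ) ^ 2))

/-! ## Explicit remainders

Below `r = x(τ) - x(t)`, `n = ν(τ)` and `m = ν(t)`. -/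

/-- `U₁ = λ n rᵀ + μ r nᵀ + μ (n·r) I`. -/
def matU1 (lam mu : ℝ) (n : Fin 2 → ℝ) (r : Plane) : RMat :=
  lam • Matrix.vecMulVec n ⇑r + mu • Matrix.vecMulVec ⇑r n + (mu * (n ⬝ᵥ ⇑r)) • (1 : RMat)

/-- `U₂ = (λ + 2μ) n rᵀ + μ r nᵀ + μ (n·r) (I - 4 G(r))`. -/
def matU2 (lam mu : ℝ) (n : Fin 2 → ℝ) (r : Plane) : RMat :=
  (lam + 2 * mu) • Matrix.vecMulVec n ⇑r + mu • Matrix.vecMulVec ⇑r n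
    + (mu * (n ⬝ᵥ ⇑r)) • ((1 : RMat) - (4 : ℝ) • matG r)

/-- `μ m nᵀ + λ n mᵀ + μ (n·m) I`. -/
def matS (lam mu : ℝ) (n m : Fin 2 → ℝ) : RMat :=
  mu • Matrix.vecMulVec m n + lam • Matrix.vecMulVec n m + (mu * (n ⬝ᵥ m)) • (1 : RMat)

def matR1 (lam mu : ℝ) (n m : Fin 2 → ℝ) : RMat :=
  (2 * lam * (lam + 2 * mu)) • Matrix.vecMulVec n m
    + (2 * mu ^ 2) • (Matrix.vecMulVec m n + (n ⬝ᵥ m) • (1 : RMat))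

def matR2 (lam mu : ℝ) (n m : Fin 2 → ℝ) (r : Plane) : RMat :=
  (2 * (lam + 2 * mu) * (lam + mu)) • Matrix.vecMulVec n m
    + (2 * mu) • (matS lam mu n m * ((1 : RMat) - (2 : ℝ) • matG r))
    - (4 * mu * (m ⬝ᵥ ⇑r) / ‖r‖ ^ 2) • matU2 lam mu n r

def matR3 (lam mu : ℝ) (n m : Fin 2 → ℝ) (r : Plane) : RMat :=
  (2 * lam * (lam + mu)) • Matrix.vecMulVec n m
    + (2 * mu) • (matS lam mu n m * matG r)
    + (2 * mu * (m ⬝ᵥ ⇑r) / ‖r‖ ^ 2) • matU2 lam mu n r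

/-- Coefficient of `log |r|` in `V - V₀`. -/
def logPartV (lam mu om : ℝ) (x : ℝ → Plane) (τ t : ℝ) : CMat :=
  let r := x τ - x t
  let p := kP lam mu om
  let s := kS mu om
  toC ((aLog2 p s om ‖r‖ * ‖r‖ ^ 2) • (1 : RMat) + (aLog3 p s om ‖r‖ * ‖r‖ ^ 2) • matG r)

/-- Regular part of `V - V₀`. -/
def regPartV (lam mu om : ℝ) (x : ℝ → Plane) (τ t : ℝ) : CMat :=
  let r := x τ - x t
  let p := kP lam mu om
  let s := kS mu om
  aReg4 p s om ‖r‖ • (1 : CMat) + (aReg5 p s om ‖r‖ * (‖r‖ : ℂ) ^ 2) • toC (matG r)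

/-- Coefficient of `log |r|` in `K - K₀`. -/
def logPartK (lam mu om : ℝ) (x : ℝ → Plane) (τ t : ℝ) : CMat :=
  let r := x τ - x t
  let p := kP lam mu om
  let s := kS mu om
  let m := normalField x t
  toC (bLog2 p s om ‖r‖ • (matU1 lam mu m r).transpose
    + bLog3 p s om ‖r‖ • (matG r * (matU1 lam mu m r).transpose)
    + bLog4 p s om ‖r‖ • (matU2 lam mu m r).transpose)

/-- Regular part of `K - K₀`. -/
def regPartK (lam mu om : ℝ) (x : ℝ → Plane) (τ t : ℝ) : CMat :=
  let r := x τ - x t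
  let p := kP lam mu om
  let s := kS mu om
  let m := normalField x t
  bReg5 p s om ‖r‖ • toC (matU1 lam mu m r).transpose
    + bReg6 p s om ‖r‖ • toC (matG r * (matU1 lam mu m r).transpose)
    + bReg7 p s om ‖r‖ • toC (matU2 lam mu m r).transpose

/-- Coefficient of `log |r|` in `W - W₀`. -/
def logPartW (lam mu om : ℝ) (x : ℝ → Plane) (τ t : ℝ) : CMat :=
  let r := x τ - x t
  let p := kP lam mu om
  let s := kS mu om
  let n := normalField x τ
  let m := normalField x t
  toC ((cLog1 p s om ‖r‖ / ‖r‖ ^ 2) • (matU1 lam mu n r * (matU1 lam mu m r).transpose)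
    + bLog2 p s om ‖r‖ • matR1 lam mu n m
    + (cLog3 p s om ‖r‖ / ‖r‖ ^ 2) •
        (matU1 lam mu n r * matG r * (matU1 lam mu m r).transpose)
    + bLog3 p s om ‖r‖ • matR3 lam mu n m r
    + (cLog5 p s om ‖r‖ / ‖r‖ ^ 2) • (matU1 lam mu n r * (matU2 lam mu m r).transpose)
    + bLog4 p s om ‖r‖ • matR2 lam mu n m r)

/-- Regular part of `W - W₀`. -/
def regPartW (lam mu om : ℝ) (x : ℝ → Plane) (τ t : ℝ) : CMat :=
  let r := x τ - x t
  let p := kP lam mu om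
  let s := kS mu om
  let n := normalField x τ
  let m := normalField x t
  (cReg7 p s om ‖r‖ / (‖r‖ : ℂ) ^ 2) •
      toC (matU1 lam mu n r * (matU1 lam mu m r).transpose)
    + bReg5 p s om ‖r‖ • toC (matR1 lam mu n m)
    + (cReg9 p s om ‖r‖ / (‖r‖ : ℂ) ^ 2) •
        toC (matU1 lam mu n r * matG r * (matU1 lam mu m r).transpose)
    + bReg6 p s om ‖r‖ • toC (matR3 lam mu n m r)
    + (cReg11 p s om ‖r‖ / (‖r‖ : ℂ) ^ 2) •
        toC (matU1 lam mu n r * (matU2 lam mu m r).transpose)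
    + bReg7 p s om ‖r‖ • toC (matR2 lam mu n m r)

/-- Smooth matrix functions of `(τ, t)`, `2π`-periodic in each variable. -/
def SmoothBiperiodic (A : ℝ → ℝ → CMat) : Prop :=
  (∀ i j, ContDiff ℝ ∞ fun q : ℝ × ℝ => A q.1 q.2 i j) ∧
    ∀ τ t, A (τ + 2 * Real.pi) t = A τ t ∧ A τ (t + 2 * Real.pi) = A τ t

end Elastodynamics

end

open Elastodynamics

namespace Elastodynamics

/-! Put ρ = |r|². Every kernel is built from the functions φ_n(k|r|)/(k|r|)^n with n ≤ 3. As a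
function of ρ, each of these is -(1/4π) log ρ times an entire function, plus a second entire
function, plus finitely many negative powers (`hankelScaled`). Differentiation in ρ raises the order
n by one and multiplies by -k²/2, and a three-term recurrence links consecutive orders. No
derivative of a Bessel function is needed beyond these two rules, which are proved on power series
coefficients.

By `fundSol_apply`, Φ = A(ρ) I + B(ρ) r rᵀ. A traction in the second variable gives the matrix
combination `combK` with scalars -2A', -2ρB' - 2B, -B. A further traction in the first variable
gives `combW`, with these scalars and twice their ρ-derivatives. Splitting each scalar into a
singular part, a multiple of log|r| and a regular part then proves the formulas off the diagonal:
the singular parts are exactly the scalars of the elastostatic kernels, because k_s² + k_p² and k_s²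
- k_p² equal ω²(λ+3μ)/(μ(λ+2μ)) and ω²(λ+μ)/(μ(λ+2μ)).

Smoothness across the diagonal comes from `exists_smooth_chord`: r = sin((τ-t)/2) q(τ,t) with q
smooth, nowhere zero and changing sign under 2π-shifts. G and the matrices R_i have degree 0 in r,
while U_1 and U_2 have degree 1. So r can be replaced by q at the price of powers of sin((τ-t)/2),
division by |q|² is harmless, and the signs cancel in the final expressions. The remaining scalars
are smooth functions of ρ (`SmoothInSq`).

For K the prescribed factor sin(τ-t) = 2 sin((τ-t)/2) cos((τ-t)/2) also vanishes at τ-t = π, where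
the logarithmic coefficient need not. A cutoff keeps the logarithm near the diagonal only; away from
the diagonal log|r| is smooth and is moved into the regular part. -/

/-! ## Real power series with factorially decaying coefficients -/

/-- The coefficients decay at least like those of an exponential series. -/
def FactorialDecay (a : ℕ → ℝ) : Prop :=
  ∃ C K : ℝ, 0 ≤ C ∧ 0 ≤ K ∧ ∀ m, |a m| ≤ C * K ^ m / (m.factorial : ℝ)

/-- The sum of a real power series. -/
noncomputable def powSeries (a : ℕ → ℝ) (ρ : ℝ) : ℝ := ∑' m, a m * ρ ^ m

/-- The sequence without its first term. -/
def seqTail (a : ℕ → ℝ) (m : ℕ) : ℝ := a (m + 1)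

/-- Coefficients of the differentiated power series. -/
def seqDeriv (a : ℕ → ℝ) (m : ℕ) : ℝ := (m + 1) * a (m + 1)

/-- The factor m + 1 is absorbed by (m+1)! = (m+1) m!, so the class is stable under termwise
differentiation. -/
theorem FactorialDecay.seqDeriv {a : ℕ → ℝ} (h : FactorialDecay a) :
    FactorialDecay (seqDeriv a) := by
  obtain ⟨C, K, hC, hK, h⟩ := h
  refine ⟨C * K, K, by positivity, hK, fun m => ?_⟩
  have h1 := h (m + 1)
  have hm : (0 : ℝ) < m + 1 := by positivity
  rw [Elastodynamics.seqDeriv, abs_mul, abs_of_pos hm]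
  calc ((m : ℝ) + 1) * |a (m + 1)| ≤ (m + 1) * (C * K ^ (m + 1) / ((m + 1).factorial : ℝ)) := by
        gcongr
    _ = C * K * K ^ m / (m.factorial : ℝ) := by
        rw [Nat.factorial_succ]; push_cast; field_simp; ring

theorem FactorialDecay.seqTail {a : ℕ → ℝ} (h : FactorialDecay a) :
    FactorialDecay (seqTail a) := by
  obtain ⟨C, K, hC, hK, h⟩ := h.seqDeriv
  refine ⟨C, K, hC, hK, fun m => le_trans ?_ (h m)⟩
  rw [Elastodynamics.seqDeriv, Elastodynamics.seqTail, abs_mul]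
  have : (1 : ℝ) ≤ |(m : ℝ) + 1| := by rw [abs_of_pos (by positivity)]; simp
  exact le_mul_of_one_le_left (abs_nonneg _) this

theorem FactorialDecay.summable {a : ℕ → ℝ} (h : FactorialDecay a) (ρ : ℝ) :
    Summable fun m => a m * ρ ^ m := by
  obtain ⟨C, K, hC, hK, h⟩ := h
  refine Summable.of_norm_bounded
    (g := fun m => C * ((K * |ρ|) ^ m / (m.factorial : ℝ)))
    ((Real.summable_pow_div_factorial (K * |ρ|)).mul_left C) fun m => ?_
  rw [Real.norm_eq_abs, abs_mul, abs_pow]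
  calc |a m| * |ρ| ^ m ≤ (C * K ^ m / (m.factorial : ℝ)) * |ρ| ^ m := by gcongr; exact h m
    _ = _ := by rw [mul_pow]; ring

theorem FactorialDecay.summable_abs {a : ℕ → ℝ} (h : FactorialDecay a) (ρ : ℝ) :
    Summable fun m => |a m| * ρ ^ m := by
  refine FactorialDecay.summable (a := fun m => |a m|) ?_ ρ
  obtain ⟨C, K, hC, hK, h⟩ := h
  exact ⟨C, K, hC, hK, fun m => by simpa using h m⟩

theorem FactorialDecay.hasDerivAt {a : ℕ → ℝ} (h : FactorialDecay a) (ρ : ℝ) :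
    HasDerivAt (powSeries a) (powSeries (Elastodynamics.seqDeriv a) ρ) ρ := by
  have hR : (0 : ℝ) < |ρ| + 1 := by positivity
  -- Majorant of the differentiated terms on the ball of radius |ρ| + 1. After a shift of the index
  -- it is the absolute series of the differentiated coefficients.
  have hsum : Summable fun m : ℕ => |a m| * (m * (|ρ| + 1) ^ (m - 1)) := by
    rw [← summable_nat_add_iff 1]
    refine (h.seqDeriv.summable_abs (|ρ| + 1)).congr fun m => ?_
    rw [Elastodynamics.seqDeriv, abs_mul, abs_of_pos (by positivity : (0 : ℝ) < m + 1)]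
    simp
    ring
  have key := hasDerivAt_tsum_of_isPreconnected (𝕜 := ℝ) (t := Metric.ball 0 (|ρ| + 1))
    (g := fun m y => a m * y ^ m) (g' := fun m y => a m * (m * y ^ (m - 1)))
    (y₀ := ρ) (y := ρ) hsum Metric.isOpen_ball (convex_ball _ _).isPreconnected
    (fun m y _ => (hasDerivAt_pow m y).const_mul (a m))
    (fun m y hy => by
      rw [Real.norm_eq_abs, abs_mul, abs_mul, abs_pow, Nat.abs_cast]
      have : |y| ≤ |ρ| + 1 := by simpa using (Metric.mem_ball.1 hy).le
      gcongr)
    (by simp) (h.summable ρ) (by simp)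
  have hs2 : Summable fun m : ℕ => a m * (m * ρ ^ (m - 1)) := by
    refine Summable.of_norm_bounded hsum fun m => ?_
    rw [Real.norm_eq_abs, abs_mul, abs_mul, abs_pow, Nat.abs_cast]
    gcongr
    simp
  -- The term m = 0 vanishes through its factor m, whatever the truncated exponent m - 1 is.
  -- Dropping it aligns the indices.
  rw [hs2.tsum_eq_zero_add] at key
  refine key.congr_deriv ?_
  simp only [powSeries, CharP.cast_eq_zero, zero_mul, mul_zero, zero_add, Nat.add_sub_cancel,
    Elastodynamics.seqDeriv]
  exact tsum_congr fun m => by push_cast; ring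

/-- The derivative is again a series of the same class, so the induction on the order of smoothness
runs over all coefficient sequences at once. -/
theorem FactorialDecay.contDiff {a : ℕ → ℝ} (h : FactorialDecay a) :
    ContDiff ℝ ∞ (powSeries a) := by
  have key : ∀ n : ℕ, ∀ a, FactorialDecay a → ContDiff ℝ n (powSeries a) := by
    intro n
    induction n with
    | zero =>
      intro a ha
      exact contDiff_zero.2 <| Differentiable.continuous (𝕜 := ℝ)
        fun ρ => (ha.hasDerivAt ρ).differentiableAt
    | succ n ih =>
      intro a ha
      have hd : deriv (powSeries a) = powSeries (Elastodynamics.seqDeriv a) :=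
        funext fun ρ => (ha.hasDerivAt ρ).deriv
      have := (contDiff_succ_iff_deriv (𝕜 := ℝ) (n := (n : WithTop ℕ∞)) (f := powSeries a)).2
        ⟨fun ρ => (ha.hasDerivAt ρ).differentiableAt, by simp, by rw [hd]; exact ih _ ha.seqDeriv⟩
      exact_mod_cast this
  exact contDiff_infty.2 fun n => key n a h

theorem FactorialDecay.powSeries_eq {a : ℕ → ℝ} (h : FactorialDecay a) (ρ : ℝ) :
    powSeries a ρ = a 0 + ρ * powSeries (Elastodynamics.seqTail a) ρ := by
  rw [powSeries, (h.summable ρ).tsum_eq_zero_add, powSeries, ← tsum_mul_left]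
  simp only [pow_zero, mul_one, Elastodynamics.seqTail]
  congr 1
  exact tsum_congr fun m => by ring

theorem FactorialDecay.powSeries_lin {a b : ℕ → ℝ} (ha : FactorialDecay a)
    (hb : FactorialDecay b) (c d ρ : ℝ) :
    powSeries (fun m => c * a m + d * b m) ρ = c * powSeries a ρ + d * powSeries b ρ := by
  simp only [powSeries]
  rw [← tsum_mul_left, ← tsum_mul_left,
    ← ((ha.summable ρ).mul_left c).tsum_add ((hb.summable ρ).mul_left d)]
  exact tsum_congr fun m => by ring

theorem powSeries_const_mul (a : ℕ → ℝ) (c ρ : ℝ) :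
    powSeries (fun m => c * a m) ρ = c * powSeries a ρ := by
  simp only [powSeries]
  rw [← tsum_mul_left]
  exact tsum_congr fun m => by ring

/-- `2 ρ f' + c f` in terms of coefficients. -/
theorem FactorialDecay.euler {a : ℕ → ℝ} (h : FactorialDecay a) (c ρ : ℝ) :
    2 * ρ * powSeries (Elastodynamics.seqDeriv a) ρ + c * powSeries a ρ
      = powSeries (fun m => (2 * m + c) * a m) ρ := by
  have hs : Summable fun m : ℕ => (m * a m) * ρ ^ m := by
    rw [← summable_nat_add_iff 1]
    refine ((h.seqDeriv.summable ρ).mul_left ρ).congr fun m => ?_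
    rw [Elastodynamics.seqDeriv]; push_cast; ring
  have h1 : ρ * powSeries (Elastodynamics.seqDeriv a) ρ = ∑' m : ℕ, (m * a m) * ρ ^ m := by
    rw [hs.tsum_eq_zero_add, powSeries, ← tsum_mul_left]
    simp only [CharP.cast_eq_zero, zero_mul, zero_add, Elastodynamics.seqDeriv]
    exact tsum_congr fun m => by push_cast; ring
  rw [mul_assoc, h1, powSeries, powSeries, ← tsum_mul_left, ← tsum_mul_left,
    ← (hs.mul_left 2).tsum_add ((h.summable ρ).mul_left c)]
  exact tsum_congr fun m => by ring

/-! ## The entire parts of the Bessel functions -/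

/-- Coefficients of `J_n(kz) / (kz)^n` as a power series in `z²`. -/
noncomputable def besselCoeff (n : ℕ) (k : ℝ) (m : ℕ) : ℝ :=
  (1 / 2) ^ n * (-(k ^ 2 / 4)) ^ m / ((m.factorial : ℝ) * ((m + n).factorial : ℝ))

/-- Coefficients of the entire part of `Y_n`. -/
noncomputable def digammaCoeff (n : ℕ) (k : ℝ) (m : ℕ) : ℝ :=
  besselCoeff n k m * (digammaSucc m + digammaSucc (n + m))

theorem besselCoeff_abs_le (n : ℕ) (k : ℝ) (m : ℕ) :
    |besselCoeff n k m| ≤ (k ^ 2 / 4) ^ m / ((m.factorial : ℝ) * ((m + n).factorial : ℝ)) := by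
  have h2 : ((1 : ℝ) / 2) ^ n ≤ 1 := pow_le_one₀ (by norm_num) (by norm_num)
  rw [besselCoeff, abs_div, abs_mul, abs_pow, abs_pow, abs_neg,
    abs_of_nonneg (by positivity : (0 : ℝ) ≤ k ^ 2 / 4),
    abs_of_nonneg (by positivity : (0 : ℝ) ≤ (m.factorial : ℝ) * ((m + n).factorial : ℝ)),
    abs_of_nonneg (by positivity : (0 : ℝ) ≤ 1 / 2)]
  gcongr
  exact mul_le_of_le_one_left (by positivity) h2

theorem factorialDecay_besselCoeff (n : ℕ) (k : ℝ) : FactorialDecay (besselCoeff n k) := by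
  refine ⟨1, k ^ 2 / 4, by norm_num, by positivity, fun m => (besselCoeff_abs_le n k m).trans ?_⟩
  rw [one_mul]
  gcongr
  have : (1 : ℝ) ≤ ((m + n).factorial : ℝ) := by exact_mod_cast (m + n).factorial_pos
  exact le_mul_of_one_le_right (by positivity) this

theorem harmonic_le_self (m : ℕ) : harmonic m ≤ m := by
  induction m with
  | zero => simp
  | succ m ih =>
    rw [harmonic_succ]
    push_cast
    have : ((m : ℚ) + 1)⁻¹ ≤ 1 := inv_le_one_of_one_le₀ (by simp)
    linarith

theorem digammaSucc_abs_le (m : ℕ) : |digammaSucc m| ≤ m + 1 := by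
  have h1 : ((harmonic m : ℚ) : ℝ) ≤ m := by exact_mod_cast harmonic_le_self m
  have h0 : (0 : ℝ) ≤ ((harmonic m : ℚ) : ℝ) := by
    have : 0 ≤ harmonic m := Finset.sum_nonneg fun i _ => by positivity
    exact_mod_cast this
  have h2 := Real.one_half_lt_eulerMascheroniConstant
  have h3 := Real.eulerMascheroniConstant_lt_two_thirds
  rw [digammaSucc, abs_le]
  constructor <;> linarith

theorem factorialDecay_digammaCoeff (n : ℕ) (k : ℝ) : FactorialDecay (digammaCoeff n k) := by
  -- The 4 comes from |ψ(m+1) + ψ(n+m+1)| ≤ 2(m+n+1) ≤ 4 (m+n)!; the second factorial of the Bessel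
  -- coefficient pays for it.
  refine ⟨4, k ^ 2 / 4, by norm_num, by positivity, fun m => ?_⟩
  have h1 : |digammaSucc m + digammaSucc (n + m)| ≤ 2 * ((m + n : ℕ) + 1) := by
    have := digammaSucc_abs_le m
    have h' := digammaSucc_abs_le (n + m)
    have := abs_add_le (digammaSucc m) (digammaSucc (n + m))
    push_cast at *
    have : (0 : ℝ) ≤ n := by positivity
    linarith
  have h2 : (((m + n : ℕ) : ℝ) + 1) ≤ 2 * ((m + n).factorial : ℝ) := by
    have h3 : m + n ≤ (m + n).factorial := Nat.self_le_factorial _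
    have h4 : 1 ≤ (m + n).factorial := (m + n).factorial_pos
    have : (m + n) + 1 ≤ 2 * (m + n).factorial := by omega
    exact_mod_cast this
  rw [digammaCoeff, abs_mul]
  have hf : (0 : ℝ) < ((m + n).factorial : ℝ) := by positivity
  calc |besselCoeff n k m| * |digammaSucc m + digammaSucc (n + m)|
      ≤ ((k ^ 2 / 4) ^ m / ((m.factorial : ℝ) * ((m + n).factorial : ℝ)))
          * (2 * (2 * ((m + n).factorial : ℝ))) := by
        gcongr
        · exact besselCoeff_abs_le n k m
        · exact h1.trans (by gcongr)
    _ = 4 * (k ^ 2 / 4) ^ m / (m.factorial : ℝ) := by field_simp; ring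

theorem digammaSucc_succ (m : ℕ) : digammaSucc (m + 1) = digammaSucc m + 1 / (m + 1) := by
  simp only [digammaSucc, harmonic_succ]
  push_cast
  ring

/-- Coefficient form of (z^{n+1} J_{n+1})' = z^{n+1} J_n. In the variable ρ the operator 2ρ d/dρ +
2(n+1) lowers the order by one. -/
theorem besselCoeff_euler (n : ℕ) (k : ℝ) (m : ℕ) :
    (2 * m + 2 * (n + 1)) * besselCoeff (n + 1) k m = besselCoeff n k m := by
  simp only [besselCoeff, ← add_assoc, Nat.factorial_succ]
  push_cast
  have : (m : ℝ) + n + 1 ≠ 0 := by positivity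
  field_simp
  ring

/-- Coefficient form of (z^{-n} J_n)' = -z^{-n} J_{n+1}. Together with `besselCoeff_euler` it yields
the three-term recurrence. -/
theorem besselCoeff_deriv (n : ℕ) (k : ℝ) (m : ℕ) :
    seqDeriv (besselCoeff n k) m = -(k ^ 2 / 2) * besselCoeff (n + 1) k m := by
  simp only [besselCoeff, seqDeriv, show m + 1 + n = m + n + 1 by ring,
    show m + (n + 1) = m + n + 1 by ring, Nat.factorial_succ]
  push_cast
  have : (m : ℝ) + n + 1 ≠ 0 := by positivity
  have : (m : ℝ) + 1 ≠ 0 := by positivity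
  field_simp
  ring

/-- The Bessel rule, with an extra term because raising n shifts the second digamma value: ψ(n+m+2)
= ψ(n+m+1) + 1/(n+m+1). -/
theorem digammaCoeff_euler (n : ℕ) (k : ℝ) (m : ℕ) :
    (2 * m + 2 * (n + 1)) * digammaCoeff (n + 1) k m
      = 1 * digammaCoeff n k m + 2 * besselCoeff (n + 1) k m := by
  have h := besselCoeff_euler n k m
  have h2 : digammaSucc (n + 1 + m) = digammaSucc (n + m) + 1 / (n + m + 1) := by
    rw [show n + 1 + m = (n + m) + 1 by ring, digammaSucc_succ]; push_cast; rfl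
  have h3 : (n : ℝ) + m + 1 ≠ 0 := by positivity
  rw [digammaCoeff, digammaCoeff, h2, ← h]
  field_simp
  ring

/-- Here the first digamma value is shifted, and the increment 1/(m+1) cancels the factor m + 1. The
leftover is the series of `besselQuot`, needed in `hasDerivAt_hankelScaled`. -/
theorem digammaCoeff_deriv (n : ℕ) (k : ℝ) (m : ℕ) :
    seqDeriv (digammaCoeff n k) m
      = -(k ^ 2 / 2) * digammaCoeff (n + 1) k m + 1 * seqTail (besselCoeff n k) m := by
  have h := besselCoeff_deriv n k m
  simp only [seqDeriv, seqTail, digammaCoeff] at h ⊢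
  have h2 : digammaSucc (n + 1 + m) = digammaSucc (n + (m + 1)) := by
    rw [show n + 1 + m = n + (m + 1) by ring]
  have h3 : (m : ℝ) + 1 ≠ 0 := by positivity
  rw [h2, ← mul_assoc, ← mul_assoc, h, digammaSucc_succ m, ← h]
  field_simp
  ring

/-- `J_n(kz) / (kz)^n` as an entire function of `ρ = z²`. -/
noncomputable def besselEntire (n : ℕ) (k ρ : ℝ) : ℝ := powSeries (besselCoeff n k) ρ

/-- The difference quotient `(j(ρ) - j(0)) / ρ` of `j = besselEntire n k`. -/
noncomputable def besselQuot (n : ℕ) (k ρ : ℝ) : ℝ := powSeries (seqTail (besselCoeff n k)) ρ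

/-- `C_{n,k} / k^n` as an entire function of `ρ = z²`. -/
noncomputable def hankelEntire (n : ℕ) (k ρ : ℝ) : ℂ :=
  (Complex.I / 4 - ((Real.log (k / 2) / (2 * Real.pi) : ℝ) : ℂ)) * (besselEntire n k ρ : ℂ)
    + ((1 / (4 * Real.pi) * powSeries (digammaCoeff n k) ρ : ℝ) : ℂ)

/-- The negative powers of `ρ = z²` in `φ_n(kz) / (kz)^n`, `n ≤ 3`. -/
noncomputable def hankelSing : ℕ → ℝ → ℝ → ℝ
  | 0, _, _ => 0
  | 1, k, ρ => 1 / (2 * Real.pi * k ^ 2 * ρ)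
  | 2, k, ρ => 1 / (Real.pi * k ^ 4 * ρ ^ 2) + 1 / (4 * Real.pi * k ^ 2 * ρ)
  | 3, k, ρ => 4 / (Real.pi * k ^ 6 * ρ ^ 3) + 1 / (2 * Real.pi * k ^ 4 * ρ ^ 2)
      + 1 / (16 * Real.pi * k ^ 2 * ρ)
  | _, _, _ => 0

/-- `φ_n(kz) / (kz)^n` as a function of `ρ = z²`, `n ≤ 3`. -/
noncomputable def hankelScaled (n : ℕ) (k ρ : ℝ) : ℂ :=
  ((-(1 / (4 * Real.pi)) * (Real.log ρ * besselEntire n k ρ) : ℝ) : ℂ) + hankelEntire n k ρ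
    + (hankelSing n k ρ : ℂ)

theorem contDiff_besselEntire (n : ℕ) (k : ℝ) : ContDiff ℝ ∞ (besselEntire n k) :=
  (factorialDecay_besselCoeff n k).contDiff

theorem contDiff_besselQuot (n : ℕ) (k : ℝ) : ContDiff ℝ ∞ (besselQuot n k) :=
  (factorialDecay_besselCoeff n k).seqTail.contDiff

theorem contDiff_hankelEntire (n : ℕ) (k : ℝ) : ContDiff ℝ ∞ (hankelEntire n k) := by
  have h1 := Complex.ofRealCLM.contDiff.comp (contDiff_besselEntire n k)
  have h2 := Complex.ofRealCLM.contDiff.comp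
    (contDiff_const (c := 1 / (4 * Real.pi)) |>.mul (factorialDecay_digammaCoeff n k).contDiff)
  exact (contDiff_const.mul h1).add h2

theorem besselEntire_eq (n : ℕ) (k ρ : ℝ) :
    besselEntire n k ρ = (1 / 2) ^ n / (n.factorial : ℝ) + ρ * besselQuot n k ρ := by
  rw [besselEntire, (factorialDecay_besselCoeff n k).powSeries_eq ρ, besselQuot]
  simp [besselCoeff]

theorem hasDerivAt_besselEntire (n : ℕ) (k ρ : ℝ) :
    HasDerivAt (besselEntire n k) (-(k ^ 2 / 2) * besselEntire (n + 1) k ρ) ρ := by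
  have h := (factorialDecay_besselCoeff n k).hasDerivAt ρ
  rwa [funext (besselCoeff_deriv n k), powSeries_const_mul] at h

theorem hasDerivAt_digammaSeries (n : ℕ) (k ρ : ℝ) :
    HasDerivAt (powSeries (digammaCoeff n k))
      (-(k ^ 2 / 2) * powSeries (digammaCoeff (n + 1) k) ρ + besselQuot n k ρ) ρ := by
  have h := (factorialDecay_digammaCoeff n k).hasDerivAt ρ
  rw [funext (digammaCoeff_deriv n k), (factorialDecay_digammaCoeff _ k).powSeries_lin
    (factorialDecay_besselCoeff n k).seqTail, one_mul] at h
  exact h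

theorem besselEntire_rec (n : ℕ) (k ρ : ℝ) :
    besselEntire n k ρ
      = 2 * (n + 1) * besselEntire (n + 1) k ρ - k ^ 2 * ρ * besselEntire (n + 2) k ρ := by
  have h := (factorialDecay_besselCoeff (n + 1) k).euler (2 * (n + 1)) ρ
  rw [funext (besselCoeff_euler n k), funext (besselCoeff_deriv (n + 1) k),
    powSeries_const_mul] at h
  simp only [besselEntire]
  linarith

theorem digammaSeries_rec (n : ℕ) (k ρ : ℝ) :
    powSeries (digammaCoeff n k) ρ
      = 2 * (n + 1) * powSeries (digammaCoeff (n + 1) k) ρ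
        - k ^ 2 * ρ * powSeries (digammaCoeff (n + 2) k) ρ
        - 2 * ((1 / 2) ^ (n + 1) / ((n + 1).factorial : ℝ)) := by
  have h := (factorialDecay_digammaCoeff (n + 1) k).euler (2 * (n + 1)) ρ
  rw [funext (digammaCoeff_euler n k), (factorialDecay_digammaCoeff n k).powSeries_lin
    (factorialDecay_besselCoeff (n + 1) k), funext (digammaCoeff_deriv (n + 1) k),
    (factorialDecay_digammaCoeff _ k).powSeries_lin
    (factorialDecay_besselCoeff (n + 1) k).seqTail] at h
  have h2 := besselEntire_eq (n + 1) k ρ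
  simp only [besselEntire, besselQuot] at h2
  linarith

theorem hankelEntire_rec (n : ℕ) (k ρ : ℝ) :
    hankelEntire n k ρ = 2 * (n + 1) * hankelEntire (n + 1) k ρ
        - k ^ 2 * ρ * hankelEntire (n + 2) k ρ
        - ((1 / (2 * Real.pi) * ((1 / 2) ^ (n + 1) / ((n + 1).factorial : ℝ)) : ℝ) : ℂ) := by
  rw [hankelEntire, besselEntire_rec, digammaSeries_rec, hankelEntire, hankelEntire]
  push_cast
  ring

theorem besselEntire_zero (k ρ : ℝ) :
    besselEntire 0 k ρ = 2 * besselEntire 1 k ρ - k ^ 2 * ρ * besselEntire 2 k ρ := by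
  simpa using besselEntire_rec 0 k ρ

theorem besselEntire_one (k ρ : ℝ) :
    besselEntire 1 k ρ = 4 * besselEntire 2 k ρ - k ^ 2 * ρ * besselEntire 3 k ρ := by
  have := besselEntire_rec 1 k ρ
  norm_num at this
  linarith

theorem hankelEntire_zero (k ρ : ℝ) : hankelEntire 0 k ρ = 2 * hankelEntire 1 k ρ
    - k ^ 2 * ρ * hankelEntire 2 k ρ - 1 / (4 * (Real.pi : ℂ)) := by
  rw [hankelEntire_rec 0 k ρ]
  simp
  ring

theorem hankelEntire_one (k ρ : ℝ) : hankelEntire 1 k ρ = 4 * hankelEntire 2 k ρ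
    - k ^ 2 * ρ * hankelEntire 3 k ρ - 1 / (16 * (Real.pi : ℂ)) := by
  rw [hankelEntire_rec 1 k ρ]
  norm_num
  ring

/-- Differentiating log ρ produces j(ρ)/ρ = j(0)/ρ + (j(ρ) - j(0))/ρ for j = `besselEntire n k`. The
difference quotient cancels against the extra term of the digamma series; the pole j(0)/ρ must be
matched by the singular parts, which is the hypothesis `hσ'`. -/
theorem hasDerivAt_hankelScaled {n : ℕ} {k ρ σ' : ℝ} (hρ : ρ ≠ 0)
    (hσ : HasDerivAt (hankelSing n k) σ' ρ)
    (hσ' : σ' - 1 / (4 * Real.pi) * ((1 / 2) ^ n / (n.factorial : ℝ)) / ρ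
      = -(k ^ 2 / 2) * hankelSing (n + 1) k ρ) :
    HasDerivAt (hankelScaled n k) (-((k : ℂ) ^ 2 / 2) * hankelScaled (n + 1) k ρ) ρ := by
  have hj := hasDerivAt_besselEntire n k ρ
  have h1 := (((Real.hasDerivAt_log hρ).mul hj).const_mul (-(1 / (4 * Real.pi)))).ofReal_comp
  have h2 := (hj.ofReal_comp.const_mul
    (Complex.I / 4 - ((Real.log (k / 2) / (2 * Real.pi) : ℝ) : ℂ))).add
    (((hasDerivAt_digammaSeries n k ρ).const_mul (1 / (4 * Real.pi))).ofReal_comp)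
  refine ((h1.add h2).add hσ.ofReal_comp).congr_deriv ?_
  have e1 := besselEntire_eq n k ρ
  have e2 : σ' = 1 / (4 * Real.pi) * ((1 / 2) ^ n / (n.factorial : ℝ)) / ρ
      + -(k ^ 2 / 2) * hankelSing (n + 1) k ρ := by linarith
  rw [hankelScaled, hankelEntire, e2, e1]
  push_cast
  have hρ' : (ρ : ℂ) ≠ 0 := by exact_mod_cast hρ
  have hpi : (Real.pi : ℂ) ≠ 0 := by exact_mod_cast Real.pi_ne_zero
  generalize (Nat.factorial n : ℂ)⁻¹ = a
  field_simp
  ring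

theorem hasDerivAt_inv_pow_mul (c ρ : ℝ) (n : ℕ) (hρ : ρ ≠ 0) :
    HasDerivAt (fun ρ : ℝ => c * (ρ ^ n)⁻¹) (-c * n * (ρ ^ (n + 1))⁻¹) ρ := by
  refine (((hasDerivAt_pow n ρ).inv (pow_ne_zero n hρ)).const_mul c).congr_deriv ?_
  cases n with
  | zero => simp
  | succ n => field_simp; simp; ring

theorem hasDerivAt_hankelScaled_zero {k ρ : ℝ} (hk : k ≠ 0) (hρ : ρ ≠ 0) :
    HasDerivAt (hankelScaled 0 k) (-((k : ℂ) ^ 2 / 2) * hankelScaled 1 k ρ) ρ := by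
  refine hasDerivAt_hankelScaled (σ' := 0) hρ (hasDerivAt_const ρ (0 : ℝ)) ?_
  simp only [hankelSing]
  have := Real.pi_ne_zero
  simp
  field_simp
  norm_num

theorem hasDerivAt_hankelScaled_one {k ρ : ℝ} (hk : k ≠ 0) (hρ : ρ ≠ 0) :
    HasDerivAt (hankelScaled 1 k) (-((k : ℂ) ^ 2 / 2) * hankelScaled 2 k ρ) ρ := by
  have h := hasDerivAt_inv_pow_mul (1 / (2 * Real.pi * k ^ 2)) ρ 1 hρ
  refine hasDerivAt_hankelScaled hρ (h.congr_of_eventuallyEq (.of_forall fun y => ?_)) ?_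
  · simp only [hankelSing]; field_simp
  · simp only [hankelSing]
    have := Real.pi_ne_zero
    simp
    field_simp
    ring

theorem hasDerivAt_hankelScaled_two {k ρ : ℝ} (hk : k ≠ 0) (hρ : ρ ≠ 0) :
    HasDerivAt (hankelScaled 2 k) (-((k : ℂ) ^ 2 / 2) * hankelScaled 3 k ρ) ρ := by
  have h := (hasDerivAt_inv_pow_mul (1 / (Real.pi * k ^ 4)) ρ 2 hρ).add
    (hasDerivAt_inv_pow_mul (1 / (4 * Real.pi * k ^ 2)) ρ 1 hρ)
  refine hasDerivAt_hankelScaled hρ (h.congr_of_eventuallyEq (.of_forall fun y => ?_)) ?_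
  · simp only [hankelSing, Pi.add_apply]; field_simp
  · simp only [hankelSing]
    have := Real.pi_ne_zero
    simp [Nat.factorial]
    field_simp
    ring

/-- The recurrence holds without a constant: the 1/(16π) in `hankelEntire_one` is offset by the one
arising from ρ times the simple pole of `hankelSing 3`. -/
theorem hankelScaled_one {k ρ : ℝ} (hk : k ≠ 0) (hρ : ρ ≠ 0) :
    hankelScaled 1 k ρ = 4 * hankelScaled 2 k ρ - k ^ 2 * ρ * hankelScaled 3 k ρ := by
  simp only [hankelScaled, besselEntire_one k ρ, hankelEntire_one k ρ, hankelSing]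
  have hk' : (k : ℂ) ≠ 0 := by exact_mod_cast hk
  have hρ' : (ρ : ℂ) ≠ 0 := by exact_mod_cast hρ
  have hpi : (Real.pi : ℂ) ≠ 0 := by exact_mod_cast Real.pi_ne_zero
  push_cast
  field_simp
  ring

/-! ## Comparison with the Bessel and Hankel functions -/

theorem besselJ_eq (n : ℕ) (k z : ℝ) :
    besselJ n (k * z) = (k * z) ^ n * besselEntire n k (z ^ 2) := by
  rw [besselJ, besselEntire, powSeries, ← tsum_mul_left]
  refine tsum_congr fun m => ?_
  rw [besselCoeff, neg_pow (k ^ 2 / 4)]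
  have : (k * z / 2) ^ (2 * m + n) = (k * z) ^ n * ((1 / 2) ^ n * (k ^ 2 / 4) ^ m * (z ^ 2) ^ m) := by
    rw [pow_add, pow_mul, show (k * z / 2) ^ 2 = k ^ 2 / 4 * z ^ 2 by ring,
      show k * z / 2 = k * z * (1 / 2) by ring]
    ring
  rw [this]
  ring

theorem jq_eq (n : ℕ) {k z : ℝ} (hk : k ≠ 0) (hz : z ≠ 0) :
    jq n k z = besselEntire n k (z ^ 2) := by
  rw [jq, besselJ_eq]
  have : (k * z) ^ n ≠ 0 := by positivity
  field_simp

theorem besselY_eq (n : ℕ) {k z : ℝ} (hk : 0 < k) (hz : 0 < z) :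
    besselY n (k * z) = -(1 / (Real.pi * (k * z / 2) ^ n)) *
      ∑ m ∈ Finset.range n,
        ((n - m - 1).factorial : ℝ) / (m.factorial : ℝ) * ((k * z) ^ 2 / 4) ^ m
      + (k * z) ^ n * (2 / Real.pi * (Real.log z + Real.log (k / 2)) * besselEntire n k (z ^ 2)
        - 1 / Real.pi * powSeries (digammaCoeff n k) (z ^ 2)) := by
  have hser : (k * z / 2) ^ n / Real.pi * (∑' m : ℕ, (digammaSucc m + digammaSucc (n + m)) *
        (-((k * z) ^ 2 / 4)) ^ m / ((m.factorial : ℝ) * ((n + m).factorial : ℝ)))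
      = (k * z) ^ n * (1 / Real.pi * powSeries (digammaCoeff n k) (z ^ 2)) := by
    rw [powSeries, ← tsum_mul_left, ← tsum_mul_left, ← tsum_mul_left]
    refine tsum_congr fun m => ?_
    rw [digammaCoeff, besselCoeff, show -((k * z) ^ 2 / 4) = -(k ^ 2 / 4) * z ^ 2 by ring,
      mul_pow, div_pow (k * z) 2 n, one_div_pow, add_comm n m]
    ring
  have hlog : Real.log (k * z / 2) = Real.log z + Real.log (k / 2) := by
    rw [← Real.log_mul hz.ne' (by positivity)]
    congr 1
    ring
  rw [besselY, hser, hlog, besselJ_eq]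
  ring

theorem hphi_eq (n : ℕ) {k z : ℝ} (hk : 0 < k) (hz : 0 < z) :
    hphi n (k * z) = ((1 / (4 * Real.pi * (k * z / 2) ^ n) *
      ∑ m ∈ Finset.range n,
        ((n - m - 1).factorial : ℝ) / (m.factorial : ℝ) * ((k * z) ^ 2 / 4) ^ m : ℝ) : ℂ)
      + (k * z) ^ n * (-((1 / (2 * Real.pi) * Real.log z * besselEntire n k (z ^ 2) : ℝ) : ℂ)
        + hankelEntire n k (z ^ 2)) := by
  have hpi : (Real.pi : ℂ) ≠ 0 := by exact_mod_cast Real.pi_ne_zero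
  rw [hphi, hankel1, besselY_eq n hk hz, besselJ_eq, hankelEntire]
  generalize (∑ m ∈ Finset.range n,
        ((n - m - 1).factorial : ℝ) / (m.factorial : ℝ) * ((k * z) ^ 2 / 4) ^ m) = S
  push_cast
  have hI : Complex.I ^ 2 = -1 := Complex.I_sq
  have hkz : ((k : ℂ) * z / 2) ^ n ≠ 0 := by
    have : (k : ℂ) ≠ 0 := by exact_mod_cast hk.ne'
    have : (z : ℂ) ≠ 0 := by exact_mod_cast hz.ne'
    exact pow_ne_zero n (div_ne_zero (mul_ne_zero ‹_› ‹_›) two_ne_zero)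
  generalize (((k : ℂ) * z / 2) ^ n) = T at *
  field_simp
  -- What remains is a multiple of I² = -1, from (i/4)(iY_n) = -Y_n/4.
  linear_combination (-(2 * S : ℂ) + 2 * T * ((k : ℂ) * z) ^ n * (2 * (Real.log z + Real.log (k / 2))
    * besselEntire n k (z ^ 2) - powSeries (digammaCoeff n k) (z ^ 2))) * hI

theorem hphi_zero_eq {k z : ℝ} (hk : 0 < k) (hz : 0 < z) :
    hphi 0 (k * z) = hankelScaled 0 k (z ^ 2) := by
  rw [hphi_eq 0 hk hz, hankelScaled, hankelSing, Real.log_pow]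
  simp
  ring

/-- For n ≤ 3 the finite sum of negative powers in Y_n is exactly what `hphiSing` subtracts. The
constant log(k/2) is part of `hankelEntire`, so only log z is split off. -/
theorem hphiReg_eq {n : ℕ} (hn : n < 4) {k z : ℝ} (hk : 0 < k) (hz : 0 < z) :
    hphiReg n k z = (k : ℂ) ^ n * hankelEntire n k (z ^ 2) := by
  have hk' : (k : ℂ) ≠ 0 := by exact_mod_cast hk.ne'
  have hz' : (z : ℂ) ≠ 0 := by exact_mod_cast hz.ne'
  have hpi : (Real.pi : ℂ) ≠ 0 := by exact_mod_cast Real.pi_ne_zero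
  rw [hphiReg, hphi_eq n hk hz, besselJ_eq, div_eq_iff (pow_ne_zero n hz')]
  interval_cases n <;>
  · simp [Finset.sum_range_succ, hphiSing, Nat.factorial]
    field_simp
    ring

/-! ## Gradients of planar functions -/

/-- `f` is differentiable at `x` with partial derivatives `g`. -/
def HasGrad (f : Plane → ℂ) (g : Fin 2 → ℂ) (x : Plane) : Prop :=
  HasFDerivAt f (∑ i, (EuclideanSpace.proj i : Plane →L[ℝ] ℝ).smulRight (g i)) x

theorem HasGrad.pd_eq {f : Plane → ℂ} {g : Fin 2 → ℂ} {x : Plane} (h : HasGrad f g x)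
    (i : Fin 2) : pd i f x = g i := by
  rw [pd, HasFDerivAt.fderiv h]
  fin_cases i <;> simp

theorem HasGrad.congr_grad {f : Plane → ℂ} {g g' : Fin 2 → ℂ} {x : Plane} (h : HasGrad f g x)
    (hg : ∀ i, g i = g' i) : HasGrad f g' x := by
  rwa [← funext hg]

theorem HasGrad.congr_of_eventuallyEq {f f' : Plane → ℂ} {g : Fin 2 → ℂ} {x : Plane}
    (h : HasGrad f g x) (hf : f' =ᶠ[nhds x] f) : HasGrad f' g x :=
  HasFDerivAt.congr_of_eventuallyEq h hf

theorem hasGrad_const (c : ℂ) (x : Plane) : HasGrad (fun _ => c) (fun _ => 0) x := by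
  refine (hasFDerivAt_const (𝕜 := ℝ) c x).congr_fderiv ?_
  ext v; simp

theorem HasGrad.add {f f' : Plane → ℂ} {g g' : Fin 2 → ℂ} {x : Plane}
    (h : HasGrad f g x) (h' : HasGrad f' g' x) :
    HasGrad (fun z => f z + f' z) (fun i => g i + g' i) x := by
  refine (HasFDerivAt.add h h').congr_fderiv ?_
  ext v; simp; ring

theorem HasGrad.mul {f f' : Plane → ℂ} {g g' : Fin 2 → ℂ} {x : Plane}
    (h : HasGrad f g x) (h' : HasGrad f' g' x) :
    HasGrad (fun z => f z * f' z) (fun i => g i * f' x + f x * g' i) x := by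
  refine (HasFDerivAt.mul h h').congr_fderiv ?_
  ext v; simp; ring

theorem HasGrad.const_mul {f : Plane → ℂ} {g : Fin 2 → ℂ} {x : Plane}
    (h : HasGrad f g x) (c : ℂ) : HasGrad (fun z => c * f z) (fun i => c * g i) x :=
  ((hasGrad_const c x).mul h).congr_grad fun i => by ring

theorem hasGrad_coord (y x : Plane) (j : Fin 2) :
    HasGrad (fun z => (((z - y) j : ℝ) : ℂ)) (fun i => if i = j then 1 else 0) x := by
  have h1 : HasFDerivAt (fun z : Plane => (z - y) j)
      (EuclideanSpace.proj j : Plane →L[ℝ] ℝ) x :=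
    (EuclideanSpace.proj j : Plane →L[ℝ] ℝ).hasFDerivAt.comp x ((hasFDerivAt_id x).sub_const y)
  refine (Complex.ofRealCLM.hasFDerivAt.comp x h1).congr_fderiv ?_
  ext v
  fin_cases j <;> simp

/-- Radial functions are taken in ρ = |r|², whose gradient 2r involves no square root. -/
theorem hasGrad_radial {A : ℝ → ℂ} {A' : ℂ} {y x : Plane}
    (hA : HasDerivAt A A' (‖x - y‖ ^ 2)) :
    HasGrad (fun z => A (‖z - y‖ ^ 2)) (fun i => 2 * A' * (((x - y) i : ℝ) : ℂ)) x := by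
  have h1 : HasFDerivAt (fun z : Plane => ‖z - y‖ ^ 2)
      (2 • (innerSL ℝ (x - y)).comp (ContinuousLinearMap.id ℝ Plane)) x :=
    ((hasFDerivAt_id x).sub_const y).norm_sq
  refine (HasFDerivAt.comp x hA.hasFDerivAt h1).congr_fderiv ?_
  ext v
  simp [PiLp.inner_apply]
  ring

theorem HasGrad.comp_sub {f : Plane → ℂ} {g : Fin 2 → ℂ} {x y : Plane}
    (h : HasGrad f g (x - y)) : HasGrad (fun z => f (x - z)) (fun i => -g i) y := by
  have h1 : HasFDerivAt (fun z : Plane => x - z) (-ContinuousLinearMap.id ℝ Plane) y :=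
    (hasFDerivAt_id y).const_sub x
  refine (HasFDerivAt.comp y h h1).congr_fderiv ?_
  ext v
  simp
  ring

theorem tractionMat_apply (lam mu : ℝ) (n : Fin 2 → ℝ) {F : Plane → CMat} {x : Plane}
    {D : Fin 2 → Fin 2 → Fin 2 → ℂ}
    (h : ∀ i j, HasGrad (fun z => F z i j) (fun k => D k i j) x) (i j : Fin 2) :
    tractionMat lam mu n F x i j = ∑ k, (mu * (D k i j + D i k j)
      + if i = k then lam * (D 0 0 j + D 1 1 j) else 0) * n k := by
  simp only [tractionMat, traction, stress, strain, divergence, Matrix.mulVec, dotProduct,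
    Matrix.of_apply, Matrix.add_apply, Matrix.smul_apply, smul_eq_mul, Fin.sum_univ_two,
    fun k i j => (h i j).pd_eq k, Matrix.one_apply]
  fin_cases i <;> simp <;> ring

/-! ## Kernels built from radial functions -/

theorem norm_sq_plane (r : Plane) : ‖r‖ ^ 2 = r 0 ^ 2 + r 1 ^ 2 := by
  rw [EuclideanSpace.real_norm_sq_eq, Fin.sum_univ_two]

/-- `β₂ U₁ᵀ + β₃ G U₁ᵀ + β₄ U₂ᵀ`. -/
noncomputable def combK (lam mu : ℝ) (m : Fin 2 → ℝ) (r : Plane) (β₂ β₃ β₄ : ℂ) : CMat :=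
  β₂ • toC (matU1 lam mu m r).transpose
    + β₃ • toC (matG r * (matU1 lam mu m r).transpose)
    + β₄ • toC (matU2 lam mu m r).transpose

/-- The matrix combination in the splitting of the hypersingular kernel. -/
noncomputable def combW (lam mu : ℝ) (n m : Fin 2 → ℝ) (r : Plane)
    (γ₁ β₂ γ₃ β₃ γ₅ β₄ : ℂ) : CMat :=
  γ₁ • toC (matU1 lam mu n r * (matU1 lam mu m r).transpose)
    + β₂ • toC (matR1 lam mu n m)
    + γ₃ • toC (matU1 lam mu n r * matG r * (matU1 lam mu m r).transpose)
    + β₃ • toC (matR3 lam mu n m r)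
    + γ₅ • toC (matU1 lam mu n r * (matU2 lam mu m r).transpose)
    + β₄ • toC (matR2 lam mu n m r)

theorem ofReal_norm_sq_ne_zero {r : Plane} (hr : r ≠ 0) : (r 0 : ℂ) ^ 2 + (r 1 : ℂ) ^ 2 ≠ 0 := by
  have : ‖r‖ ^ 2 ≠ 0 := by positivity
  rw [norm_sq_plane] at this
  exact_mod_cast this

/-- Since G r = r, G U₁ᵀ equals λ r mᵀ + 2μ (m·r) G. So only r mᵀ, m rᵀ, (m·r) I and (m·r) r rᵀ/ρ
remain, each easy to differentiate. -/
theorem combK_apply (lam mu : ℝ) (m : Fin 2 → ℝ) {r : Plane} (hr : r ≠ 0) (β₂ β₃ β₄ : ℂ)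
    (i j : Fin 2) : combK lam mu m r β₂ β₃ β₄ i j
      = (lam * (β₂ + β₃) + (lam + 2 * mu) * β₄) * m j * r i
        + mu * (β₂ + β₄) * (m i * r j + (m 0 * r 0 + m 1 * r 1) * if i = j then 1 else 0)
        + 2 * mu * (β₃ - 2 * β₄) / ((r 0 : ℂ) ^ 2 + (r 1 : ℂ) ^ 2)
          * ((m 0 * r 0 + m 1 * r 1) * (r i * r j)) := by
  have h0 := ofReal_norm_sq_ne_zero hr
  fin_cases i <;> fin_cases j <;>
  · simp [combK, toC, matU1, matU2, matG, Matrix.mul_apply, Matrix.vecMulVec_apply, dotProduct,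
      Fin.sum_univ_two, norm_sq_plane]
    field_simp
    ring

/-- Traction in the second variable of a matrix `A I + B r rᵀ` with radial `A`, `B`. -/
theorem tractionMat_radial (lam mu : ℝ) (m : Fin 2 → ℝ) {A B : ℝ → ℂ} {A' B' : ℂ} {x y : Plane}
    (hxy : x ≠ y) (hA : HasDerivAt A A' (‖x - y‖ ^ 2)) (hB : HasDerivAt B B' (‖x - y‖ ^ 2))
    {F : Plane → CMat} (hF : ∀ z, x ≠ z → ∀ i j, F z i j =
      (if i = j then 1 else 0) * A (‖x - z‖ ^ 2)
        + B (‖x - z‖ ^ 2) * ((((x - z) i : ℝ) : ℂ) * (((x - z) j : ℝ) : ℂ))) :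
    (tractionMat lam mu m F y).transpose = combK lam mu m (x - y) (-2 * A')
      (-2 * ((‖x - y‖ ^ 2 : ℝ) : ℂ) * B' - 2 * B (‖x - y‖ ^ 2)) (-B (‖x - y‖ ^ 2)) := by
  -- Gradients are computed in the difference variable around the origin; `HasGrad.comp_sub` then
  -- supplies the minus sign of differentiation in the second point.
  have hA' : HasDerivAt A A' (‖x - y - 0‖ ^ 2) := by simpa using hA
  have hB' : HasDerivAt B B' (‖x - y - 0‖ ^ 2) := by simpa using hB
  have hgrad := fun i j => ((((hasGrad_radial hA').const_mul (if i = j then 1 else 0)).add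
    ((hasGrad_radial hB').mul ((hasGrad_coord 0 (x - y) i).mul
      (hasGrad_coord 0 (x - y) j))))).comp_sub.congr_of_eventuallyEq (f' := fun z => F z i j) (by
    filter_upwards [isOpen_ne.mem_nhds hxy.symm] with z hz
    rw [hF z (Ne.symm hz)]
    simp only [sub_zero])
  have hr : x - y ≠ 0 := sub_ne_zero.2 hxy
  have h0 := ofReal_norm_sq_ne_zero hr
  ext i j
  rw [combK_apply lam mu m hr, Matrix.transpose_apply, tractionMat_apply lam mu m hgrad]
  simp only [sub_zero]
  generalize B (‖x - y‖ ^ 2) = b at *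
  simp only [norm_sq_plane]
  generalize x - y = r at *
  fin_cases i <;> fin_cases j <;>
  · simp [Fin.sum_univ_two]
    field_simp
    ring

set_option maxHeartbeats 1000000 in
/-- Traction in the first variable of a double layer kernel with radial coefficients. -/
theorem tractionMat_combK (lam mu : ℝ) (n m : Fin 2 → ℝ) {β₂ β₃ β₄ : ℝ → ℂ} {β₂' β₃' β₄' : ℂ}
    {x y : Plane} (hxy : x ≠ y) (h₂ : HasDerivAt β₂ β₂' (‖x - y‖ ^ 2))
    (h₃ : HasDerivAt β₃ β₃' (‖x - y‖ ^ 2)) (h₄ : HasDerivAt β₄ β₄' (‖x - y‖ ^ 2))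
    {F : Plane → CMat} (hF : ∀ z, z ≠ y → F z = combK lam mu m (z - y)
      (β₂ (‖z - y‖ ^ 2)) (β₃ (‖z - y‖ ^ 2)) (β₄ (‖z - y‖ ^ 2))) :
    tractionMat lam mu n F x = combW lam mu n m (x - y) (2 * β₂') (β₂ (‖x - y‖ ^ 2))
      (2 * β₃') (β₃ (‖x - y‖ ^ 2)) (2 * β₄') (β₄ (‖x - y‖ ^ 2)) := by
  have hr : x - y ≠ 0 := sub_ne_zero.2 hxy
  have hρ : ((‖x - y‖ ^ 2 : ℝ) : ℂ) ≠ 0 := by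
    have : ‖x - y‖ ^ 2 ≠ 0 := by positivity
    exact_mod_cast this
  -- The three scalars of the normal form `combK_apply`; the last one carries the factor 1/ρ.
  have ha := ((h₂.add h₃).const_mul (lam : ℂ)).add (h₄.const_mul (lam + 2 * mu : ℂ))
  have hb := (h₂.add h₄).const_mul (mu : ℂ)
  have he := ((h₃.sub (h₄.const_mul 2)).const_mul (2 * mu : ℂ)).div
    (hasDerivAt_id (‖x - y‖ ^ 2)).ofReal_comp hρ
  have hmr := ((hasGrad_coord y x 0).const_mul (m 0 : ℂ)).add
    ((hasGrad_coord y x 1).const_mul (m 1 : ℂ))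
  have hgrad := fun i j => ((((hasGrad_radial ha).const_mul (m j : ℂ)).mul
    (hasGrad_coord y x i)).add ((hasGrad_radial hb).mul
      (((hasGrad_coord y x j).const_mul (m i : ℂ)).add
        (hmr.const_mul (if i = j then 1 else 0))))).add
    ((hasGrad_radial he).mul (hmr.mul ((hasGrad_coord y x i).mul (hasGrad_coord y x j))))
    |>.congr_of_eventuallyEq (f' := fun z => F z i j) (by
      filter_upwards [isOpen_ne.mem_nhds hxy] with z hz
      rw [hF z hz, combK_apply lam mu m (sub_ne_zero.2 hz)]
      simp only [Pi.add_apply, Pi.sub_apply, Pi.div_apply, id, norm_sq_plane]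
      push_cast
      ring)
  have h0 := ofReal_norm_sq_ne_zero hr
  ext i j
  rw [tractionMat_apply lam mu n hgrad]
  simp only [Pi.add_apply, Pi.sub_apply, Pi.div_apply, id]
  generalize β₂ (‖x - y‖ ^ 2) = b₂ at *
  generalize β₃ (‖x - y‖ ^ 2) = b₃ at *
  generalize β₄ (‖x - y‖ ^ 2) = b₄ at *
  simp only [norm_sq_plane]
  clear ha hb he hmr hgrad h₂ h₃ h₄ hF hρ
  generalize x - y = r at *
  fin_cases i <;> fin_cases j <;>
  · simp [Fin.sum_univ_two, combW, toC, matU1, matU2, matR1, matR2, matR3, matS, matG,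
      Matrix.mul_apply, Matrix.vecMulVec_apply, dotProduct, norm_sq_plane]
    field_simp
    ring

/-! ## The fundamental solution in radial form -/

/-- Coefficient of `I` in the fundamental solution `A(ρ) I + B(ρ) r rᵀ`, `ρ = |r|²`. -/
noncomputable def radA (p s om ρ : ℝ) : ℂ :=
  1 / (om : ℂ) ^ 2 * (s ^ 2 * hankelScaled 0 s ρ - s ^ 2 * hankelScaled 1 s ρ
    + p ^ 2 * hankelScaled 1 p ρ)

/-- Coefficient of `r rᵀ` in the fundamental solution. -/
noncomputable def radB (p s om ρ : ℝ) : ℂ :=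
  1 / (om : ℂ) ^ 2 * (s ^ 4 * hankelScaled 2 s ρ - p ^ 4 * hankelScaled 2 p ρ)

/-- Coefficient of `U₁ᵀ` in the double layer kernel, `-2 A'`. -/
noncomputable def radBeta2 (p s om ρ : ℝ) : ℂ :=
  1 / (om : ℂ) ^ 2 * (s ^ 4 * hankelScaled 1 s ρ - s ^ 4 * hankelScaled 2 s ρ
    + p ^ 4 * hankelScaled 2 p ρ)

/-- Coefficient of `G U₁ᵀ` in the double layer kernel, `-2 ρ B' - 2 B`. -/
noncomputable def radBeta3 (p s om ρ : ℝ) : ℂ :=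
  1 / (om : ℂ) ^ 2 * (2 * s ^ 4 * hankelScaled 2 s ρ - s ^ 4 * hankelScaled 1 s ρ
    - 2 * p ^ 4 * hankelScaled 2 p ρ + p ^ 4 * hankelScaled 1 p ρ)

/-- The derivative of `radBeta2`. -/
noncomputable def radBeta2Deriv (p s om ρ : ℝ) : ℂ :=
  -(1 / 2) / (om : ℂ) ^ 2 * (s ^ 6 * hankelScaled 2 s ρ - s ^ 6 * hankelScaled 3 s ρ
    + p ^ 6 * hankelScaled 3 p ρ)

/-- The derivative of `radBeta3`. -/
noncomputable def radBeta3Deriv (p s om ρ : ℝ) : ℂ :=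
  -(1 / 2) / (om : ℂ) ^ 2 * (2 * s ^ 6 * hankelScaled 3 s ρ - s ^ 6 * hankelScaled 2 s ρ
    - 2 * p ^ 6 * hankelScaled 3 p ρ + p ^ 6 * hankelScaled 2 p ρ)

/-- The derivative of `radB`. -/
noncomputable def radBDeriv (p s om ρ : ℝ) : ℂ :=
  -(1 / 2) / (om : ℂ) ^ 2 * (s ^ 6 * hankelScaled 3 s ρ - p ^ 6 * hankelScaled 3 p ρ)

section
variable {p s om ρ : ℝ}

theorem hasDerivAt_radA (hp : p ≠ 0) (hs : s ≠ 0) (hρ : ρ ≠ 0) :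
    HasDerivAt (radA p s om) (-(1 / 2) * radBeta2 p s om ρ) ρ := by
  refine (((((hasDerivAt_hankelScaled_zero hs hρ).const_mul ((s : ℂ) ^ 2)).sub
    ((hasDerivAt_hankelScaled_one hs hρ).const_mul ((s : ℂ) ^ 2))).add
    ((hasDerivAt_hankelScaled_one hp hρ).const_mul ((p : ℂ) ^ 2))).const_mul
    (1 / (om : ℂ) ^ 2)).congr_deriv ?_
  rw [radBeta2]; ring

theorem hasDerivAt_radB (hp : p ≠ 0) (hs : s ≠ 0) (hρ : ρ ≠ 0) :
    HasDerivAt (radB p s om) (radBDeriv p s om ρ) ρ := by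
  refine ((((hasDerivAt_hankelScaled_two hs hρ).const_mul ((s : ℂ) ^ 4)).sub
    ((hasDerivAt_hankelScaled_two hp hρ).const_mul ((p : ℂ) ^ 4))).const_mul
    (1 / (om : ℂ) ^ 2)).congr_deriv ?_
  rw [radBDeriv]; ring

theorem hasDerivAt_radBeta2 (hp : p ≠ 0) (hs : s ≠ 0) (hρ : ρ ≠ 0) :
    HasDerivAt (radBeta2 p s om) (radBeta2Deriv p s om ρ) ρ := by
  refine (((((hasDerivAt_hankelScaled_one hs hρ).const_mul ((s : ℂ) ^ 4)).sub
    ((hasDerivAt_hankelScaled_two hs hρ).const_mul ((s : ℂ) ^ 4))).add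
    ((hasDerivAt_hankelScaled_two hp hρ).const_mul ((p : ℂ) ^ 4))).const_mul
    (1 / (om : ℂ) ^ 2)).congr_deriv ?_
  rw [radBeta2Deriv]; ring

theorem hasDerivAt_radBeta3 (hp : p ≠ 0) (hs : s ≠ 0) (hρ : ρ ≠ 0) :
    HasDerivAt (radBeta3 p s om) (radBeta3Deriv p s om ρ) ρ := by
  refine ((((((hasDerivAt_hankelScaled_two hs hρ).const_mul (2 * (s : ℂ) ^ 4)).sub
    ((hasDerivAt_hankelScaled_one hs hρ).const_mul ((s : ℂ) ^ 4))).sub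
    ((hasDerivAt_hankelScaled_two hp hρ).const_mul (2 * (p : ℂ) ^ 4))).add
    ((hasDerivAt_hankelScaled_one hp hρ).const_mul ((p : ℂ) ^ 4))).const_mul
    (1 / (om : ℂ) ^ 2)).congr_deriv ?_
  rw [radBeta3Deriv]; ring

/-- The term ρ B' contains ρ times order 3, which the three-term recurrence turns into orders 1 and
2. -/
theorem radBeta3_eq (hp : p ≠ 0) (hs : s ≠ 0) (hρ : ρ ≠ 0) :
    radBeta3 p s om ρ = -2 * (ρ : ℂ) * radBDeriv p s om ρ - 2 * radB p s om ρ := by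
  rw [radBeta3, radBDeriv, radB, hankelScaled_one hs hρ, hankelScaled_one hp hρ]
  ring

end

theorem norm_sub_sq_ne_zero {x y : Plane} (h : x ≠ y) : ‖x - y‖ ^ 2 ≠ 0 :=
  pow_ne_zero 2 (norm_ne_zero_iff.2 (sub_ne_zero.2 h))

/-- With h_n = `hankelScaled n k`, the gradient of h_0 is -k² h_1 r, so its Hessian is -k² h_1 I +
k⁴ h_2 r rᵀ. Subtracting the two wave numbers and writing 1/μ as k_s²/ω² gives A and B. -/
theorem fundSol_apply {lam mu om : ℝ} (hmu : mu ≠ 0) (hom : om ≠ 0) (hp : 0 < kP lam mu om)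
    (hs : 0 < kS mu om) (hs2 : kS mu om ^ 2 * mu = om ^ 2) {x y : Plane} (hxy : x ≠ y)
    (i j : Fin 2) :
    fundSol lam mu om x y i j
      = (if i = j then 1 else 0) * radA (kP lam mu om) (kS mu om) om (‖x - y‖ ^ 2)
        + radB (kP lam mu om) (kS mu om) om (‖x - y‖ ^ 2)
          * ((((x - y) i : ℝ) : ℂ) * (((x - y) j : ℝ) : ℂ)) := by
  rw [fundSol]
  generalize kP lam mu om = p at *
  generalize kS mu om = s at *
  have hphi0 : ∀ z, z ≠ y → ∀ k, 0 < k →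
      hphi 0 (k * ‖z - y‖) = hankelScaled 0 k (‖z - y‖ ^ 2) := fun z hz k hk =>
    hphi_zero_eq hk (norm_pos_iff.2 (sub_ne_zero.2 hz))
  -- The gradient is needed at all points near `x`, because it is differentiated once more.
  have hg : ∀ z, z ≠ y → ∀ j, pd j
      (fun z => hphi 0 (s * ‖z - y‖) - hphi 0 (p * ‖z - y‖)) z
      = (-(s : ℂ) ^ 2 * hankelScaled 1 s (‖z - y‖ ^ 2)
        + (p : ℂ) ^ 2 * hankelScaled 1 p (‖z - y‖ ^ 2)) * (((z - y) j : ℝ) : ℂ) := by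
    intro z hz j
    have hρ := norm_sub_sq_ne_zero hz
    have h := ((hasGrad_radial (hasDerivAt_hankelScaled_zero hs.ne' hρ)).add
      ((hasGrad_radial (hasDerivAt_hankelScaled_zero hp.ne' hρ)).const_mul
        (-1))).congr_of_eventuallyEq (f' := fun z => hphi 0 (s * ‖z - y‖) - hphi 0 (p * ‖z - y‖))
      (by
        filter_upwards [isOpen_ne.mem_nhds hz] with w hw
        rw [hphi0 w hw s hs, hphi0 w hw p hp]
        ring)
    rw [h.pd_eq]
    ring
  have hρ := norm_sub_sq_ne_zero hxy
  have h := ((((hasGrad_radial (hasDerivAt_hankelScaled_one hs.ne' hρ)).const_mul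
      (-(s : ℂ) ^ 2)).add
    ((hasGrad_radial (hasDerivAt_hankelScaled_one hp.ne' hρ)).const_mul ((p : ℂ) ^ 2))).mul
    (hasGrad_coord y x j)).congr_of_eventuallyEq
    (f' := pd j (fun z => hphi 0 (s * ‖z - y‖) - hphi 0 (p * ‖z - y‖)))
      (by
        filter_upwards [isOpen_ne.mem_nhds hxy] with w hw
        rw [hg w hw])
  have hmu' : (mu : ℂ) ≠ 0 := by exact_mod_cast hmu
  have hom' : (om : ℂ) ≠ 0 := by exact_mod_cast hom
  have hs2' : (s : ℂ) ^ 2 * mu = om ^ 2 := by exact_mod_cast hs2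
  have hinv : 1 / (mu : ℂ) = s ^ 2 / om ^ 2 := by
    rw [← hs2']
    have : (s : ℂ) ≠ 0 := by exact_mod_cast hs.ne'
    field_simp
  rw [Matrix.add_apply, Matrix.smul_apply, Matrix.smul_apply, Matrix.of_apply, h.pd_eq,
    hphi0 x hxy s hs, hinv, Matrix.one_apply, radA, radB]
  simp only [smul_eq_mul, mul_ite, ite_mul, mul_one, mul_zero, zero_mul, one_mul]
  split_ifs <;> ring

theorem kernelK_eq_combK {lam mu om : ℝ} (hmu : mu ≠ 0) (hom : om ≠ 0) (hp : 0 < kP lam mu om)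
    (hs : 0 < kS mu om) (hs2 : kS mu om ^ 2 * mu = om ^ 2) (m : Fin 2 → ℝ) {x y : Plane}
    (hxy : x ≠ y) :
    (tractionMat lam mu m (fun y => fundSol lam mu om x y) y).transpose
      = combK lam mu m (x - y) (radBeta2 (kP lam mu om) (kS mu om) om (‖x - y‖ ^ 2))
        (radBeta3 (kP lam mu om) (kS mu om) om (‖x - y‖ ^ 2))
        (-radB (kP lam mu om) (kS mu om) om (‖x - y‖ ^ 2)) := by
  have hρ := norm_sub_sq_ne_zero hxy
  rw [tractionMat_radial lam mu m hxy (hasDerivAt_radA hp.ne' hs.ne' hρ)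
    (hasDerivAt_radB hp.ne' hs.ne' hρ)
    (fun z hz i j => fundSol_apply hmu hom hp hs hs2 hz i j), radBeta3_eq hp.ne' hs.ne' hρ]
  congr 1
  ring

theorem kernelW_eq_combW {lam mu om : ℝ} (hmu : mu ≠ 0) (hom : om ≠ 0) (hp : 0 < kP lam mu om)
    (hs : 0 < kS mu om) (hs2 : kS mu om ^ 2 * mu = om ^ 2) (x : ℝ → Plane) {τ t : ℝ}
    (hxy : x τ ≠ x t) :
    kernelW lam mu om x τ t
      = combW lam mu (normalField x τ) (normalField x t) (x τ - x t)
        (2 * radBeta2Deriv (kP lam mu om) (kS mu om) om (‖x τ - x t‖ ^ 2))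
        (radBeta2 (kP lam mu om) (kS mu om) om (‖x τ - x t‖ ^ 2))
        (2 * radBeta3Deriv (kP lam mu om) (kS mu om) om (‖x τ - x t‖ ^ 2))
        (radBeta3 (kP lam mu om) (kS mu om) om (‖x τ - x t‖ ^ 2))
        (2 * (-radBDeriv (kP lam mu om) (kS mu om) om (‖x τ - x t‖ ^ 2)))
        (-radB (kP lam mu om) (kS mu om) om (‖x τ - x t‖ ^ 2)) := by
  have hρ := norm_sub_sq_ne_zero hxy
  exact tractionMat_combK lam mu _ _ hxy (hasDerivAt_radBeta2 hp.ne' hs.ne' hρ)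
    (hasDerivAt_radBeta3 hp.ne' hs.ne' hρ) (hasDerivAt_radB hp.ne' hs.ne' hρ).neg
    (fun z hz => kernelK_eq_combK hmu hom hp hs hs2 _ hz)

/-! ## Splitting of the radial coefficients -/

theorem hankelScaled_sq (n : ℕ) (k z : ℝ) : hankelScaled n k (z ^ 2)
    = -(1 / (2 * (Real.pi : ℂ))) * Real.log z * besselEntire n k (z ^ 2)
      + hankelEntire n k (z ^ 2) + hankelSing n k (z ^ 2) := by
  rw [hankelScaled, Real.log_pow]
  push_cast
  ring

section
variable {p s om z : ℝ}

/-- The simple poles of the two order-1 terms cancel. The logarithmic coefficient at ρ = 0 is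
-(s²+p²)/(4πω²), which is split off as the elastostatic part. -/
theorem radA_eq (hp : 0 < p) (hs : 0 < s) (hom : om ≠ 0) (hz : 0 < z) :
    radA p s om (z ^ 2) = (-((s ^ 2 + p ^ 2) / (4 * Real.pi * om ^ 2)) * Real.log z : ℝ)
      + ((Real.log z * (aLog2 p s om z * z ^ 2) : ℝ) : ℂ) + aReg4 p s om z := by
  rw [radA, aLog2, aReg4]
  simp only [hankelScaled_sq, jq_eq _ hp.ne' hz.ne', jq_eq _ hs.ne' hz.ne',
    hphiReg_eq (by norm_num : 1 < 4) hp hz, hphiReg_eq (by norm_num : 1 < 4) hs hz,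
    hphiReg_eq (by norm_num : 0 < 4) hs hz, hankelSing]
  have h1 : (p : ℂ) ≠ 0 := by exact_mod_cast hp.ne'
  have h2 : (s : ℂ) ≠ 0 := by exact_mod_cast hs.ne'
  have h3 : (z : ℂ) ≠ 0 := by exact_mod_cast hz.ne'
  have h4 : (om : ℂ) ≠ 0 := by exact_mod_cast hom
  have h5 : (Real.pi : ℂ) ≠ 0 := by exact_mod_cast Real.pi_ne_zero
  push_cast
  field_simp
  ring

/-- The division by z² is only apparent: j_0 - 2 j_1 = -k² z² j_2. -/
theorem aLog3_eq (hp : 0 < p) (hs : 0 < s) (hz : 0 < z) :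
    aLog3 p s om z = 1 / (2 * Real.pi * om ^ 2) *
      (p ^ 4 * besselEntire 2 p (z ^ 2) - s ^ 4 * besselEntire 2 s (z ^ 2)) := by
  rw [aLog3]
  simp only [jq_eq _ hp.ne' hz.ne', jq_eq _ hs.ne' hz.ne', besselEntire_zero]
  field_simp
  ring

/-- The constant (p² - s²)/(4π) in the coefficient compensates the inhomogeneity of
`hankelEntire_zero`; the rest is divisible by z². -/
theorem aReg5_eq (hp : 0 < p) (hs : 0 < s) (hz : 0 < z) :
    aReg5 p s om z = 1 / (om : ℂ) ^ 2 *
      (s ^ 4 * hankelEntire 2 s (z ^ 2) - p ^ 4 * hankelEntire 2 p (z ^ 2)) := by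
  rw [aReg5]
  simp only [hphiReg_eq (by norm_num : 1 < 4) hp hz, hphiReg_eq (by norm_num : 1 < 4) hs hz,
    hphiReg_eq (by norm_num : 0 < 4) hp hz, hphiReg_eq (by norm_num : 0 < 4) hs hz,
    hankelEntire_zero]
  have h3 : (z : ℂ) ≠ 0 := by exact_mod_cast hz.ne'
  have h5 : (Real.pi : ℂ) ≠ 0 := by exact_mod_cast Real.pi_ne_zero
  push_cast
  field_simp
  ring

/-- The double poles 1/(πρ²) of the two wave numbers cancel; the simple pole becomes the G-term of
V₀. -/
theorem radB_eq (hp : 0 < p) (hs : 0 < s) (hom : om ≠ 0) (hz : 0 < z) :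
    radB p s om (z ^ 2) = ((s ^ 2 - p ^ 2) / (4 * Real.pi * om ^ 2 * z ^ 2) : ℝ)
      + ((Real.log z * aLog3 p s om z : ℝ) : ℂ) + aReg5 p s om z := by
  rw [radB, aLog3_eq hp hs hz, aReg5_eq hp hs hz]
  simp only [hankelScaled_sq, hankelSing]
  have h1 : (p : ℂ) ≠ 0 := by exact_mod_cast hp.ne'
  have h2 : (s : ℂ) ≠ 0 := by exact_mod_cast hs.ne'
  have h3 : (z : ℂ) ≠ 0 := by exact_mod_cast hz.ne'
  have h4 : (om : ℂ) ≠ 0 := by exact_mod_cast hom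
  have h5 : (Real.pi : ℂ) ≠ 0 := by exact_mod_cast Real.pi_ne_zero
  push_cast
  field_simp
  ring

theorem radBeta2_eq (hp : 0 < p) (hs : 0 < s) (hom : om ≠ 0) (hz : 0 < z) :
    radBeta2 p s om (z ^ 2) = ((s ^ 2 + p ^ 2) / (4 * Real.pi * om ^ 2 * z ^ 2) : ℝ)
      + ((Real.log z * bLog2 p s om z : ℝ) : ℂ) + bReg5 p s om z := by
  rw [radBeta2, bLog2, bReg5]
  simp only [hankelScaled_sq, hankelSing, jq_eq _ hp.ne' hz.ne', jq_eq _ hs.ne' hz.ne',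
    hphiReg_eq (by norm_num : 1 < 4) hs hz, hphiReg_eq (by norm_num : 2 < 4) hp hz,
    hphiReg_eq (by norm_num : 2 < 4) hs hz]
  have h1 : (p : ℂ) ≠ 0 := by exact_mod_cast hp.ne'
  have h2 : (s : ℂ) ≠ 0 := by exact_mod_cast hs.ne'
  have h3 : (z : ℂ) ≠ 0 := by exact_mod_cast hz.ne'
  have h4 : (om : ℂ) ≠ 0 := by exact_mod_cast hom
  have h5 : (Real.pi : ℂ) ≠ 0 := by exact_mod_cast Real.pi_ne_zero
  push_cast
  field_simp
  ring

/-- All poles cancel, in accordance with B being a multiple of 1/ρ in the static case, where -2ρB' -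
2B = 0. -/
theorem radBeta3_split (hp : 0 < p) (hs : 0 < s) (hom : om ≠ 0) (hz : 0 < z) :
    radBeta3 p s om (z ^ 2)
      = ((Real.log z * bLog3 p s om z : ℝ) : ℂ) + bReg6 p s om z := by
  rw [radBeta3, bLog3, bReg6]
  simp only [hankelScaled_sq, hankelSing, jq_eq _ hp.ne' hz.ne', jq_eq _ hs.ne' hz.ne',
    hphiReg_eq (by norm_num : 1 < 4) hs hz, hphiReg_eq (by norm_num : 2 < 4) hp hz,
    hphiReg_eq (by norm_num : 1 < 4) hp hz, hphiReg_eq (by norm_num : 2 < 4) hs hz]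
  have h1 : (p : ℂ) ≠ 0 := by exact_mod_cast hp.ne'
  have h2 : (s : ℂ) ≠ 0 := by exact_mod_cast hs.ne'
  have h3 : (z : ℂ) ≠ 0 := by exact_mod_cast hz.ne'
  have h4 : (om : ℂ) ≠ 0 := by exact_mod_cast hom
  have h5 : (Real.pi : ℂ) ≠ 0 := by exact_mod_cast Real.pi_ne_zero
  push_cast
  field_simp
  ring

/-- The constant (3s⁴+p⁴)/(16πω²) in `cReg7` is a surviving simple pole in ρ. It is not static and
is kept over z², where it multiplies a product of two matrices linear in r. -/
theorem radBeta2Deriv_eq (hp : 0 < p) (hs : 0 < s) (hom : om ≠ 0) (hz : 0 < z) :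
    2 * radBeta2Deriv p s om (z ^ 2) = (-((s ^ 2 + p ^ 2) / (2 * Real.pi * om ^ 2 * z ^ 4)) : ℝ)
      + ((Real.log z * (cLog1 p s om z / z ^ 2) : ℝ) : ℂ) + cReg7 p s om z / (z : ℂ) ^ 2 := by
  rw [radBeta2Deriv, cLog1, cReg7]
  simp only [hankelScaled_sq, hankelSing, jq_eq _ hp.ne' hz.ne', jq_eq _ hs.ne' hz.ne',
    hphiReg_eq (by norm_num : 2 < 4) hs hz, hphiReg_eq (by norm_num : 3 < 4) hp hz,
    hphiReg_eq (by norm_num : 3 < 4) hs hz]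
  have h1 : (p : ℂ) ≠ 0 := by exact_mod_cast hp.ne'
  have h2 : (s : ℂ) ≠ 0 := by exact_mod_cast hs.ne'
  have h3 : (z : ℂ) ≠ 0 := by exact_mod_cast hz.ne'
  have h4 : (om : ℂ) ≠ 0 := by exact_mod_cast hom
  have h5 : (Real.pi : ℂ) ≠ 0 := by exact_mod_cast Real.pi_ne_zero
  push_cast
  field_simp
  ring

theorem radBeta3Deriv_eq (hp : 0 < p) (hs : 0 < s) (hom : om ≠ 0) (hz : 0 < z) :
    2 * radBeta3Deriv p s om (z ^ 2)
      = ((Real.log z * (cLog3 p s om z / z ^ 2) : ℝ) : ℂ) + cReg9 p s om z / (z : ℂ) ^ 2 := by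
  rw [radBeta3Deriv, cLog3, cReg9]
  simp only [hankelScaled_sq, hankelSing, jq_eq _ hp.ne' hz.ne', jq_eq _ hs.ne' hz.ne',
    hphiReg_eq (by norm_num : 2 < 4) hs hz, hphiReg_eq (by norm_num : 3 < 4) hp hz,
    hphiReg_eq (by norm_num : 2 < 4) hp hz, hphiReg_eq (by norm_num : 3 < 4) hs hz]
  have h1 : (p : ℂ) ≠ 0 := by exact_mod_cast hp.ne'
  have h2 : (s : ℂ) ≠ 0 := by exact_mod_cast hs.ne'
  have h3 : (z : ℂ) ≠ 0 := by exact_mod_cast hz.ne'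
  have h4 : (om : ℂ) ≠ 0 := by exact_mod_cast hom
  have h5 : (Real.pi : ℂ) ≠ 0 := by exact_mod_cast Real.pi_ne_zero
  push_cast
  field_simp
  ring

theorem cLog5_eq (hp : 0 < p) (hs : 0 < s) (hz : 0 < z) :
    cLog5 p s om z = 1 / (2 * Real.pi * om ^ 2) *
      (4 * p ^ 4 * besselEntire 2 p (z ^ 2) - p ^ 4 * besselEntire 1 p (z ^ 2)
        - 4 * s ^ 4 * besselEntire 2 s (z ^ 2) + s ^ 4 * besselEntire 1 s (z ^ 2)) := by
  rw [cLog5]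
  simp only [jq_eq _ hp.ne' hz.ne', jq_eq _ hs.ne' hz.ne', besselJ_eq, besselEntire_zero]
  field_simp
  ring

theorem cReg11_eq (hp : 0 < p) (hs : 0 < s) (hom : om ≠ 0) (hz : 0 < z) :
    cReg11 p s om z = -(1 / (om : ℂ) ^ 2) *
      (4 * p ^ 4 * hankelEntire 2 p (z ^ 2) - p ^ 4 * hankelEntire 1 p (z ^ 2)
        - 4 * s ^ 4 * hankelEntire 2 s (z ^ 2) + s ^ 4 * hankelEntire 1 s (z ^ 2)) := by
  rw [cReg11]
  simp only [hphiReg_eq (by norm_num : 1 < 4) hp hz, hphiReg_eq (by norm_num : 1 < 4) hs hz,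
    hphiReg_eq (by norm_num : 0 < 4) hp hz, hphiReg_eq (by norm_num : 0 < 4) hs hz,
    hphiReg_eq (by norm_num : 2 < 4) hp hz, hphiReg_eq (by norm_num : 2 < 4) hs hz,
    hankelEntire_zero]
  have h3 : (z : ℂ) ≠ 0 := by exact_mod_cast hz.ne'
  have h4 : (om : ℂ) ≠ 0 := by exact_mod_cast hom
  have h5 : (Real.pi : ℂ) ≠ 0 := by exact_mod_cast Real.pi_ne_zero
  push_cast
  field_simp
  ring

/-- The reduced coefficients `cLog5` and `cReg11` contain 4 j_2 - j_1 = k²ρ j_3 and its Hankel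
analogue, whose constant accounts for the simple pole of order 3. -/
theorem radBDeriv_eq (hp : 0 < p) (hs : 0 < s) (hom : om ≠ 0) (hz : 0 < z) :
    2 * (-radBDeriv p s om (z ^ 2)) = ((s ^ 2 - p ^ 2) / (2 * Real.pi * om ^ 2 * z ^ 4) : ℝ)
      + ((Real.log z * (cLog5 p s om z / z ^ 2) : ℝ) : ℂ) + cReg11 p s om z / (z : ℂ) ^ 2 := by
  rw [radBDeriv, cLog5_eq hp hs hz, cReg11_eq hp hs hom hz]
  simp only [hankelScaled_sq, hankelSing, besselEntire_one, hankelEntire_one]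
  have h1 : (p : ℂ) ≠ 0 := by exact_mod_cast hp.ne'
  have h2 : (s : ℂ) ≠ 0 := by exact_mod_cast hs.ne'
  have h3 : (z : ℂ) ≠ 0 := by exact_mod_cast hz.ne'
  have h4 : (om : ℂ) ≠ 0 := by exact_mod_cast hom
  have h5 : (Real.pi : ℂ) ≠ 0 := by exact_mod_cast Real.pi_ne_zero
  push_cast
  field_simp
  ring

end

/-! ## The elastostatic kernels -/

theorem hasDerivAt_coord {x : ℝ → Plane} {t : ℝ} (hx : DifferentiableAt ℝ x t) (i : Fin 2) :
    HasDerivAt (fun s => x s i) (deriv x t i) t :=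
  (EuclideanSpace.proj i : Plane →L[ℝ] ℝ).hasFDerivAt.comp_hasDerivAt t hx.hasDerivAt

theorem log_norm_plane (r : Plane) : Real.log ‖r‖ = 1 / 2 * Real.log (r 0 ^ 2 + r 1 ^ 2) := by
  rw [← norm_sq_plane, Real.log_pow]
  push_cast
  ring

/-- The scalars are -2A', -2ρB' - 2B and -B for the static A = -(λ+3μ)/(8πμ(λ+2μ)) log ρ and B =
(λ+μ)/(4πμ(λ+2μ)ρ). The tangential derivative fits in because ν is x' rotated by a right angle. -/
theorem toC_kernelK0 {lam mu : ℝ} (hmu : mu ≠ 0) (hlm : lam + 2 * mu ≠ 0) {x : ℝ → Plane}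
    (hx : Differentiable ℝ x) {τ t : ℝ} (hxy : x τ ≠ x t) :
    toC (kernelK0 lam mu x τ t) = combK lam mu (normalField x t) (x τ - x t)
      ((lam + 3 * mu) / (4 * Real.pi * mu * (lam + 2 * mu) * ‖x τ - x t‖ ^ 2) : ℝ) 0
      (-((lam + mu) / (4 * Real.pi * mu * (lam + 2 * mu) * ‖x τ - x t‖ ^ 2)) : ℝ) := by
  have hρ := norm_sub_sq_ne_zero hxy
  rw [norm_sq_plane] at hρ
  have hr := sub_ne_zero.2 hxy
  have h0 := ofReal_norm_sq_ne_zero hr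
  have hd : ∀ i, HasDerivAt (fun s => (x τ - x s) i) (-(deriv x t i)) t := fun i =>
    (hasDerivAt_coord (hx t) i).const_sub (x τ i)
  have hlog := (((((hd 0).pow 2).add ((hd 1).pow 2)).log hρ).const_mul
    (1 / 2)).const_mul (1 / (2 * Real.pi))
  have e : deriv (fun s => 1 / (2 * Real.pi) * Real.log ‖x τ - x s‖) t = _ :=
    (hlog.congr_of_eventuallyEq (.of_forall fun s => by simp [log_norm_plane])).deriv
  ext i j
  rw [combK_apply lam mu _ hr, toC, Matrix.map_apply, kernelK0, e]
  simp only [normalField, norm_sq_plane, matG, Pi.add_apply, Pi.pow_apply]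
  clear e hlog hd
  generalize x τ - x t = r at *
  generalize deriv x t = d at *
  have h5 : (Real.pi : ℂ) ≠ 0 := by exact_mod_cast Real.pi_ne_zero
  have h6 : (mu : ℂ) ≠ 0 := by exact_mod_cast hmu
  have h7 : (lam : ℂ) + 2 * mu ≠ 0 := by exact_mod_cast hlm
  fin_cases i <;> fin_cases j <;>
  · simp [dotProduct, Fin.sum_univ_two]
    field_simp
    ring

-- The scalars are those of `toC_kernelK0` and twice their ρ-derivatives, since 2 d/dρ (c/ρ) =
-- -2c/ρ². The mixed derivative is expanded and compared entry by entry.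
set_option maxHeartbeats 2000000 in
theorem toC_kernelW0 {lam mu : ℝ} (hmu : mu ≠ 0) (hlm : lam + 2 * mu ≠ 0) {x : ℝ → Plane}
    (hx : Differentiable ℝ x) {τ t : ℝ} (hxy : x τ ≠ x t) :
    toC (kernelW0 lam mu x τ t)
      = combW lam mu (normalField x τ) (normalField x t) (x τ - x t)
        (-((lam + 3 * mu) / (2 * Real.pi * mu * (lam + 2 * mu) * ‖x τ - x t‖ ^ 4)) : ℝ)
        ((lam + 3 * mu) / (4 * Real.pi * mu * (lam + 2 * mu) * ‖x τ - x t‖ ^ 2) : ℝ) 0 0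
        ((lam + mu) / (2 * Real.pi * mu * (lam + 2 * mu) * ‖x τ - x t‖ ^ 4) : ℝ)
        (-((lam + mu) / (4 * Real.pi * mu * (lam + 2 * mu) * ‖x τ - x t‖ ^ 2)) : ℝ) := by
  have hr := sub_ne_zero.2 hxy
  have h0 := ofReal_norm_sq_ne_zero hr
  have hsq : ∀ s, x s ≠ x t → (x s - x t) 0 ^ 2 + (x s - x t) 1 ^ 2 ≠ 0 := fun s hs => by
    rw [← norm_sq_plane]; exact norm_sub_sq_ne_zero hs
  have hdt : ∀ s i, HasDerivAt (fun u => (x s - x u) i) (-(deriv x t i)) t := fun s i =>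
    (hasDerivAt_coord (hx t) i).const_sub (x s i)
  have hdτ : ∀ i, HasDerivAt (fun s => (x s - x t) i) (deriv x τ i) τ := fun i =>
    (hasDerivAt_coord (hx τ) i).sub_const (x t i)
  have hsq_t := fun s => ((hdt s 0).pow 2).add ((hdt s 1).pow 2)
  -- The inner derivative is required in closed form for all `s` near `τ`, so that it can be
  -- differentiated again.
  have hin : ∀ s, x s ≠ x t → ∀ i j : Fin 2, deriv (fun u =>
      1 / Real.pi * ((-Real.log ‖x s - x u‖) • (1 : RMat) + matG (x s - x u)) i j) t
      = 1 / Real.pi * (((x s - x t) 0 * deriv x t 0 + (x s - x t) 1 * deriv x t 1)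
            / ((x s - x t) 0 ^ 2 + (x s - x t) 1 ^ 2) * (if i = j then 1 else 0)
          - (deriv x t i * (x s - x t) j + (x s - x t) i * deriv x t j)
            / ((x s - x t) 0 ^ 2 + (x s - x t) 1 ^ 2)
          + 2 * ((x s - x t) i * (x s - x t) j)
            * ((x s - x t) 0 * deriv x t 0 + (x s - x t) 1 * deriv x t 1)
            / ((x s - x t) 0 ^ 2 + (x s - x t) 1 ^ 2) ^ 2) := by
    intro s hs i j
    have h := (((((hsq_t s).log (hsq s hs)).const_mul (-(1 / 2))).mul_const
      (if i = j then (1 : ℝ) else 0)).add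
      (((hdt s i).mul (hdt s j)).div (hsq_t s) (hsq s hs))).const_mul (1 / Real.pi)
    have hρ := hsq s hs
    refine ((h.congr_of_eventuallyEq (.of_forall fun u => ?_)).congr_deriv ?_).deriv
    · simp only [log_norm_plane, matG, Matrix.one_apply, norm_sq_plane, Matrix.add_apply,
        Matrix.smul_apply, Matrix.of_apply, smul_eq_mul, Pi.add_apply, Pi.pow_apply,
        Pi.mul_apply, Pi.div_apply]
      ring
    · simp only [Pi.add_apply, Pi.pow_apply, Pi.mul_apply]
      generalize (if i = j then (1 : ℝ) else 0) = δ
      have := Real.pi_ne_zero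
      push_cast
      field_simp
      ring
  have hρ := hsq τ hxy
  have hsq_τ := ((hdτ 0).pow 2).add ((hdτ 1).pow 2)
  have hdot := ((hdτ 0).mul_const (deriv x t 0)).add ((hdτ 1).mul_const (deriv x t 1))
  have hout := fun i j : Fin 2 => (((((hdot.div hsq_τ hρ).mul_const
      (if i = j then (1 : ℝ) else 0)).sub
    ((((hdτ j).const_mul (deriv x t i)).add ((hdτ i).mul_const (deriv x t j))).div hsq_τ hρ)).add
    (((((hdτ i).mul (hdτ j)).const_mul 2).mul hdot).div (hsq_τ.pow 2)
      (pow_ne_zero 2 hρ))).const_mul (1 / Real.pi)).congr_of_eventuallyEq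
    (f₁ := fun s => deriv (fun u =>
      1 / Real.pi * ((-Real.log ‖x s - x u‖) • (1 : RMat) + matG (x s - x u)) i j) t) (by
      have hc : ContinuousAt x τ := hx.continuous.continuousAt
      filter_upwards [hc.eventually_ne hxy] with s hs
      rw [hin s hs]
      simp)
  have h5 : (Real.pi : ℂ) ≠ 0 := by exact_mod_cast Real.pi_ne_zero
  have h6 : (mu : ℂ) ≠ 0 := by exact_mod_cast hmu
  have h7 : (lam : ℂ) + 2 * mu ≠ 0 := by exact_mod_cast hlm
  have h4 : ‖x τ - x t‖ ^ 4 = ((x τ - x t) 0 ^ 2 + (x τ - x t) 1 ^ 2) ^ 2 := by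
    rw [← norm_sq_plane]; ring
  -- Tangents are rewritten through normals, so both sides use the same vectors.
  have n0 : ∀ t, deriv x t 0 = -normalField x t 1 := fun t => by simp [normalField]
  have n1 : ∀ t, deriv x t 1 = normalField x t 0 := fun t => by simp [normalField]
  ext i j
  rw [toC, Matrix.map_apply, kernelW0, Matrix.smul_apply, Matrix.of_apply, (hout i j).deriv]
  simp only [norm_sq_plane, h4]
  clear hout hdot hsq_τ hin hsq_t hdτ hdt hsq h4
  simp only [Pi.add_apply, Pi.pow_apply, Pi.mul_apply]
  generalize x τ - x t = r at *
  fin_cases i <;> fin_cases j <;>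
  · simp [n0, n1, combW, toC, matU1, matU2, matR1, matR2, matR3, matS, matG,
      Matrix.mul_apply, Matrix.vecMulVec_apply, dotProduct, Fin.sum_univ_two, norm_sq_plane]
    field_simp
    ring

/-! ## The splittings away from the diagonal -/

theorem logPartK_eq (lam mu om : ℝ) (x : ℝ → Plane) (τ t : ℝ) :
    logPartK lam mu om x τ t = combK lam mu (normalField x t) (x τ - x t)
      (bLog2 (kP lam mu om) (kS mu om) om ‖x τ - x t‖ : ℝ)
      (bLog3 (kP lam mu om) (kS mu om) om ‖x τ - x t‖ : ℝ)
      (bLog4 (kP lam mu om) (kS mu om) om ‖x τ - x t‖ : ℝ) := by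
  ext i j
  simp [logPartK, combK, toC]

theorem logPartW_eq (lam mu om : ℝ) (x : ℝ → Plane) (τ t : ℝ) :
    logPartW lam mu om x τ t = combW lam mu (normalField x τ) (normalField x t) (x τ - x t)
      (cLog1 (kP lam mu om) (kS mu om) om ‖x τ - x t‖ / ‖x τ - x t‖ ^ 2 : ℝ)
      (bLog2 (kP lam mu om) (kS mu om) om ‖x τ - x t‖ : ℝ)
      (cLog3 (kP lam mu om) (kS mu om) om ‖x τ - x t‖ / ‖x τ - x t‖ ^ 2 : ℝ)
      (bLog3 (kP lam mu om) (kS mu om) om ‖x τ - x t‖ : ℝ)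
      (cLog5 (kP lam mu om) (kS mu om) om ‖x τ - x t‖ / ‖x τ - x t‖ ^ 2 : ℝ)
      (bLog4 (kP lam mu om) (kS mu om) om ‖x τ - x t‖ : ℝ) := by
  ext i j
  simp [logPartW, combW, toC]

section
variable {lam mu om : ℝ} {x : ℝ → Plane} {τ t : ℝ}

theorem kP_sq (hlm : 0 < lam + 2 * mu) : kP lam mu om ^ 2 * (lam + 2 * mu) = om ^ 2 := by
  rw [kP, div_pow, Real.sq_sqrt hlm.le]
  field_simp

theorem kS_sq (hmu : 0 < mu) : kS mu om ^ 2 * mu = om ^ 2 := by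
  rw [kS, div_pow, Real.sq_sqrt hmu.le]
  field_simp

theorem kP_pos (hlm : 0 < lam + 2 * mu) (hom : 0 < om) : 0 < kP lam mu om :=
  div_pos hom (Real.sqrt_pos.2 hlm)

theorem kS_pos (hmu : 0 < mu) (hom : 0 < om) : 0 < kS mu om :=
  div_pos hom (Real.sqrt_pos.2 hmu)

/-- This identity and the next turn the poles of the dynamic scalars into the Lamé constants of the
static kernels; ω cancels. -/
theorem kS_sq_add_kP_sq (hmu : 0 < mu) (hlm : 0 < lam + 2 * mu) :
    kS mu om ^ 2 + kP lam mu om ^ 2 = om ^ 2 * ((lam + 3 * mu) / (mu * (lam + 2 * mu))) := by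
  have h1 : kS mu om ^ 2 = om ^ 2 / mu := (eq_div_iff hmu.ne').2 (kS_sq hmu)
  have h2 : kP lam mu om ^ 2 = om ^ 2 / (lam + 2 * mu) := (eq_div_iff hlm.ne').2 (kP_sq hlm)
  rw [h1, h2]
  rw [div_add_div _ _ hmu.ne' hlm.ne', mul_div_assoc']
  ring_nf

theorem kS_sq_sub_kP_sq (hmu : 0 < mu) (hlm : 0 < lam + 2 * mu) :
    kS mu om ^ 2 - kP lam mu om ^ 2 = om ^ 2 * ((lam + mu) / (mu * (lam + 2 * mu))) := by
  have h1 : kS mu om ^ 2 = om ^ 2 / mu := (eq_div_iff hmu.ne').2 (kS_sq hmu)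
  have h2 : kP lam mu om ^ 2 = om ^ 2 / (lam + 2 * mu) := (eq_div_iff hlm.ne').2 (kP_sq hlm)
  rw [h1, h2]
  rw [div_sub_div _ _ hmu.ne' hlm.ne', mul_div_assoc']
  ring_nf

theorem kernelV_split (hmu : 0 < mu) (hlm : 0 < lam + 2 * mu) (hom : 0 < om)
    (hxy : x τ ≠ x t) :
    kernelV lam mu om x τ t = toC (kernelV0 lam mu x τ t)
      + ((Real.log ‖x τ - x t‖ : ℝ) : ℂ) • logPartV lam mu om x τ t
      + regPartV lam mu om x τ t := by
  have hp := kP_pos (om := om) hlm hom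
  have hs := kS_pos (om := om) hmu hom
  have hz : 0 < ‖x τ - x t‖ := norm_pos_iff.2 (sub_ne_zero.2 hxy)
  have hz' : (‖x τ - x t‖ : ℂ) ≠ 0 := by exact_mod_cast hz.ne'
  have hom' : (om : ℂ) ≠ 0 := by exact_mod_cast hom.ne'
  have h5 : (Real.pi : ℂ) ≠ 0 := by exact_mod_cast Real.pi_ne_zero
  have h6 : (mu : ℂ) ≠ 0 := by exact_mod_cast hmu.ne'
  have h7 : (lam : ℂ) + 2 * mu ≠ 0 := by exact_mod_cast hlm.ne'
  ext i j
  rw [kernelV, fundSol_apply hmu.ne' hom.ne' hp hs (kS_sq hmu) hxy,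
    radA_eq hp hs hom.ne' hz, radB_eq hp hs hom.ne' hz, kS_sq_add_kP_sq hmu hlm,
    kS_sq_sub_kP_sq hmu hlm]
  simp only [kernelV0, logPartV, regPartV, toC, matG, Matrix.add_apply, Matrix.smul_apply,
    Matrix.map_apply, Matrix.of_apply, Matrix.one_apply, smul_eq_mul]
  split_ifs <;>
  · push_cast
    field_simp
    ring

theorem kernelK_split (hmu : 0 < mu) (hlm : 0 < lam + 2 * mu) (hom : 0 < om)
    (hx : Differentiable ℝ x) (hxy : x τ ≠ x t) :
    kernelK lam mu om x τ t = toC (kernelK0 lam mu x τ t)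
      + ((Real.log ‖x τ - x t‖ : ℝ) : ℂ) • logPartK lam mu om x τ t
      + regPartK lam mu om x τ t := by
  have hp := kP_pos (om := om) hlm hom
  have hs := kS_pos (om := om) hmu hom
  have hz : 0 < ‖x τ - x t‖ := norm_pos_iff.2 (sub_ne_zero.2 hxy)
  have e2 : (kS mu om ^ 2 + kP lam mu om ^ 2) / (4 * Real.pi * om ^ 2 * ‖x τ - x t‖ ^ 2)
      = (lam + 3 * mu) / (4 * Real.pi * mu * (lam + 2 * mu) * ‖x τ - x t‖ ^ 2) := by
    rw [kS_sq_add_kP_sq hmu hlm]; field_simp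
  have e4 : (kS mu om ^ 2 - kP lam mu om ^ 2) / (4 * Real.pi * om ^ 2 * ‖x τ - x t‖ ^ 2)
      = (lam + mu) / (4 * Real.pi * mu * (lam + 2 * mu) * ‖x τ - x t‖ ^ 2) := by
    rw [kS_sq_sub_kP_sq hmu hlm]; field_simp
  have e := kernelK_eq_combK hmu.ne' hom.ne' hp hs (kS_sq hmu) (normalField x t) hxy
  rw [kernelK, e, radBeta2_eq hp hs hom.ne' hz, radBeta3_split hp hs hom.ne' hz,
    radB_eq hp hs hom.ne' hz, toC_kernelK0 hmu.ne' hlm.ne' hx hxy, logPartK_eq, regPartK, e2, e4]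
  simp only [combK, bLog4, bReg7]
  push_cast
  module

theorem kernelW_split (hmu : 0 < mu) (hlm : 0 < lam + 2 * mu) (hom : 0 < om)
    (hx : Differentiable ℝ x) (hxy : x τ ≠ x t) :
    kernelW lam mu om x τ t = toC (kernelW0 lam mu x τ t)
      + ((Real.log ‖x τ - x t‖ : ℝ) : ℂ) • logPartW lam mu om x τ t
      + regPartW lam mu om x τ t := by
  have hp := kP_pos (om := om) hlm hom
  have hs := kS_pos (om := om) hmu hom
  have hz : 0 < ‖x τ - x t‖ := norm_pos_iff.2 (sub_ne_zero.2 hxy)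
  -- Used for (c, n) = (4, 2), the scalars of K, and (2, 4), their doubled derivatives.
  have e2 : ∀ c : ℝ, ∀ n : ℕ, (kS mu om ^ 2 + kP lam mu om ^ 2)
        / (c * Real.pi * om ^ 2 * ‖x τ - x t‖ ^ n)
      = (lam + 3 * mu) / (c * Real.pi * mu * (lam + 2 * mu) * ‖x τ - x t‖ ^ n) := by
    intro c n
    rw [kS_sq_add_kP_sq hmu hlm]; field_simp
  have e4 : ∀ c : ℝ, ∀ n : ℕ, (kS mu om ^ 2 - kP lam mu om ^ 2)
        / (c * Real.pi * om ^ 2 * ‖x τ - x t‖ ^ n)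
      = (lam + mu) / (c * Real.pi * mu * (lam + 2 * mu) * ‖x τ - x t‖ ^ n) := by
    intro c n
    rw [kS_sq_sub_kP_sq hmu hlm]; field_simp
  rw [kernelW_eq_combW hmu.ne' hom.ne' hp hs (kS_sq hmu) x hxy, radBeta2_eq hp hs hom.ne' hz,
    radBeta3_split hp hs hom.ne' hz, radB_eq hp hs hom.ne' hz, radBeta2Deriv_eq hp hs hom.ne' hz,
    radBeta3Deriv_eq hp hs hom.ne' hz, radBDeriv_eq hp hs hom.ne' hz,
    toC_kernelW0 hmu.ne' hlm.ne' hx hxy, logPartW_eq, regPartW, e2, e4, e2, e4]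
  simp only [combW, bLog4, bReg7]
  push_cast
  module

end

/-! ## Smooth difference quotients of curves -/

/-- Integrals over a compact interval depend smoothly on parameters. -/
theorem contDiff_intervalIntegral_param {H : Type} [NormedAddCommGroup H] [NormedSpace ℝ H]
    [ProperSpace H] (n : ℕ) : ∀ {E : Type} [NormedAddCommGroup E] [NormedSpace ℝ E]
    {F : H × ℝ → E} (_ : ContDiff ℝ ∞ F),
    ContDiff ℝ n fun y => ∫ s in (0 : ℝ)..1, F (y, s) := by
  have key : ∀ {E : Type} [NormedAddCommGroup E] [NormedSpace ℝ E]
      {F : H × ℝ → E} (_ : ContDiff ℝ ∞ F) (y : H),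
      HasFDerivAt (fun y => ∫ s in (0 : ℝ)..1, F (y, s))
        (∫ s in (0 : ℝ)..1, (fderiv ℝ F (y, s)).comp (ContinuousLinearMap.inl ℝ H ℝ)) y := by
    intro E _ _ F hF y
    have hcont : Continuous fun p : H × ℝ =>
        (fderiv ℝ F p).comp (ContinuousLinearMap.inl ℝ H ℝ) :=
      (hF.continuous_fderiv (by simp)).clm_comp continuous_const
    -- A closed ball times [0,1] is compact, so a constant dominates the partial derivative.
    obtain ⟨C, hC⟩ := ((isCompact_closedBall y 1).prod
      (isCompact_Icc (a := (0 : ℝ)) (b := 1))).exists_bound_of_continuousOn hcont.continuousOn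
    refine intervalIntegral.hasFDerivAt_integral_of_dominated_of_fderiv_le
      (F' := fun y s => (fderiv ℝ F (y, s)).comp (ContinuousLinearMap.inl ℝ H ℝ))
      (bound := fun _ => C) (Metric.closedBall_mem_nhds y one_pos) ?_ ?_ ?_ ?_ ?_ ?_
    · refine Filter.Eventually.of_forall fun y => ?_
      exact (hF.continuous.comp (by fun_prop : Continuous fun s : ℝ => (y, s))).aestronglyMeasurable
    · exact (hF.continuous.comp
        (by fun_prop : Continuous fun s : ℝ => (y, s))).intervalIntegrable _ _
    · exact (hcont.comp (by fun_prop : Continuous fun s : ℝ => (y, s))).aestronglyMeasurable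
    · refine Filter.Eventually.of_forall fun s hs y' hy' => hC (y', s) ⟨hy', ?_⟩
      rw [Set.uIoc_of_le zero_le_one] at hs
      exact ⟨hs.1.le, hs.2⟩
    · exact intervalIntegrable_const
    · refine Filter.Eventually.of_forall fun s _ y' _ => ?_
      have h1 : HasFDerivAt F (fderiv ℝ F (y', s)) (y', s) :=
        (hF.differentiable (by simp) _).hasFDerivAt
      have h2 : HasFDerivAt (fun z : H => (z, s)) (ContinuousLinearMap.inl ℝ H ℝ) y' :=
        hasFDerivAt_prodMk_left y' s
      exact h1.comp y' h2
  -- The derivative is again a parameter integral, now with values in linear maps; hence the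
  -- quantification over the target space.
  induction n with
  | zero =>
    intro E _ _ F hF
    exact contDiff_zero.2 <| Differentiable.continuous (𝕜 := ℝ)
      fun y => (key hF y).differentiableAt
  | succ n ih =>
    intro E _ _ F hF
    have h := contDiff_succ_iff_hasFDerivAt (𝕜 := ℝ) (n := n)
      (f := fun y => ∫ s in (0 : ℝ)..1, F (y, s))
    push_cast
    refine h.2 ⟨_, ?_, key hF⟩
    exact ih (F := fun p => (fderiv ℝ F p).comp (ContinuousLinearMap.inl ℝ H ℝ))
      ((hF.fderiv_right (by simp)).clm_comp contDiff_const)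

/-- Hadamard's lemma: the difference quotient of a smooth curve is smooth. -/
theorem exists_contDiff_diffQuotient {E : Type} [NormedAddCommGroup E] [NormedSpace ℝ E]
    [CompleteSpace E] {f : ℝ → E} (hf : ContDiff ℝ ∞ f) :
    ∃ D : ℝ × ℝ → E, ContDiff ℝ ∞ D ∧
      (∀ τ t, f τ - f t = (τ - t) • D (τ, t)) ∧ ∀ t, D (t, t) = deriv f t := by
  have hdf : ContDiff ℝ ∞ (deriv f) := (contDiff_infty_iff_deriv.1 hf).2
  refine ⟨fun q => ∫ s in (0 : ℝ)..1, deriv f (q.2 + s * (q.1 - q.2)), ?_, fun τ t => ?_,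
    fun t => by simp⟩
  · refine contDiff_infty.2 fun n => contDiff_intervalIntegral_param n
      (F := fun p : (ℝ × ℝ) × ℝ => deriv f (p.1.2 + p.2 * (p.1.1 - p.1.2))) ?_
    exact hdf.comp (by fun_prop)
  · rw [← intervalIntegral.integral_smul]
    have hd : ∀ s ∈ Set.uIcc (0 : ℝ) 1, HasDerivAt (fun s : ℝ => f (t + s * (τ - t)))
        ((τ - t) • deriv f (t + s * (τ - t))) s := by
      intro s _
      have h1 : HasDerivAt f (deriv f (t + s * (τ - t))) (t + s * (τ - t)) :=
        (hf.differentiable (by simp) _).hasDerivAt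
      have h2 : HasDerivAt (fun s : ℝ => t + s * (τ - t)) (τ - t) s := by
        simpa using ((hasDerivAt_id s).mul_const (τ - t)).const_add t
      exact h1.scomp s h2
    have hc : Continuous fun s : ℝ => (τ - t) • deriv f (t + s * (τ - t)) :=
      (hdf.continuous.comp (by fun_prop)).const_smul _
    have := intervalIntegral.integral_eq_sub_of_hasDerivAt hd (hc.intervalIntegrable _ _)
    rw [this]
    simp

set_option maxHeartbeats 1000000 in
/-- A chord of a closed curve, divided by `sin ((τ - t) / 2)`, extends smoothly to all `(τ, t)`;
the extension is antiperiodic, and vanishes nowhere if the curve is regular and simple. -/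
theorem exists_smooth_chord {E : Type} [NormedAddCommGroup E] [NormedSpace ℝ E]
    [CompleteSpace E] {x : ℝ → E} (hx : ContDiff ℝ ∞ x)
    (hper : Function.Periodic x (2 * Real.pi)) (hreg : ∀ t, deriv x t ≠ 0)
    (hsimple : ∀ τ t, x τ = x t → ∃ n : ℤ, τ - t = n * (2 * Real.pi)) :
    ∃ q : ℝ → ℝ → E, (ContDiff ℝ ∞ fun p : ℝ × ℝ => q p.1 p.2) ∧
      (∀ τ t, x τ - x t = Real.sin ((τ - t) / 2) • q τ t) ∧
      (∀ τ t, q (τ + 2 * Real.pi) t = -q τ t) ∧ (∀ τ t, q τ (t + 2 * Real.pi) = -q τ t) ∧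
      ∀ τ t, q τ t ≠ 0 := by
  obtain ⟨D, hD, hDx, hDd⟩ := exists_contDiff_diffQuotient hx
  obtain ⟨h, hh, hhs, hhd⟩ := exists_contDiff_diffQuotient
    (f := fun u : ℝ => Real.sin (u / 2)) (by fun_prop)
  have hsin : ∀ u, Real.sin (u / 2) = u * h (u, 0) := fun u => by simpa using hhs u 0
  have hh0 : h (0, 0) = 1 / 2 := by
    rw [hhd]
    have : HasDerivAt (fun u : ℝ => Real.sin (u / 2)) (Real.cos (0 / 2) * (1 / 2)) 0 :=
      ((hasDerivAt_id (0 : ℝ)).div_const 2).sin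
    rw [this.deriv]; simp
  have hpi := Real.pi_pos
  -- Here h(u,0) extends sin(u/2)/u, and for |u| < 2π the sine vanishes only at u = 0, where h =
  -- 1/2.
  have hhne : ∀ u, |u| < 2 * Real.pi → h (u, 0) ≠ 0 := by
    intro u hu h0
    have h1 : Real.sin (u / 2) = 0 := by rw [hsin, h0, mul_zero]
    rw [abs_lt] at hu
    have h2 := (Real.sin_eq_zero_iff_of_lt_of_lt (by linarith) (by linarith)).1 h1
    have h3 : u = 0 := by linarith
    rw [h3, hh0] at h0
    norm_num at h0
  have hzero : ∀ τ t, Real.sin ((τ - t) / 2) = 0 → ∃ n : ℤ, τ = t + n * (2 * Real.pi) := by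
    intro τ t h0
    obtain ⟨n, hn⟩ := Real.sin_eq_zero_iff.1 h0
    exact ⟨n, by linarith⟩
  have hxper : ∀ (n : ℤ) t, x (t + n * (2 * Real.pi)) = x t := fun n t => hper.int_mul n t
  have hxd : ∀ t, deriv x (t + 2 * Real.pi) = deriv x t := by
    intro t
    rw [← deriv_comp_add_const]
    congr 1
    exact funext hper
  have hsin1 : ∀ u, Real.sin ((u + 2 * Real.pi) / 2) = - Real.sin (u / 2) := fun u => by
    rw [show (u + 2 * Real.pi) / 2 = u / 2 + Real.pi by ring, Real.sin_add_pi]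
  have hsin2 : ∀ u, Real.sin ((u - 2 * Real.pi) / 2) = - Real.sin (u / 2) := fun u => by
    rw [show (u - 2 * Real.pi) / 2 = u / 2 - Real.pi by ring, Real.sin_sub_pi]
  have hcos1 : ∀ u, Real.cos ((u + 2 * Real.pi) / 2) = - Real.cos (u / 2) := fun u => by
    rw [show (u + 2 * Real.pi) / 2 = u / 2 + Real.pi by ring, Real.cos_add_pi]
  have hcos2 : ∀ u, Real.cos ((u - 2 * Real.pi) / 2) = - Real.cos (u / 2) := fun u => by
    rw [show (u - 2 * Real.pi) / 2 = u / 2 - Real.pi by ring, Real.cos_sub_pi]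
  -- At τ - t = 2πn l'Hôpital's rule gives x'(t) / (½ cos((τ-t)/2)), and this cosine is ±1, its own
  -- inverse.
  let q : ℝ → ℝ → E := fun τ t => if Real.sin ((τ - t) / 2) = 0 then
    (2 * Real.cos ((τ - t) / 2)) • deriv x t else (Real.sin ((τ - t) / 2))⁻¹ • (x τ - x t)
  have hq1 : ∀ τ t, q (τ + 2 * Real.pi) t = -q τ t := by
    intro τ t
    simp only [q, add_sub_right_comm, hsin1, hcos1, neg_eq_zero, hper τ]
    split_ifs <;> simp
  have hq2 : ∀ τ t, q τ (t + 2 * Real.pi) = -q τ t := by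
    intro τ t
    simp only [q, ← sub_sub, hsin2, hcos2, neg_eq_zero, hper t, hxd]
    split_ifs <;> simp
  have hqD : ∀ τ t, |τ - t| < 2 * Real.pi → q τ t = (h (τ - t, 0))⁻¹ • D (τ, t) := by
    intro τ t htt
    by_cases h0 : Real.sin ((τ - t) / 2) = 0
    · have hu : τ - t = 0 := by
        rw [hsin] at h0
        exact (mul_eq_zero.1 h0).resolve_right (hhne _ htt)
      have : τ = t := by linarith
      subst this
      simp [q, hh0, hDd]
    · have hu : τ - t ≠ 0 := fun hu => h0 (by rw [hu]; simp)
      simp only [q, if_neg h0]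
      rw [hDx, hsin, smul_smul]
      congr 1
      field_simp
  -- Every component τ - t = 2πn of the zero set is moved to the main diagonal. The factor is the
  -- sign (-1)^n, of which only the existence matters.
  have hqn : ∀ n : ℤ, ∃ ε : ℝ, ∀ τ' t', q τ' t' = ε • q (τ' - n * (2 * Real.pi)) t' := by
    intro n
    induction n with
    | zero => exact ⟨1, fun τ' t' => by simp⟩
    | succ n ih =>
      obtain ⟨ε, hε⟩ := ih
      refine ⟨-ε, fun τ' t' => ?_⟩
      rw [hε, show τ' - ((n : ℤ) : ℝ) * (2 * Real.pi)
        = τ' - (((n : ℤ) + 1 : ℤ) : ℝ) * (2 * Real.pi) + 2 * Real.pi by push_cast; ring, hq1]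
      simp
    | pred n ih =>
      obtain ⟨ε, hε⟩ := ih
      refine ⟨-ε, fun τ' t' => ?_⟩
      rw [hε, show τ' - ((-(n : ℤ) - 1 : ℤ) : ℝ) * (2 * Real.pi)
        = τ' - ((-(n : ℤ) : ℤ) : ℝ) * (2 * Real.pi) + 2 * Real.pi by push_cast; ring, hq1]
      simp
  refine ⟨q, contDiff_iff_contDiffAt.2 ?_, ?_, hq1, hq2, ?_⟩
  · rintro ⟨τ, t⟩
    by_cases h0 : Real.sin ((τ - t) / 2) = 0
    · obtain ⟨n, hn⟩ := hzero τ t h0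
      obtain ⟨ε, hε⟩ := hqn n
      have hloc : (fun p : ℝ × ℝ => q p.1 p.2) =ᶠ[nhds (τ, t)] fun p => ε •
          (h (p.1 - n * (2 * Real.pi) - p.2, 0))⁻¹ • D (p.1 - n * (2 * Real.pi), p.2) := by
        have hopen : IsOpen {p : ℝ × ℝ | |p.1 - n * (2 * Real.pi) - p.2| < 2 * Real.pi} :=
          isOpen_lt (by fun_prop) (by fun_prop)
        filter_upwards [hopen.mem_nhds (by simp [hn]; positivity)] with p hp
        rw [hε, hqD _ _ hp]
      refine ContDiffAt.congr_of_eventuallyEq ?_ hloc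
      have e1 : ContDiffAt ℝ ∞ (fun p : ℝ × ℝ => h (p.1 - n * (2 * Real.pi) - p.2, 0)) (τ, t) :=
        (hh.comp (by fun_prop)).contDiffAt
      have e2 : ContDiffAt ℝ ∞ (fun p : ℝ × ℝ => D (p.1 - n * (2 * Real.pi), p.2)) (τ, t) :=
        (hD.comp (by fun_prop)).contDiffAt
      have hne : h (τ - n * (2 * Real.pi) - t, 0) ≠ 0 := hhne _ (by simp [hn]; positivity)
      have e3 := e1.inv hne
      exact (e3.smul e2).const_smul ε
    · have hcs : Continuous fun p : ℝ × ℝ => Real.sin ((p.1 - p.2) / 2) := by fun_prop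
      have hloc : (fun p : ℝ × ℝ => q p.1 p.2) =ᶠ[nhds (τ, t)] fun p =>
          (Real.sin ((p.1 - p.2) / 2))⁻¹ • (x p.1 - x p.2) := by
        filter_upwards [hcs.continuousAt.eventually_ne h0] with p hp
        simp only [q, if_neg hp]
      refine ContDiffAt.congr_of_eventuallyEq ?_ hloc
      have e1 : ContDiff ℝ ∞ fun p : ℝ × ℝ => Real.sin ((p.1 - p.2) / 2) := by fun_prop
      have e2 : ContDiff ℝ ∞ fun p : ℝ × ℝ => x p.1 - x p.2 :=
        (hx.comp contDiff_fst).sub (hx.comp contDiff_snd)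
      have e3 := e1.contDiffAt.inv (x := (τ, t)) h0
      exact e3.smul e2.contDiffAt
  · intro τ t
    by_cases h0 : Real.sin ((τ - t) / 2) = 0
    · obtain ⟨n, rfl⟩ := hzero τ t h0
      rw [h0, hxper]; simp
    · simp only [q, if_neg h0]
      rw [smul_smul, mul_inv_cancel₀ h0, one_smul]
  · intro τ t hq0
    by_cases h0 : Real.sin ((τ - t) / 2) = 0
    · have hc : Real.cos ((τ - t) / 2) ≠ 0 := by
        intro hc
        have := Real.sin_sq_add_cos_sq ((τ - t) / 2)
        rw [h0, hc] at this
        norm_num at this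
      simp only [q, if_pos h0, smul_eq_zero, mul_eq_zero] at hq0
      rcases hq0 with (h2 | h2) | h2
      · norm_num at h2
      · exact hc h2
      · exact hreg t h2
    · simp only [q, if_neg h0, smul_eq_zero, inv_eq_zero, h0, false_or, sub_eq_zero] at hq0
      obtain ⟨n, hn⟩ := hsimple τ t hq0
      refine h0 (Real.sin_eq_zero_iff.2 ⟨n, ?_⟩)
      rw [hn]; ring

/-! ## The coefficients are smooth functions of `z²` -/

/-- `c` is a smooth function of `z²` for `z > 0`. -/
def SmoothInSq {E : Type} [NormedAddCommGroup E] [NormedSpace ℝ E] (c : ℝ → E) : Prop :=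
  ∃ C : ℝ → E, ContDiff ℝ ∞ C ∧ ∀ z, 0 < z → c z = C (z ^ 2)

attribute [fun_prop] contDiff_besselEntire contDiff_besselQuot contDiff_hankelEntire

section
variable {p s om : ℝ}

/-- Since j_0(0) = 1 and j_1(0) = 1/2, the constant (s²+p²)/2 cancels the value at zero, and
dividing by z² leaves difference quotients. -/
theorem smoothInSq_aLog2 (hp : 0 < p) (hs : 0 < s) : SmoothInSq (aLog2 p s om) := by
  refine ⟨fun ρ => 1 / (2 * Real.pi * om ^ 2) * (-p ^ 2 * besselQuot 1 p ρ
    - s ^ 2 * besselQuot 0 s ρ + s ^ 2 * besselQuot 1 s ρ), by fun_prop, fun z hz => ?_⟩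
  rw [aLog2]
  simp only [jq_eq _ hp.ne' hz.ne', jq_eq _ hs.ne' hz.ne', besselEntire_eq]
  simp
  field_simp
  ring

theorem smoothInSq_aLog3 (hp : 0 < p) (hs : 0 < s) : SmoothInSq (aLog3 p s om) :=
  ⟨fun ρ => 1 / (2 * Real.pi * om ^ 2) *
      (p ^ 4 * besselEntire 2 p ρ - s ^ 4 * besselEntire 2 s ρ), by fun_prop, fun _ hz => aLog3_eq hp hs hz⟩

theorem smoothInSq_aReg4 (hp : 0 < p) (hs : 0 < s) : SmoothInSq (aReg4 p s om) := by
  refine ⟨fun ρ => 1 / (om : ℂ) ^ 2 * (p ^ 2 * hankelEntire 1 p ρ + s ^ 2 * hankelEntire 0 s ρ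
    - s ^ 2 * hankelEntire 1 s ρ), by fun_prop, fun z hz => ?_⟩
  rw [aReg4, hphiReg_eq (by norm_num : 1 < 4) hp hz, hphiReg_eq (by norm_num : 1 < 4) hs hz,
    hphiReg_eq (by norm_num : 0 < 4) hs hz]
  ring

theorem smoothInSq_aReg5 (hp : 0 < p) (hs : 0 < s) : SmoothInSq (aReg5 p s om) :=
  ⟨fun ρ => 1 / (om : ℂ) ^ 2 *
      (s ^ 4 * hankelEntire 2 s ρ - p ^ 4 * hankelEntire 2 p ρ), by fun_prop, fun _ hz => aReg5_eq hp hs hz⟩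

theorem smoothInSq_bLog2 (hp : 0 < p) (hs : 0 < s) : SmoothInSq (bLog2 p s om) := by
  refine ⟨fun ρ => 1 / (2 * Real.pi * om ^ 2) * (-p ^ 4 * besselEntire 2 p ρ
    - s ^ 4 * besselEntire 1 s ρ + s ^ 4 * besselEntire 2 s ρ), by fun_prop, fun z hz => ?_⟩
  simp only [bLog2, jq_eq _ hp.ne' hz.ne', jq_eq _ hs.ne' hz.ne']

theorem smoothInSq_bLog3 (hp : 0 < p) (hs : 0 < s) : SmoothInSq (bLog3 p s om) := by
  refine ⟨fun ρ => 1 / (2 * Real.pi * om ^ 2) * (-p ^ 4 * besselEntire 1 p ρ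
    + 2 * p ^ 4 * besselEntire 2 p ρ + s ^ 4 * besselEntire 1 s ρ
    - 2 * s ^ 4 * besselEntire 2 s ρ), by fun_prop, fun z hz => ?_⟩
  simp only [bLog3, jq_eq _ hp.ne' hz.ne', jq_eq _ hs.ne' hz.ne']

theorem smoothInSq_bReg5 (hp : 0 < p) (hs : 0 < s) : SmoothInSq (bReg5 p s om) := by
  refine ⟨fun ρ => -(1 / (om : ℂ) ^ 2) * (-s ^ 4 * hankelEntire 1 s ρ
    + s ^ 4 * hankelEntire 2 s ρ - p ^ 4 * hankelEntire 2 p ρ), by fun_prop, fun z hz => ?_⟩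
  rw [bReg5, hphiReg_eq (by norm_num : 1 < 4) hs hz, hphiReg_eq (by norm_num : 2 < 4) hs hz,
    hphiReg_eq (by norm_num : 2 < 4) hp hz]
  ring

theorem smoothInSq_bReg6 (hp : 0 < p) (hs : 0 < s) : SmoothInSq (bReg6 p s om) := by
  refine ⟨fun ρ => -(1 / (om : ℂ) ^ 2) * (s ^ 4 * hankelEntire 1 s ρ
    - 2 * s ^ 4 * hankelEntire 2 s ρ - p ^ 4 * hankelEntire 1 p ρ
    + 2 * p ^ 4 * hankelEntire 2 p ρ), by fun_prop, fun z hz => ?_⟩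
  rw [bReg6, hphiReg_eq (by norm_num : 1 < 4) hs hz, hphiReg_eq (by norm_num : 2 < 4) hs hz,
    hphiReg_eq (by norm_num : 1 < 4) hp hz, hphiReg_eq (by norm_num : 2 < 4) hp hz]
  ring

theorem smoothInSq_cLog1 (hp : 0 < p) (hs : 0 < s) : SmoothInSq (cLog1 p s om) := by
  refine ⟨fun ρ => ρ / (2 * Real.pi * om ^ 2) * (p ^ 6 * besselEntire 3 p ρ
    + s ^ 6 * besselEntire 2 s ρ - s ^ 6 * besselEntire 3 s ρ), by fun_prop, fun z hz => ?_⟩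
  simp only [cLog1, jq_eq _ hp.ne' hz.ne', jq_eq _ hs.ne' hz.ne']

theorem smoothInSq_cLog3 (hp : 0 < p) (hs : 0 < s) : SmoothInSq (cLog3 p s om) := by
  refine ⟨fun ρ => ρ / (2 * Real.pi * om ^ 2) * (p ^ 6 * besselEntire 2 p ρ
    - 2 * p ^ 6 * besselEntire 3 p ρ - s ^ 6 * besselEntire 2 s ρ
    + 2 * s ^ 6 * besselEntire 3 s ρ), by fun_prop, fun z hz => ?_⟩
  simp only [cLog3, jq_eq _ hp.ne' hz.ne', jq_eq _ hs.ne' hz.ne']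

theorem smoothInSq_cLog5 (hp : 0 < p) (hs : 0 < s) : SmoothInSq (cLog5 p s om) :=
  ⟨fun ρ => 1 / (2 * Real.pi * om ^ 2) *
      (4 * p ^ 4 * besselEntire 2 p ρ - p ^ 4 * besselEntire 1 p ρ
        - 4 * s ^ 4 * besselEntire 2 s ρ + s ^ 4 * besselEntire 1 s ρ), by fun_prop, fun _ hz => cLog5_eq hp hs hz⟩

theorem contDiff_ofReal {E : Type} [NormedAddCommGroup E] [NormedSpace ℝ E] {f : E → ℝ}
    (hf : ContDiff ℝ ∞ f) : ContDiff ℝ ∞ fun y => (f y : ℂ) :=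
  Complex.ofRealCLM.contDiff.comp hf

theorem smoothInSq_cReg7 (hp : 0 < p) (hs : 0 < s) : SmoothInSq (cReg7 p s om) := by
  have hid : ContDiff ℝ ∞ fun ρ : ℝ => (ρ : ℂ) := contDiff_ofReal contDiff_id
  refine ⟨fun ρ => -(1 / (16 * (Real.pi : ℂ) * (om : ℂ) ^ 2) * (3 * s ^ 4 + p ^ 4)
    + (ρ : ℂ) * (1 / (om : ℂ) ^ 2) * (p ^ 6 * hankelEntire 3 p ρ + s ^ 6 * hankelEntire 2 s ρ
      - s ^ 6 * hankelEntire 3 s ρ)), by fun_prop, fun z hz => ?_⟩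
  rw [cReg7, hphiReg_eq (by norm_num : 3 < 4) hs hz, hphiReg_eq (by norm_num : 2 < 4) hs hz,
    hphiReg_eq (by norm_num : 3 < 4) hp hz]
  push_cast
  ring

theorem smoothInSq_cReg9 (hp : 0 < p) (hs : 0 < s) : SmoothInSq (cReg9 p s om) := by
  have hid : ContDiff ℝ ∞ fun ρ : ℝ => (ρ : ℂ) := contDiff_ofReal contDiff_id
  refine ⟨fun ρ => (ρ : ℂ) * (1 / (om : ℂ) ^ 2) * (2 * p ^ 6 * hankelEntire 3 p ρ
      - p ^ 6 * hankelEntire 2 p ρ - 2 * s ^ 6 * hankelEntire 3 s ρ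
      + s ^ 6 * hankelEntire 2 s ρ) - (p ^ 4 - s ^ 4) / (8 * (Real.pi : ℂ) * (om : ℂ) ^ 2),
    by fun_prop, fun z hz => ?_⟩
  rw [cReg9, hphiReg_eq (by norm_num : 3 < 4) hs hz, hphiReg_eq (by norm_num : 2 < 4) hs hz,
    hphiReg_eq (by norm_num : 3 < 4) hp hz, hphiReg_eq (by norm_num : 2 < 4) hp hz]
  push_cast
  ring

theorem smoothInSq_cReg11 (hp : 0 < p) (hs : 0 < s) (hom : om ≠ 0) :
    SmoothInSq (cReg11 p s om) :=
  ⟨fun ρ => -(1 / (om : ℂ) ^ 2) *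
      (4 * p ^ 4 * hankelEntire 2 p ρ - p ^ 4 * hankelEntire 1 p ρ
        - 4 * s ^ 4 * hankelEntire 2 s ρ + s ^ 4 * hankelEntire 1 s ρ), by fun_prop, fun _ hz => cReg11_eq hp hs hom hz⟩

end

theorem SmoothInSq.ofReal {c : ℝ → ℝ} (h : SmoothInSq c) : SmoothInSq fun z => (c z : ℂ) := by
  obtain ⟨C, hC, h⟩ := h
  exact ⟨fun ρ => (C ρ : ℂ), contDiff_ofReal hC, fun z hz => congrArg _ (h z hz)⟩

/-! ## Smooth matrix fields -/

/-- Matrix fields with smooth entries. -/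
def SmoothEntries {E R : Type} [NormedAddCommGroup E] [NormedSpace ℝ E] [NormedRing R]
    [NormedAlgebra ℝ R] (M : E → Matrix (Fin 2) (Fin 2) R) : Prop :=
  ∀ i j, ContDiff ℝ ∞ fun y => M y i j

section
variable {E R : Type} [NormedAddCommGroup E] [NormedSpace ℝ E] [NormedRing R]
    [NormedAlgebra ℝ R] {M N : E → Matrix (Fin 2) (Fin 2) R} {u v : E → Fin 2 → ℝ} {q : E → Plane}

theorem smoothEntries_const (A : Matrix (Fin 2) (Fin 2) R) :
    SmoothEntries fun _ : E => A := fun _ _ => contDiff_const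

theorem SmoothEntries.add (hM : SmoothEntries M) (hN : SmoothEntries N) :
    SmoothEntries fun y => M y + N y := fun i j => (hM i j).add (hN i j)

theorem SmoothEntries.sub (hM : SmoothEntries M) (hN : SmoothEntries N) :
    SmoothEntries fun y => M y - N y := fun i j => (hM i j).sub (hN i j)

theorem SmoothEntries.smul (hM : SmoothEntries M) {f : E → R} (hf : ContDiff ℝ ∞ f) :
    SmoothEntries fun y => f y • M y := fun i j => hf.mul (hM i j)

theorem SmoothEntries.mul (hM : SmoothEntries M) (hN : SmoothEntries N) :
    SmoothEntries fun y => M y * N y := fun i j => by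
  simp only [Matrix.mul_apply, Fin.sum_univ_two]
  exact ((hM i 0).mul (hN 0 j)).add ((hM i 1).mul (hN 1 j))

theorem SmoothEntries.transpose (hM : SmoothEntries M) :
    SmoothEntries fun y => (M y).transpose := fun i j => hM j i

theorem SmoothEntries.toC {M : E → RMat} (hM : SmoothEntries M) :
    SmoothEntries fun y => toC (M y) := fun i j => contDiff_ofReal (hM i j)

theorem smoothEntries_vecMulVec (hu : ∀ i, ContDiff ℝ ∞ fun y => u y i)
    (hv : ∀ i, ContDiff ℝ ∞ fun y => v y i) :
    SmoothEntries fun y => Matrix.vecMulVec (u y) (v y) := fun i j => by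
  simp only [Matrix.vecMulVec_apply]
  exact (hu i).mul (hv j)

theorem contDiff_dotProduct (hu : ∀ i, ContDiff ℝ ∞ fun y => u y i)
    (hv : ∀ i, ContDiff ℝ ∞ fun y => v y i) : ContDiff ℝ ∞ fun y => u y ⬝ᵥ v y := by
  simp only [dotProduct, Fin.sum_univ_two]
  exact ((hu 0).mul (hv 0)).add ((hu 1).mul (hv 1))

theorem contDiff_coord (hq : ContDiff ℝ ∞ q) (i : Fin 2) : ContDiff ℝ ∞ fun y => q y i :=
  (EuclideanSpace.proj i : Plane →L[ℝ] ℝ).contDiff.comp hq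

theorem contDiff_inv_norm_sq (hq : ContDiff ℝ ∞ q) (hq0 : ∀ y, q y ≠ 0) :
    ContDiff ℝ ∞ fun y => 1 / ‖q y‖ ^ 2 :=
  contDiff_const.div (hq.norm_sq ℝ) fun y => pow_ne_zero 2 (norm_ne_zero_iff.2 (hq0 y))

/-- G itself is singular at the origin, so smoothness is claimed along a nonvanishing field, in
practice the chord factor q. -/
theorem smoothEntries_matG (hq : ContDiff ℝ ∞ q) (hq0 : ∀ y, q y ≠ 0) :
    SmoothEntries fun y => matG (q y) := by
  refine SmoothEntries.smul (fun i j => ?_) (contDiff_inv_norm_sq hq hq0)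
  exact (contDiff_coord hq i).mul (contDiff_coord hq j)

variable (lam mu : ℝ)

theorem smoothEntries_matU1 (hu : ∀ i, ContDiff ℝ ∞ fun y => u y i) (hq : ContDiff ℝ ∞ q) :
    SmoothEntries fun y => matU1 lam mu (u y) (q y) := by
  have hc := contDiff_coord hq
  exact (((smoothEntries_vecMulVec hu hc).smul contDiff_const).add
    ((smoothEntries_vecMulVec hc hu).smul contDiff_const)).add
    ((smoothEntries_const 1).smul (contDiff_const.mul (contDiff_dotProduct hu hc)))

theorem smoothEntries_matU2 (hu : ∀ i, ContDiff ℝ ∞ fun y => u y i) (hq : ContDiff ℝ ∞ q)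
    (hq0 : ∀ y, q y ≠ 0) : SmoothEntries fun y => matU2 lam mu (u y) (q y) := by
  have hc := contDiff_coord hq
  exact (((smoothEntries_vecMulVec hu hc).smul contDiff_const).add
    ((smoothEntries_vecMulVec hc hu).smul contDiff_const)).add
    (((smoothEntries_const 1).sub ((smoothEntries_matG hq hq0).smul contDiff_const)).smul
      (contDiff_const.mul (contDiff_dotProduct hu hc)))

theorem smoothEntries_matS (hu : ∀ i, ContDiff ℝ ∞ fun y => u y i)
    (hv : ∀ i, ContDiff ℝ ∞ fun y => v y i) : SmoothEntries fun y => matS lam mu (u y) (v y) :=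
  (((smoothEntries_vecMulVec hv hu).smul contDiff_const).add
    ((smoothEntries_vecMulVec hu hv).smul contDiff_const)).add
    ((smoothEntries_const 1).smul (contDiff_const.mul (contDiff_dotProduct hu hv)))

theorem smoothEntries_matR1 (hu : ∀ i, ContDiff ℝ ∞ fun y => u y i)
    (hv : ∀ i, ContDiff ℝ ∞ fun y => v y i) : SmoothEntries fun y => matR1 lam mu (u y) (v y) :=
  ((smoothEntries_vecMulVec hu hv).smul contDiff_const).add
    (((smoothEntries_vecMulVec hv hu).add
      ((smoothEntries_const 1).smul (contDiff_dotProduct hu hv))).smul contDiff_const)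

theorem smoothEntries_matR2 (hu : ∀ i, ContDiff ℝ ∞ fun y => u y i)
    (hv : ∀ i, ContDiff ℝ ∞ fun y => v y i) (hq : ContDiff ℝ ∞ q) (hq0 : ∀ y, q y ≠ 0) :
    SmoothEntries fun y => matR2 lam mu (u y) (v y) (q y) := by
  have hG := smoothEntries_matG hq hq0
  have hquot := (contDiff_const (c := 4 * mu)).mul (contDiff_dotProduct hv (contDiff_coord hq))
  exact (((smoothEntries_vecMulVec hu hv).smul contDiff_const).add
    (((smoothEntries_matS lam mu hu hv).mul ((smoothEntries_const 1).sub
      (hG.smul contDiff_const))).smul contDiff_const)).sub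
    ((smoothEntries_matU2 lam mu hu hq hq0).smul (hquot.div (hq.norm_sq ℝ)
      fun y => pow_ne_zero 2 (norm_ne_zero_iff.2 (hq0 y))))

theorem smoothEntries_matR3 (hu : ∀ i, ContDiff ℝ ∞ fun y => u y i)
    (hv : ∀ i, ContDiff ℝ ∞ fun y => v y i) (hq : ContDiff ℝ ∞ q) (hq0 : ∀ y, q y ≠ 0) :
    SmoothEntries fun y => matR3 lam mu (u y) (v y) (q y) := by
  have hG := smoothEntries_matG hq hq0
  have hquot := (contDiff_const (c := 2 * mu)).mul (contDiff_dotProduct hv (contDiff_coord hq))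
  exact (((smoothEntries_vecMulVec hu hv).smul contDiff_const).add
    (((smoothEntries_matS lam mu hu hv).mul hG).smul contDiff_const)).add
    ((smoothEntries_matU2 lam mu hu hq hq0).smul (hquot.div (hq.norm_sq ℝ)
      fun y => pow_ne_zero 2 (norm_ne_zero_iff.2 (hq0 y))))

variable {γ₁ β₂ γ₃ β₃ γ₅ β₄ : E → ℂ}

theorem smoothEntries_combK (hv : ∀ i, ContDiff ℝ ∞ fun y => v y i) (hq : ContDiff ℝ ∞ q)
    (hq0 : ∀ y, q y ≠ 0) (h₂ : ContDiff ℝ ∞ β₂) (h₃ : ContDiff ℝ ∞ β₃) (h₄ : ContDiff ℝ ∞ β₄) :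
    SmoothEntries fun y => combK lam mu (v y) (q y) (β₂ y) (β₃ y) (β₄ y) := by
  have h1 := (smoothEntries_matU1 lam mu hv hq).transpose
  exact ((h1.toC.smul h₂).add (((smoothEntries_matG hq hq0).mul h1).toC.smul h₃)).add
    ((smoothEntries_matU2 lam mu hv hq hq0).transpose.toC.smul h₄)

theorem smoothEntries_combW (hu : ∀ i, ContDiff ℝ ∞ fun y => u y i)
    (hv : ∀ i, ContDiff ℝ ∞ fun y => v y i) (hq : ContDiff ℝ ∞ q) (hq0 : ∀ y, q y ≠ 0)
    (g₁ : ContDiff ℝ ∞ γ₁) (h₂ : ContDiff ℝ ∞ β₂) (g₃ : ContDiff ℝ ∞ γ₃) (h₃ : ContDiff ℝ ∞ β₃)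
    (g₅ : ContDiff ℝ ∞ γ₅) (h₄ : ContDiff ℝ ∞ β₄) :
    SmoothEntries fun y => combW lam mu (u y) (v y) (q y) (γ₁ y) (β₂ y) (γ₃ y) (β₃ y) (γ₅ y)
      (β₄ y) := by
  have hn := smoothEntries_matU1 lam mu hu hq
  have h1 := (smoothEntries_matU1 lam mu hv hq).transpose
  have h2 := (smoothEntries_matU2 lam mu hv hq hq0).transpose
  have hG := smoothEntries_matG hq hq0
  exact ((((((hn.mul h1).toC.smul g₁).add ((smoothEntries_matR1 lam mu hu hv).toC.smul h₂)).add
    (((hn.mul hG).mul h1).toC.smul g₃)).add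
    ((smoothEntries_matR3 lam mu hu hv hq hq0).toC.smul h₃)).add
    ((hn.mul h2).toC.smul g₅)).add ((smoothEntries_matR2 lam mu hu hv hq hq0).toC.smul h₄)

end

/-! ## Homogeneity -/

section
variable (lam mu : ℝ) (n m : Fin 2 → ℝ) {c : ℝ} (q : Plane) (γ₁ β₂ γ₃ β₃ γ₅ β₄ : ℂ)

theorem matG_smul (hc : c ≠ 0) : matG (c • q) = matG q := by
  ext i j
  simp only [matG, norm_smul, Matrix.smul_apply, Matrix.of_apply, PiLp.smul_apply, smul_eq_mul,
    mul_pow, Real.norm_eq_abs, sq_abs]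
  field_simp

theorem matU1_smul : matU1 lam mu m (c • q) = c • matU1 lam mu m q := by
  ext i j
  simp [matU1, Matrix.vecMulVec_apply, dotProduct]
  ring

theorem matU2_smul (hc : c ≠ 0) : matU2 lam mu m (c • q) = c • matU2 lam mu m q := by
  rw [matU2, matG_smul q hc, matU2]
  ext i j
  simp [Matrix.vecMulVec_apply, dotProduct]
  ring

theorem matR2_smul (hc : c ≠ 0) : matR2 lam mu n m (c • q) = matR2 lam mu n m q := by
  rw [matR2, matG_smul q hc, matU2_smul lam mu n q hc, matR2, smul_smul]
  congr 2
  simp only [WithLp.ofLp_smul, dotProduct_smul, norm_smul, mul_pow, Real.norm_eq_abs, sq_abs,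
    smul_eq_mul]
  field_simp

theorem matR3_smul (hc : c ≠ 0) : matR3 lam mu n m (c • q) = matR3 lam mu n m q := by
  rw [matR3, matG_smul q hc, matU2_smul lam mu n q hc, matR3, smul_smul]
  congr 2
  simp only [WithLp.ofLp_smul, dotProduct_smul, norm_smul, mul_pow, Real.norm_eq_abs, sq_abs,
    smul_eq_mul]
  field_simp

theorem toC_smul (M : RMat) : toC (c • M) = (c : ℂ) • toC M := by
  ext i j; simp [toC]

theorem combK_smul (hc : c ≠ 0) :
    combK lam mu m (c • q) β₂ β₃ β₄ = (c : ℂ) • combK lam mu m q β₂ β₃ β₄ := by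
  simp only [combK, matG_smul q hc, matU1_smul, matU2_smul lam mu m q hc, Matrix.transpose_smul,
    Matrix.mul_smul, toC_smul]
  module

/-- The products of two U-matrices have degree 2 and their c² is moved into the scalars; the
R-matrices have degree 0. -/
theorem combW_smul (hc : c ≠ 0) : combW lam mu n m (c • q) γ₁ β₂ γ₃ β₃ γ₅ β₄
    = combW lam mu n m q ((c : ℂ) ^ 2 * γ₁) β₂ ((c : ℂ) ^ 2 * γ₃) β₃ ((c : ℂ) ^ 2 * γ₅) β₄ := by
  simp only [combW, matG_smul q hc, matU1_smul, matU2_smul lam mu m q hc, Matrix.transpose_smul,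
    Matrix.mul_smul, Matrix.smul_mul, toC_smul, matR2_smul lam mu n m q hc,
    matR3_smul lam mu n m q hc]
  module

theorem matG_neg : matG (-q) = matG q := by
  simpa using matG_smul q (c := -1) (by norm_num)

theorem combK_neg : combK lam mu m (-q) β₂ β₃ β₄ = -combK lam mu m q β₂ β₃ β₄ := by
  simpa using combK_smul lam mu m q β₂ β₃ β₄ (c := -1) (by norm_num)

theorem combW_neg : combW lam mu n m (-q) γ₁ β₂ γ₃ β₃ γ₅ β₄
    = combW lam mu n m q γ₁ β₂ γ₃ β₃ γ₅ β₄ := by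
  simpa using combW_smul lam mu n m q γ₁ β₂ γ₃ β₃ γ₅ β₄ (c := -1) (by norm_num)

end

/-! ## The cutoff around the diagonal -/

/-- A smooth cutoff, equal to `1` where `cos (τ - t) ≥ √2/2` and to `0` where
`cos (τ - t) ≤ 0`. -/
noncomputable def diagCutoff (τ t : ℝ) : ℝ :=
  Real.smoothTransition (Real.sqrt 2 * Real.cos (τ - t))

theorem contDiff_diagCutoff : ContDiff ℝ ∞ fun y : ℝ × ℝ => diagCutoff y.1 y.2 :=
  Real.smoothTransition.contDiff.comp (by fun_prop)

theorem diagCutoff_eq_one {τ t : ℝ} (h : Real.sqrt 2 / 2 ≤ Real.cos (τ - t)) :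
    diagCutoff τ t = 1 := by
  refine Real.smoothTransition.one_of_one_le ?_
  have h2 : Real.sqrt 2 * Real.sqrt 2 = 2 := Real.mul_self_sqrt (by norm_num)
  nlinarith [Real.sqrt_nonneg 2]

theorem diagCutoff_eq_zero {τ t : ℝ} (h : Real.cos (τ - t) ≤ 0) : diagCutoff τ t = 0 :=
  Real.smoothTransition.zero_of_nonpos
    (mul_nonpos_of_nonneg_of_nonpos (Real.sqrt_nonneg 2) h)

theorem cos_half_ne_zero {u : ℝ} (h : 0 ≤ Real.cos u) : Real.cos (u / 2) ≠ 0 := by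
  intro h0
  have := Real.cos_two_mul (u / 2)
  rw [mul_div_cancel₀ u two_ne_zero, h0] at this
  norm_num at this
  linarith

/-- The denominator vanishes only where cos(τ-t) = -1, and the cutoff is zero wherever cos(τ-t) ≤ 0.
-/
theorem contDiff_diagCutoff_div_cos : ContDiff ℝ ∞ fun y : ℝ × ℝ =>
    diagCutoff y.1 y.2 / (2 * Real.cos ((y.1 - y.2) / 2)) := by
  refine contDiff_iff_contDiffAt.2 fun y => ?_
  have hc : Continuous fun y : ℝ × ℝ => Real.cos (y.1 - y.2) := by fun_prop
  rcases lt_or_ge (Real.cos (y.1 - y.2)) 0 with h | h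
  · refine (contDiffAt_const (c := (0 : ℝ))).congr_of_eventuallyEq ?_
    filter_upwards [hc.continuousAt.eventually_lt continuousAt_const h] with w hw
    rw [diagCutoff_eq_zero hw.le, zero_div]
  · have hd : ContDiff ℝ ∞ fun y : ℝ × ℝ => 2 * Real.cos ((y.1 - y.2) / 2) := by fun_prop
    exact contDiff_diagCutoff.contDiffAt.div hd.contDiffAt
      (mul_ne_zero two_ne_zero (cos_half_ne_zero h))

/-- Near each zero of f the cutoff is identically 1, so the product vanishes there. -/
theorem contDiff_cutoff_mul_log {f : ℝ × ℝ → ℝ} (hf : ContDiff ℝ ∞ f)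
    (h0 : ∀ y : ℝ × ℝ, f y = 0 → Real.cos (y.1 - y.2) = 1) :
    ContDiff ℝ ∞ fun y : ℝ × ℝ => (1 - diagCutoff y.1 y.2) * (1 / 2 * Real.log (f y)) := by
  refine contDiff_iff_contDiffAt.2 fun y => ?_
  have hc : Continuous fun y : ℝ × ℝ => Real.cos (y.1 - y.2) := by fun_prop
  by_cases hy : f y = 0
  · refine (contDiffAt_const (c := (0 : ℝ))).congr_of_eventuallyEq ?_
    have h2 : Real.sqrt 2 / 2 < Real.cos (y.1 - y.2) := by
      rw [h0 y hy]
      have h2 : Real.sqrt 2 * Real.sqrt 2 = 2 := Real.mul_self_sqrt (by norm_num)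
      nlinarith [Real.sqrt_nonneg 2]
    filter_upwards [continuousAt_const.eventually_lt hc.continuousAt h2] with w hw
    rw [diagCutoff_eq_one hw.le, sub_self, zero_mul]
  · exact (contDiffAt_const.sub contDiff_diagCutoff.contDiffAt).mul
      (contDiffAt_const.mul (hf.contDiffAt.log hy))

/-- From sin u = 2 sin(u/2) cos(u/2) with u = τ - t; where cos u < 0 both sides are zero. -/
theorem sin_mul_cutoff (τ t : ℝ) :
    Real.sin (τ - t) * (diagCutoff τ t / (2 * Real.cos ((τ - t) / 2)))
      = diagCutoff τ t * Real.sin ((τ - t) / 2) := by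
  rcases lt_or_ge (Real.cos (τ - t)) 0 with h | h
  · rw [diagCutoff_eq_zero h.le]; simp
  · have hs := Real.sin_two_mul ((τ - t) / 2)
    rw [mul_div_cancel₀ _ two_ne_zero] at hs
    have := cos_half_ne_zero h
    rw [hs]
    field_simp

/-! ## Assembly -/

theorem SmoothEntries.smoothBiperiodic {A : ℝ → ℝ → CMat}
    (h : SmoothEntries fun y : ℝ × ℝ => A y.1 y.2) (h₁ : ∀ τ t, A (τ + 2 * Real.pi) t = A τ t)
    (h₂ : ∀ τ t, A τ (t + 2 * Real.pi) = A τ t) : SmoothBiperiodic A :=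
  ⟨h, fun τ t => ⟨h₁ τ t, h₂ τ t⟩⟩

theorem deriv_periodic {x : ℝ → Plane} {T : ℝ} (hx : Function.Periodic x T) :
    Function.Periodic (deriv x) T := by
  intro t
  rw [← deriv_comp_add_const]
  congr 1
  exact funext hx

end Elastodynamics

open Elastodynamics
theorem mainTheorem11 (lam mu om : ℝ) (hmu : 0 < mu) (hlam : -mu < lam) (hom : 0 < om)
    (x : ℝ → Plane) (hx_smooth : ContDiff ℝ ∞ x)
    (hx_per : Function.Periodic x (2 * Real.pi))
    (hx_reg : ∀ t, deriv x t ≠ 0)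
    (hx_simple : ∀ τ t, x τ = x t → ∃ n : ℤ, τ - t = n * (2 * Real.pi)) :
    ∃ Alog Areg Blog Breg Clog Dreg : ℝ → ℝ → CMat,
      SmoothBiperiodic Alog ∧ SmoothBiperiodic Areg ∧ SmoothBiperiodic Blog ∧
      SmoothBiperiodic Breg ∧ SmoothBiperiodic Clog ∧ SmoothBiperiodic Dreg ∧
      ∀ τ t, x τ ≠ x t →
        -- the three splittings
        (kernelV lam mu om x τ t = toC (kernelV0 lam mu x τ t)
          + ((Real.sin ((τ - t) / 2) ^ 2 * Real.log ‖x τ - x t‖ : ℝ) : ℂ) • Alog τ t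
          + Areg τ t) ∧
        (kernelK lam mu om x τ t = toC (kernelK0 lam mu x τ t)
          + ((Real.sin (τ - t) * Real.log ‖x τ - x t‖ : ℝ) : ℂ) • Blog τ t
          + Breg τ t) ∧
        (kernelW lam mu om x τ t = toC (kernelW0 lam mu x τ t)
          + ((Real.log ‖x τ - x t‖ : ℝ) : ℂ) • Clog τ t
          + Dreg τ t) ∧
        -- explicit form of the remainder of `V`
        (((Real.sin ((τ - t) / 2) ^ 2 : ℝ) : ℂ) • Alog τ t = logPartV lam mu om x τ t) ∧
        Areg τ t = regPartV lam mu om x τ t ∧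
        -- explicit form of the remainder of `K`, globally and near the diagonal
        (kernelK lam mu om x τ t = toC (kernelK0 lam mu x τ t)
          + ((Real.log ‖x τ - x t‖ : ℝ) : ℂ) • logPartK lam mu om x τ t
          + regPartK lam mu om x τ t) ∧
        (Real.sqrt 2 / 2 ≤ Real.cos (τ - t) →
          ((Real.sin (τ - t) : ℝ) : ℂ) • Blog τ t = logPartK lam mu om x τ t ∧
          Breg τ t = regPartK lam mu om x τ t) ∧
        -- explicit form of the remainder of `W`
        Clog τ t = logPartW lam mu om x τ t ∧
        Dreg τ t = regPartW lam mu om x τ t := by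
  have hlm : 0 < lam + 2 * mu := by linarith
  have hp := kP_pos (om := om) hlm hom
  have hs := kS_pos (om := om) hmu hom
  have hxd : Differentiable ℝ x := hx_smooth.differentiable (by simp)
  obtain ⟨q, hq, hxq, hq₁, hq₂, hq0⟩ :=
    exists_smooth_chord hx_smooth hx_per hx_reg hx_simple
  have hq0' : ∀ y : ℝ × ℝ, q y.1 y.2 ≠ 0 := fun y => hq0 y.1 y.2
  -- geometry
  have hdx : ContDiff ℝ ∞ (deriv x) := (contDiff_infty_iff_deriv.1 hx_smooth).2
  have hν : ∀ i, ContDiff ℝ ∞ fun t => normalField x t i := by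
    intro i
    fin_cases i
    · exact contDiff_coord hdx 1
    · exact (contDiff_coord hdx 0).neg
  have hn : ∀ i, ContDiff ℝ ∞ fun y : ℝ × ℝ => normalField x y.1 i := fun i =>
    (hν i).comp contDiff_fst
  have hm : ∀ i, ContDiff ℝ ∞ fun y : ℝ × ℝ => normalField x y.2 i := fun i =>
    (hν i).comp contDiff_snd
  have hνp : ∀ t, normalField x (t + 2 * Real.pi) = normalField x t := fun t => by
    simp only [normalField, deriv_periodic hx_per t]
  have hρ : ContDiff ℝ ∞ fun y : ℝ × ℝ => ‖x y.1 - x y.2‖ ^ 2 :=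
    ((hx_smooth.comp contDiff_fst).sub (hx_smooth.comp contDiff_snd)).norm_sq ℝ
  have hw := contDiff_inv_norm_sq hq hq0'
  have hwC := contDiff_ofReal hw
  have hS : ContDiff ℝ ∞ fun y : ℝ × ℝ => ((Real.sin ((y.1 - y.2) / 2) : ℝ) : ℂ) :=
    contDiff_ofReal (by fun_prop)
  have hG := (smoothEntries_matG hq hq0').toC
  have hone : SmoothEntries fun _ : ℝ × ℝ => (1 : CMat) := smoothEntries_const 1
  -- coefficients
  obtain ⟨A2, hA2, eA2⟩ := (smoothInSq_aLog2 (om := om) hp hs).ofReal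
  obtain ⟨A3, hA3, eA3⟩ := (smoothInSq_aLog3 (om := om) hp hs).ofReal
  obtain ⟨A4, hA4, eA4⟩ := smoothInSq_aReg4 (om := om) hp hs
  obtain ⟨A5, hA5, eA5⟩ := smoothInSq_aReg5 (om := om) hp hs
  obtain ⟨B2, hB2, eB2⟩ := (smoothInSq_bLog2 (om := om) hp hs).ofReal
  obtain ⟨B3, hB3, eB3⟩ := (smoothInSq_bLog3 (om := om) hp hs).ofReal
  obtain ⟨B5, hB5, eB5⟩ := smoothInSq_bReg5 (om := om) hp hs
  obtain ⟨B6, hB6, eB6⟩ := smoothInSq_bReg6 (om := om) hp hs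
  obtain ⟨C1, hC1, eC1⟩ := (smoothInSq_cLog1 (om := om) hp hs).ofReal
  obtain ⟨C3, hC3, eC3⟩ := (smoothInSq_cLog3 (om := om) hp hs).ofReal
  obtain ⟨C5, hC5, eC5⟩ := (smoothInSq_cLog5 (om := om) hp hs).ofReal
  obtain ⟨C7, hC7, eC7⟩ := smoothInSq_cReg7 (om := om) hp hs
  obtain ⟨C9, hC9, eC9⟩ := smoothInSq_cReg9 (om := om) hp hs
  obtain ⟨C11, hC11, eC11⟩ := smoothInSq_cReg11 (om := om) hp hs hom.ne'
  simp only at eA2 eA3 eB2 eB3 eC1 eC3 eC5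
  replace hA2 := hA2.comp hρ
  replace hA3 := hA3.comp hρ
  replace hA4 := hA4.comp hρ
  replace hA5 := hA5.comp hρ
  replace hB2 := hB2.comp hρ
  replace hB3 := hB3.comp hρ
  replace hB5 := hB5.comp hρ
  replace hB6 := hB6.comp hρ
  -- The coefficients over r² multiply matrices quadratic in r, so after passing to q the division
  -- is by |q|².
  replace hC1 := (hC1.comp hρ).mul hwC
  replace hC3 := (hC3.comp hρ).mul hwC
  replace hC5 := (hC5.comp hρ).mul hwC
  replace hC7 := (hC7.comp hρ).mul hwC
  replace hC9 := (hC9.comp hρ).mul hwC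
  replace hC11 := (hC11.comp hρ).mul hwC
  -- the cutoff
  have hsin0 : ∀ y : ℝ × ℝ, ‖x y.1 - x y.2‖ ^ 2 = 0 → Real.cos (y.1 - y.2) = 1 := by
    intro y hy
    obtain ⟨k, hk⟩ := hx_simple y.1 y.2 (by simpa [sub_eq_zero] using hy)
    rw [hk, Real.cos_int_mul_two_pi]
  have hcut := contDiff_ofReal contDiff_diagCutoff_div_cos
  have hcutlog := contDiff_ofReal (contDiff_cutoff_mul_log hρ hsin0)
  have hsin1 : ∀ τ t, Real.sin ((τ + 2 * Real.pi - t) / 2) = -Real.sin ((τ - t) / 2) :=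
    fun τ t => by
      rw [show (τ + 2 * Real.pi - t) / 2 = (τ - t) / 2 + Real.pi by ring, Real.sin_add_pi]
  have hsin2 : ∀ τ t, Real.sin ((τ - (t + 2 * Real.pi)) / 2) = -Real.sin ((τ - t) / 2) :=
    fun τ t => by
      rw [show (τ - (t + 2 * Real.pi)) / 2 = (τ - t) / 2 - Real.pi by ring, Real.sin_sub_pi]
  have hcos1 : ∀ τ t, Real.cos ((τ + 2 * Real.pi - t) / 2) = -Real.cos ((τ - t) / 2) :=
    fun τ t => by
      rw [show (τ + 2 * Real.pi - t) / 2 = (τ - t) / 2 + Real.pi by ring, Real.cos_add_pi]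
  have hcos2 : ∀ τ t, Real.cos ((τ - (t + 2 * Real.pi)) / 2) = -Real.cos ((τ - t) / 2) :=
    fun τ t => by
      rw [show (τ - (t + 2 * Real.pi)) / 2 = (τ - t) / 2 - Real.pi by ring, Real.cos_sub_pi]
  have hχ1 : ∀ τ t, diagCutoff (τ + 2 * Real.pi) t = diagCutoff τ t := fun τ t => by
    rw [diagCutoff, show τ + 2 * Real.pi - t = τ - t + 2 * Real.pi by ring, Real.cos_add_two_pi,
      diagCutoff]
  have hχ2 : ∀ τ t, diagCutoff τ (t + 2 * Real.pi) = diagCutoff τ t := fun τ t => by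
    rw [diagCutoff, show τ - (t + 2 * Real.pi) = τ - t - 2 * Real.pi by ring,
      Real.cos_sub_two_pi, diagCutoff]
  have hKlog := smoothEntries_combK lam mu hm hq hq0' hB2 hB3 hA3.neg
  have hKreg := smoothEntries_combK lam mu hm hq hq0' hB5 hB6 hA5.neg
  have hq2 := contDiff_ofReal (hq.norm_sq ℝ)
  have hρC := contDiff_ofReal hρ
  refine ⟨fun τ t => (A2 (‖x τ - x t‖ ^ 2) * ((‖q τ t‖ ^ 2 : ℝ) : ℂ)) • (1 : CMat)
      + (A3 (‖x τ - x t‖ ^ 2) * ((‖q τ t‖ ^ 2 : ℝ) : ℂ)) • toC (matG (q τ t)),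
    fun τ t => A4 (‖x τ - x t‖ ^ 2) • (1 : CMat)
      + (A5 (‖x τ - x t‖ ^ 2) * ((‖x τ - x t‖ ^ 2 : ℝ) : ℂ)) • toC (matG (q τ t)),
    -- Both 1/cos((τ-t)/2) and the combination in q change sign under a 2π-shift, so the product is
    -- periodic.
    fun τ t => ((diagCutoff τ t / (2 * Real.cos ((τ - t) / 2)) : ℝ) : ℂ) •
      combK lam mu (normalField x t) (q τ t) (B2 (‖x τ - x t‖ ^ 2)) (B3 (‖x τ - x t‖ ^ 2))
        (-A3 (‖x τ - x t‖ ^ 2)),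
    -- The second summand is the logarithmic part outside the cutoff; it vanishes where the cutoff
    -- is 1, leaving the explicit regular part near the diagonal.
    fun τ t => ((Real.sin ((τ - t) / 2) : ℝ) : ℂ) •
      (combK lam mu (normalField x t) (q τ t) (B5 (‖x τ - x t‖ ^ 2)) (B6 (‖x τ - x t‖ ^ 2))
        (-A5 (‖x τ - x t‖ ^ 2))
      + (((1 - diagCutoff τ t) * (1 / 2 * Real.log (‖x τ - x t‖ ^ 2)) : ℝ) : ℂ) •
        combK lam mu (normalField x t) (q τ t) (B2 (‖x τ - x t‖ ^ 2)) (B3 (‖x τ - x t‖ ^ 2))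
          (-A3 (‖x τ - x t‖ ^ 2))),
    fun τ t => combW lam mu (normalField x τ) (normalField x t) (q τ t)
      (C1 (‖x τ - x t‖ ^ 2) * ((1 / ‖q τ t‖ ^ 2 : ℝ) : ℂ)) (B2 (‖x τ - x t‖ ^ 2))
      (C3 (‖x τ - x t‖ ^ 2) * ((1 / ‖q τ t‖ ^ 2 : ℝ) : ℂ)) (B3 (‖x τ - x t‖ ^ 2))
      (C5 (‖x τ - x t‖ ^ 2) * ((1 / ‖q τ t‖ ^ 2 : ℝ) : ℂ)) (-A3 (‖x τ - x t‖ ^ 2)),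
    fun τ t => combW lam mu (normalField x τ) (normalField x t) (q τ t)
      (C7 (‖x τ - x t‖ ^ 2) * ((1 / ‖q τ t‖ ^ 2 : ℝ) : ℂ)) (B5 (‖x τ - x t‖ ^ 2))
      (C9 (‖x τ - x t‖ ^ 2) * ((1 / ‖q τ t‖ ^ 2 : ℝ) : ℂ)) (B6 (‖x τ - x t‖ ^ 2))
      (C11 (‖x τ - x t‖ ^ 2) * ((1 / ‖q τ t‖ ^ 2 : ℝ) : ℂ)) (-A5 (‖x τ - x t‖ ^ 2)),
    ?_, ?_, ?_, ?_, ?_, ?_, ?_⟩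
  · refine ((hone.smul (hA2.mul hq2)).add (hG.smul (hA3.mul hq2))).smoothBiperiodic
      (fun τ t => ?_) (fun τ t => ?_)
    · simp only [hx_per τ, hq₁, norm_neg, matG_neg]
    · simp only [hx_per t, hq₂, norm_neg, matG_neg]
  · refine ((hone.smul hA4).add (hG.smul (hA5.mul hρC))).smoothBiperiodic
      (fun τ t => ?_) (fun τ t => ?_)
    · simp only [hx_per τ, hq₁, matG_neg]
    · simp only [hx_per t, hq₂, matG_neg]
  · refine (hKlog.smul hcut).smoothBiperiodic (fun τ t => ?_) (fun τ t => ?_)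
    · simp only [hx_per τ, hq₁, combK_neg, hχ1, hcos1, mul_neg, div_neg, Complex.ofReal_neg,
        neg_smul, smul_neg, neg_neg]
    · simp only [hx_per t, hq₂, combK_neg, hχ2, hcos2, hνp, mul_neg, div_neg,
        Complex.ofReal_neg, neg_smul, smul_neg, neg_neg]
  · refine ((hKreg.add (hKlog.smul hcutlog)).smul hS).smoothBiperiodic
      (fun τ t => ?_) (fun τ t => ?_)
    · simp only [hx_per τ, hq₁, combK_neg, hχ1, hsin1, Complex.ofReal_neg, neg_smul, smul_neg,
        ← neg_add, neg_neg]
    · simp only [hx_per t, hq₂, combK_neg, hχ2, hsin2, hνp, Complex.ofReal_neg, neg_smul,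
        smul_neg, ← neg_add, neg_neg]
  · refine (smoothEntries_combW lam mu hn hm hq hq0' hC1 hB2 hC3 hB3 hC5
      hA3.neg).smoothBiperiodic (fun τ t => ?_) (fun τ t => ?_)
    · simp only [hx_per τ, hq₁, combW_neg, norm_neg, hνp]
    · simp only [hx_per t, hq₂, combW_neg, norm_neg, hνp]
  · refine (smoothEntries_combW lam mu hn hm hq hq0' hC7 hB5 hC9 hB6 hC11
      hA5.neg).smoothBiperiodic (fun τ t => ?_) (fun τ t => ?_)
    · simp only [hx_per τ, hq₁, combW_neg, norm_neg, hνp]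
    · simp only [hx_per t, hq₂, combW_neg, norm_neg, hνp]
  intro τ t hxy
  beta_reduce
  have hz : 0 < ‖x τ - x t‖ := norm_pos_iff.2 (sub_ne_zero.2 hxy)
  -- Off the diagonal the sine is nonzero, so homogeneity applies with this factor.
  have hS0 : Real.sin ((τ - t) / 2) ≠ 0 := fun h =>
    sub_ne_zero.2 hxy (by rw [hxq, h, zero_smul])
  have hnorm : ‖x τ - x t‖ ^ 2 = Real.sin ((τ - t) / 2) ^ 2 * ‖q τ t‖ ^ 2 := by
    rw [hxq, norm_smul, mul_pow, Real.norm_eq_abs, sq_abs]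
  have hlog : 1 / 2 * Real.log (‖x τ - x t‖ ^ 2) = Real.log ‖x τ - x t‖ := by
    rw [Real.log_pow]; push_cast; ring
  have hGq : matG (x τ - x t) = matG (q τ t) := by rw [hxq, matG_smul _ hS0]
  have hlogV : ((Real.sin ((τ - t) / 2) ^ 2 : ℝ) : ℂ) •
      ((A2 (‖x τ - x t‖ ^ 2) * ((‖q τ t‖ ^ 2 : ℝ) : ℂ)) • (1 : CMat)
        + (A3 (‖x τ - x t‖ ^ 2) * ((‖q τ t‖ ^ 2 : ℝ) : ℂ)) • toC (matG (q τ t)))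
      = logPartV lam mu om x τ t := by
    have h1 : toC (1 : RMat) = 1 := by ext i j; simp [toC, Matrix.one_apply]; split_ifs <;> simp
    have h2 : ∀ M N : RMat, toC (M + N) = toC M + toC N := fun M N => by ext i j; simp [toC]
    simp only [logPartV, h2, toC_smul, h1]
    rw [hGq, Complex.ofReal_mul, eA2 _ hz, Complex.ofReal_mul, eA3 _ hz]
    generalize A2 (‖x τ - x t‖ ^ 2) = a
    generalize A3 (‖x τ - x t‖ ^ 2) = b
    rw [hnorm, Complex.ofReal_mul]
    module
  have hregV : A4 (‖x τ - x t‖ ^ 2) • (1 : CMat)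
      + (A5 (‖x τ - x t‖ ^ 2) * ((‖x τ - x t‖ ^ 2 : ℝ) : ℂ)) • toC (matG (q τ t))
      = regPartV lam mu om x τ t := by
    simp only [regPartV]
    rw [hGq, eA4 _ hz, eA5 _ hz, Complex.ofReal_pow]
  have hlogK : logPartK lam mu om x τ t = ((Real.sin ((τ - t) / 2) : ℝ) : ℂ) •
      combK lam mu (normalField x t) (q τ t) (B2 (‖x τ - x t‖ ^ 2)) (B3 (‖x τ - x t‖ ^ 2))
        (-A3 (‖x τ - x t‖ ^ 2)) := by
    rw [← combK_smul _ _ _ _ _ _ _ hS0, ← hxq, logPartK_eq, eB2 _ hz, eB3 _ hz, bLog4,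
      Complex.ofReal_neg, eA3 _ hz]
  have hregK : regPartK lam mu om x τ t = ((Real.sin ((τ - t) / 2) : ℝ) : ℂ) •
      combK lam mu (normalField x t) (q τ t) (B5 (‖x τ - x t‖ ^ 2)) (B6 (‖x τ - x t‖ ^ 2))
        (-A5 (‖x τ - x t‖ ^ 2)) := by
    rw [← combK_smul _ _ _ _ _ _ _ hS0, ← hxq, ← eB5 _ hz, ← eB6 _ hz, ← eA5 _ hz]
    rfl
  have hsq : ∀ c : ℂ, ((Real.sin ((τ - t) / 2) : ℝ) : ℂ) ^ 2 * (c / (‖x τ - x t‖ : ℂ) ^ 2)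
      = c * ((1 / ‖q τ t‖ ^ 2 : ℝ) : ℂ) := fun c => by
    have h1 : ((‖x τ - x t‖ : ℝ) : ℂ) ^ 2
        = ((Real.sin ((τ - t) / 2) : ℝ) : ℂ) ^ 2 * ((‖q τ t‖ ^ 2 : ℝ) : ℂ) := by
      exact_mod_cast hnorm
    have h2 : ((Real.sin ((τ - t) / 2) : ℝ) : ℂ) ≠ 0 := by exact_mod_cast hS0
    have h3 : ((‖q τ t‖ ^ 2 : ℝ) : ℂ) ≠ 0 := by
      exact_mod_cast pow_ne_zero 2 (norm_ne_zero_iff.2 (hq0 τ t))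
    rw [h1, Complex.ofReal_div, Complex.ofReal_one]
    field_simp
  have hlogW : combW lam mu (normalField x τ) (normalField x t) (q τ t)
      (C1 (‖x τ - x t‖ ^ 2) * ((1 / ‖q τ t‖ ^ 2 : ℝ) : ℂ)) (B2 (‖x τ - x t‖ ^ 2))
      (C3 (‖x τ - x t‖ ^ 2) * ((1 / ‖q τ t‖ ^ 2 : ℝ) : ℂ)) (B3 (‖x τ - x t‖ ^ 2))
      (C5 (‖x τ - x t‖ ^ 2) * ((1 / ‖q τ t‖ ^ 2 : ℝ) : ℂ)) (-A3 (‖x τ - x t‖ ^ 2))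
      = logPartW lam mu om x τ t := by
    rw [← hsq, ← hsq, ← hsq, ← combW_smul _ _ _ _ _ _ _ _ _ _ _ hS0, ← hxq, logPartW_eq, bLog4]
    simp only [Complex.ofReal_div, Complex.ofReal_pow, Complex.ofReal_neg, eB2 _ hz, eB3 _ hz,
      eA3 _ hz, eC1 _ hz, eC3 _ hz, eC5 _ hz]
  have hregW : combW lam mu (normalField x τ) (normalField x t) (q τ t)
      (C7 (‖x τ - x t‖ ^ 2) * ((1 / ‖q τ t‖ ^ 2 : ℝ) : ℂ)) (B5 (‖x τ - x t‖ ^ 2))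
      (C9 (‖x τ - x t‖ ^ 2) * ((1 / ‖q τ t‖ ^ 2 : ℝ) : ℂ)) (B6 (‖x τ - x t‖ ^ 2))
      (C11 (‖x τ - x t‖ ^ 2) * ((1 / ‖q τ t‖ ^ 2 : ℝ) : ℂ)) (-A5 (‖x τ - x t‖ ^ 2))
      = regPartW lam mu om x τ t := by
    rw [← hsq, ← hsq, ← hsq, ← combW_smul _ _ _ _ _ _ _ _ _ _ _ hS0, ← hxq, ← eB5 _ hz,
      ← eB6 _ hz, ← eA5 _ hz, ← eC7 _ hz, ← eC9 _ hz, ← eC11 _ hz]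
    rfl
  have hsplitK := kernelK_split (om := om) hmu hlm hom hxd hxy
  have hcutK : ((Real.sin (τ - t) : ℝ) : ℂ)
        * ((diagCutoff τ t / (2 * Real.cos ((τ - t) / 2)) : ℝ) : ℂ)
      = (diagCutoff τ t : ℂ) * ((Real.sin ((τ - t) / 2) : ℝ) : ℂ) := by
    exact_mod_cast sin_mul_cutoff τ t
  refine ⟨?_, ?_, ?_, hlogV, hregV, hsplitK, fun hc => ⟨?_, ?_⟩, hlogW, hregW⟩
  · rw [kernelV_split hmu hlm hom hxy, ← hregV, ← hlogV, smul_smul, ← Complex.ofReal_mul,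
      mul_comm (Real.log _)]
  -- The cutoff share χ and the complement 1 - χ of the logarithmic term add up to the full one.
  · rw [hsplitK, hlogK, hregK, hlog, Complex.ofReal_mul, Complex.ofReal_mul, smul_smul (_ * _),
      mul_right_comm, hcutK]
    push_cast
    module
  · rw [kernelW_split hmu hlm hom hxd hxy, hlogW, hregW]
  · rw [smul_smul, hcutK, hlogK, diagCutoff_eq_one hc, Complex.ofReal_one, one_mul]
  · simp only [diagCutoff_eq_one hc, sub_self, zero_mul, Complex.ofReal_zero, zero_smul, add_zero]
    rw [hregK]
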